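/- Fix an integer $n\ge 0$. Let $V_n=\{(i,j)\in\mathbb Z^2 : |i|+|j|\le n,\ j\le 0,\ i+j\equiv n \pmod 2\}$, a triangular array of points in the triangular lattice in which neighbouring points differ by $(\pm2,0)$ or $(\pm1,\pm1)$. A *simplified grove of size $n$* is an acyclic graph $G$ with vertex set $V_n$, all of whose edges join neighbouring points, such that every connected component of $G$ contains exactly one of the following sets, and each of these sets is contained in some component: - $\{(-n,0)\}$, $\{(n,0)\}$, $\{(0,-n)\}$; - $\{(-i,0),(\frac{-n-i}{2},\frac{-n+i}{2})\}$ and $\{(i,0),(\frac{n+i}{2},\frac{-n+i}{2})\}$ for $0<i<n$, $i\equiv n \pmod 2$; - $\{(-n+i,-i),(n-i,-i)\}$ for $\frac n2<i<n$; - $\{(0,0),(-\frac n2,-\frac n2),(\frac n2,-\frac n2)\}$ if $n$ is even. A downward triangle is a triple $(a,b),(a-1,b+1),(a+1,b+1)$ of points of $V_n$. The downward triangles form a triangular array with rows of $n,n-1,\dots,1$ entries from top to bottom. An *alternating sign triangle of size $n$* is an array obtained from a simplified grove of size $n$ by giving each downward triangle the entry $1-e$, where $e$ is the number of edges of the grove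 in that triangle. The *identity triangle* is the array whose entry at position $r$ of row $r$ is $1$ for each $r$ with $1\le r\le \frac{n+1}{2}$ (rows and positions counted from the top and from the left, starting at $1$), and whose other entries are $0$. **Theorem.** From every alternating sign triangle $A$ of size $n$, the identity triangle of size $n$ can be obtained by a finite (possibly empty) sequence of steps in which all arrays are alternating sign triangles, and each step adds one of the three sub-triangles $$\begin{matrix}-1&&1\\&0&\end{matrix}\qquad \begin{matrix}1&&0\\&-1&\end{matrix}\qquad \begin{matrix}0&&-1\\&1&\end{matrix}$$ to three entries of the array: those at positions $p$ and $p+1$ of some row $r$ (upper left and upper right) and at position $p$ of row $r+1$ (below), where $1\le r$ and $1\le p\le n-r$. -/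

import Mathlib

namespace SignTriangles

/-- The lattice points of the triangle of size `n`: the points `(i, j)` with `|i| + |j| ≤ n`,
`j ≤ 0` and `i + j ≡ n (mod 2)`.  It has the corners `(-n, 0)`, `(n, 0)`, `(0, -n)`, and the row
at depth `d = -j` has `n + 1 - d` points. -/
def points (n : ℕ) : Set (ℤ × ℤ) :=
  {v | |v.1| + |v.2| ≤ (n : ℤ) ∧ v.2 ≤ 0 ∧ v.1 + v.2 ≡ (n : ℤ) [ZMOD 2]}

/-- Two lattice points are neighbours when they differ by one of the six vectors
`(±2, 0)`, `(±1, ±1)` of the triangular lattice. -/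
def Neighbours (u v : ℤ × ℤ) : Prop :=
  (|u.1 - v.1| = 2 ∧ u.2 = v.2) ∨ (|u.1 - v.1| = 1 ∧ |u.2 - v.2| = 1)

/-- The sets of boundary points that the components of a simplified grove have to connect.
All divisions by two are exact. -/
def boundaryParts (n : ℕ) : Set (Set (ℤ × ℤ)) :=
  {P | P = {(-(n : ℤ), 0)} ∨ P = {((n : ℤ), 0)} ∨ P = {(0, -(n : ℤ))} ∨
    (∃ i : ℤ, 0 < i ∧ i < n ∧ i ≡ (n : ℤ) [ZMOD 2] ∧
      P = {(-i, 0), ((-(n : ℤ) - i) / 2, (-(n : ℤ) + i) / 2)}) ∨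
    (∃ i : ℤ, 0 < i ∧ i < n ∧ i ≡ (n : ℤ) [ZMOD 2] ∧
      P = {(i, 0), (((n : ℤ) + i) / 2, (-(n : ℤ) + i) / 2)}) ∨
    (∃ i : ℤ, (n : ℤ) < 2 * i ∧ i < n ∧ P = {(-(n : ℤ) + i, -i), ((n : ℤ) - i, -i)}) ∨
    (Even n ∧
      P = {(0, 0), (-((n : ℤ) / 2), -((n : ℤ) / 2)), ((n : ℤ) / 2, -((n : ℤ) / 2))})}

/-- A simplified grove of size `n`: an acyclic graph on the points of the triangle, with edges
between neighbouring lattice points, such that every component contains exactly one of the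
boundary sets and every boundary set is contained in some component. -/
structure IsGrove (n : ℕ) (G : SimpleGraph (points n)) : Prop where
  lattice : ∀ u v : points n, G.Adj u v → Neighbours u v
  acyclic : G.IsAcyclic
  component_contains : ∀ K : G.ConnectedComponent,
    ∃! P : Set (ℤ × ℤ), P ∈ boundaryParts n ∧ P ⊆ Subtype.val '' K.supp
  contained_in_component : ∀ P ∈ boundaryParts n,
    ∃ K : G.ConnectedComponent, P ⊆ Subtype.val '' K.supp

/-- The vertices of the downward triangle (of side one) with lower vertex `c`. -/
def downTriangle (c : ℤ × ℤ) : Set (ℤ × ℤ) :=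
  {c, (c.1 - 1, c.2 + 1), (c.1 + 1, c.2 + 1)}

/-- The downward triangles in the triangle of size `n`, named by their lower vertices.  They are
the positions of the entries of a triangular array whose rows have `n`, `n - 1`, …, `1` entries:
position `p` of row `r` (counted from one) has lower vertex `(-n + r + 2 * (p - 1), -r)`. -/
def cells (n : ℕ) : Set (ℤ × ℤ) := {c | downTriangle c ⊆ points n}

/-- Triangular arrays of integers, indexed by the downward triangles. -/
abbrev TriArray (n : ℕ) : Type := cells n → ℤ

/-- The array of a graph `G`: the entry of a downward triangle is `1 - e`, where `e` is the number
of edges of `G` in this triangle. -/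
noncomputable def arrayOf {n : ℕ} (G : SimpleGraph (points n)) : TriArray n := fun c =>
  1 - (({e ∈ G.edgeSet | ∀ v ∈ e, (v : ℤ × ℤ) ∈ downTriangle c}.ncard : ℕ) : ℤ)

/-- Alternating sign triangles of size `n`: the arrays of the simplified groves of size `n`. -/
def IsAlternatingSignTriangle {n : ℕ} (A : TriArray n) : Prop :=
  ∃ G : SimpleGraph (points n), IsGrove n G ∧ A = arrayOf G

/-- The array with entry `x` at the downward triangle to the left of the upward triangle with top
vertex `u`, entry `y` at the one to its right, entry `z` at the one below it, and `0` elsewhere: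
```
x   y
  z
```
-/
def subTriangle (n : ℕ) (u : ℤ × ℤ) (x y z : ℤ) : TriArray n := fun c =>
  if (c : ℤ × ℤ) = (u.1 - 1, u.2 - 1) then x
  else if (c : ℤ × ℤ) = (u.1 + 1, u.2 - 1) then y
  else if (c : ℤ × ℤ) = (u.1, u.2 - 2) then z
  else 0

/-- `B` arises from `A` by adding one of the three sub-triangles, at a place where all three of its
entries lie inside the array. -/
def AddsSubTriangle {n : ℕ} (A B : TriArray n) : Prop :=
  ∃ u : ℤ × ℤ, (u.1 - 1, u.2 - 1) ∈ cells n ∧ (u.1 + 1, u.2 - 1) ∈ cells n ∧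
    (u.1, u.2 - 2) ∈ cells n ∧
    (B = A + subTriangle n u (-1) 1 0 ∨
     B = A + subTriangle n u 1 0 (-1) ∨
     B = A + subTriangle n u 0 (-1) 1)

/-- The identity triangle: in row `r` the entry at position `r` (if the row is long enough) is `1`,
all other entries are `0`.  With `c = (-n + r + 2 * (p - 1), -r)`, the condition `p = r` reads
`c.1 = -n - 3 * c.2 - 2`. -/
def identityTriangle (n : ℕ) : TriArray n := fun c =>
  if (c : ℤ × ℤ).1 = -(n : ℤ) - 3 * (c : ℤ × ℤ).2 - 2 then 1 else 0

end SignTriangles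

/-! In skew coordinates a grove is a spanning forest of a triangular piece of the lattice. Its
components are the level sets of a labeling `c` that agrees with `idLabel` on the boundary and takes
no value in the interior that is absent from the boundary (`Valid`, `Forest`). Each lattice edge
lies in exactly one downward triangle. Exchanging an edge in the downward triangle `p` for one in
`q` therefore adds 1 to the entry at `p` and subtracts 1 at `q`. The three sub-triangles are exactly
the three cyclic displacements from `p` to `q` around an upward triangle (`Allowed`). Going the
wrong way round takes two permitted moves.

Fixed labeling. Any two forests with the same components are connected by rotations, each exchanging
one edge of a unit triangle for another (`Forest.reflTransGen_rotates`). The argument is planar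
topology mod 2. A new edge closes a loop in the forest, and this loop bounds a set of triangles.
Since every component reaches the boundary, the loop encloses only points of its own component. An
edge of the loop can then be moved across the enclosed triangles one by one, by induction on their
number (`exchange`). A rotation costs at most two moves of the array (`Rotates.reach`).

Changing the labeling. If an interior point can be removed from its component without disconnecting
it, some forest with the same labels has this point as a leaf. Turning the leaf edge around the
point, in the permitted direction, attaches it to any neighbour (`Forest.exists_update`). It remains
to transform labelings by such changes.

Reaching the identity labeling. Maximise the number of horizontal pairs of neighbours with equal
labels. At a maximum no interior horizontal run can be split off without disconnecting its component
(`Tight`), and this forces every component to meet each row in a segment (`Tight.convex`). The lower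
half is then determined by the boundary, while in the upper half the rows increase weakly and in
steps of at most one. Among the maxima take one with the least sum of labels. If it differs from
`idLabel`, the largest misplaced label has a removable left tip whose label can be lowered by one at
no cost in equal pairs (`Tight.exists_decrease`), a contradiction. Hence `idLabel` is reached, and
the fixed-labeling argument leads on to the identity configuration. -/

namespace SignTriangles

/-! ### The triangular array of lattice points in skew coordinates -/

/-- The point at position `p.1` of row `p.2` (both counted from zero) is a point of the triangle. -/
def InTri (n : ℕ) (p : ℤ × ℤ) : Prop := 0 ≤ p.1 ∧ 0 ≤ p.2 ∧ p.1 + p.2 ≤ n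

instance (n : ℕ) (p : ℤ × ℤ) : Decidable (InTri n p) := by unfold InTri; infer_instance

/-- Adjacency of lattice points in skew coordinates. -/
def Nb (p q : ℤ × ℤ) : Prop :=
  q = (p.1 + 1, p.2) ∨ p = (q.1 + 1, q.2) ∨ q = (p.1, p.2 + 1) ∨ p = (q.1, q.2 + 1) ∨
    q = (p.1 - 1, p.2 + 1) ∨ p = (q.1 - 1, q.2 + 1)

theorem Nb.symm {p q : ℤ × ℤ} (h : Nb p q) : Nb q p := by
  unfold Nb at *; tauto

theorem Nb.ne {p q : ℤ × ℤ} (h : Nb p q) : p ≠ q := by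
  rintro rfl
  simp [Nb, Prod.ext_iff] at h

/-- The graph of all lattice edges in the triangle. -/
def lat (n : ℕ) : SimpleGraph (ℤ × ℤ) where
  Adj p q := InTri n p ∧ InTri n q ∧ Nb p q
  symm := ⟨fun _ _ h => ⟨h.2.1, h.1, h.2.2.symm⟩⟩
  loopless := ⟨fun _ h => h.2.2.ne rfl⟩

/-- The corners of a unit triangle: `(i, j, true)` is the downward triangle with upper left corner
`(i, j)`, and `(i, j, false)` is the upward triangle to its right. -/
def corners : ℤ × ℤ × Bool → Finset (ℤ × ℤ)
  | (i, j, true) => {(i, j), (i + 1, j), (i, j + 1)}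
  | (i, j, false) => {(i + 1, j), (i, j + 1), (i + 1, j + 1)}

/-- The unit triangles of the triangle of size `n`. -/
noncomputable def trs (n : ℕ) : Finset (ℤ × ℤ × Bool) :=
  (Finset.Icc (0 : ℤ) n ×ˢ Finset.Icc (0 : ℤ) n ×ˢ Finset.univ).filter
    fun t => ∀ p ∈ corners t, InTri n p

theorem mem_trs_down {n : ℕ} {i j : ℤ} :
    (i, j, true) ∈ trs n ↔ 0 ≤ i ∧ 0 ≤ j ∧ i + j + 1 ≤ n := by
  rw [trs, Finset.mem_filter]
  simp only [corners, InTri, Finset.mem_product, Finset.mem_Icc,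
    Finset.mem_univ, and_true, Finset.mem_insert, Finset.mem_singleton, forall_eq_or_imp,
    forall_eq]
  omega

theorem mem_trs_up {n : ℕ} {i j : ℤ} :
    (i, j, false) ∈ trs n ↔ 0 ≤ i ∧ 0 ≤ j ∧ i + j + 2 ≤ n := by
  rw [trs, Finset.mem_filter]
  simp only [corners, InTri, Finset.mem_product, Finset.mem_Icc,
    Finset.mem_univ, and_true, Finset.mem_insert, Finset.mem_singleton, forall_eq_or_imp,
    forall_eq]
  omega

theorem inTri_of_mem_corners {n : ℕ} {t : ℤ × ℤ × Bool} (ht : t ∈ trs n) {p : ℤ × ℤ}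
    (hp : p ∈ corners t) : InTri n p := by
  simp only [trs, Finset.mem_filter] at ht
  exact ht.2 p hp

theorem nb_of_mem_corners {t : ℤ × ℤ × Bool} {p q : ℤ × ℤ} (hp : p ∈ corners t)
    (hq : q ∈ corners t) (hne : p ≠ q) : Nb p q := by
  obtain ⟨i, j, b⟩ := t
  obtain ⟨p1, p2⟩ := p
  obtain ⟨q1, q2⟩ := q
  cases b <;> simp [corners, Nb, Prod.ext_iff] at * <;> omega

theorem card_corners (t : ℤ × ℤ × Bool) : (corners t).card = 3 := by
  obtain ⟨i, j, b⟩ := t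
  cases b <;> simp only [corners] <;> rw [Finset.card_eq_three]
  · exact ⟨_, _, _, by simp, by simp, by simp, rfl⟩
  · exact ⟨_, _, _, by simp, by simp, by simp, rfl⟩

/-- Two distinct corners of a unit triangle have a unique third one. -/
theorem exists_third_corner {t : ℤ × ℤ × Bool} {u v : ℤ × ℤ} (hu : u ∈ corners t)
    (hv : v ∈ corners t) (huv : u ≠ v) :
    ∃ w, w ≠ u ∧ w ≠ v ∧ corners t = {u, v, w} := by
  have hc : (((corners t).erase u).erase v).card = 1 := by
    rw [Finset.card_erase_of_mem (Finset.mem_erase.2 ⟨huv.symm, hv⟩), Finset.card_erase_of_mem hu,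
      card_corners]
  obtain ⟨w, hw⟩ := Finset.card_eq_one.1 hc
  have hw' : w ∈ ((corners t).erase u).erase v := by rw [hw]; simp
  simp only [Finset.mem_erase] at hw'
  refine ⟨w, hw'.2.1, hw'.1, ?_⟩
  rw [← Finset.insert_erase hu, ← Finset.insert_erase (Finset.mem_erase.2 ⟨huv.symm, hv⟩), hw]

/-! ### Boundaries of sets of unit triangles -/

/-- The number of triangles of `D` that contain both `x` and `y`. -/
def cnt (D : Finset (ℤ × ℤ × Bool)) (x y : ℤ × ℤ) : ℕ :=
  (D.filter fun t => x ∈ corners t ∧ y ∈ corners t).card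

theorem cnt_comm (D : Finset (ℤ × ℤ × Bool)) (x y : ℤ × ℤ) : cnt D x y = cnt D y x := by
  simp only [cnt, and_comm]

theorem cnt_congr (D : Finset (ℤ × ℤ × Bool)) {x y a b : ℤ × ℤ} (h : s(x, y) = s(a, b)) :
    cnt D x y = cnt D a b := by
  rcases Sym2.eq_iff.1 h with ⟨rfl, rfl⟩ | ⟨rfl, rfl⟩
  · rfl
  · exact cnt_comm _ _ _

/-- In the plane an edge belongs to exactly two unit triangles, so it is on the mod 2 boundary of
`D` exactly when one of the two is in `D`. This is the common form for the three edge directions. -/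
theorem odd_card_filter_pair {α : Type*} [DecidableEq α] (D : Finset α) (P : α → Prop)
    [DecidablePred P] {a b : α} (hab : a ≠ b) (h : ∀ t, P t ↔ t = a ∨ t = b) :
    Odd (D.filter P).card ↔ ¬ (a ∈ D ↔ b ∈ D) := by
  have : D.filter P = ({a, b} : Finset α) ∩ D := by
    ext t; simp [h]; tauto
  rw [this]
  by_cases ha : a ∈ D <;> by_cases hb : b ∈ D <;>
    simp [Finset.insert_inter_of_mem, Finset.insert_inter_of_notMem,
      Finset.singleton_inter_of_mem, Finset.singleton_inter_of_notMem, ha, hb, hab]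

theorem odd_cnt_horizontal (D : Finset (ℤ × ℤ × Bool)) (i j : ℤ) :
    Odd (cnt D (i, j) (i + 1, j)) ↔ ¬ ((i, j, true) ∈ D ↔ (i, j - 1, false) ∈ D) := by
  refine odd_card_filter_pair _ _ (by simp) ?_
  rintro ⟨k, l, b⟩
  cases b <;> simp [corners, Prod.ext_iff] <;> omega

theorem odd_cnt_vertical (D : Finset (ℤ × ℤ × Bool)) (i j : ℤ) :
    Odd (cnt D (i, j) (i, j + 1)) ↔ ¬ ((i, j, true) ∈ D ↔ (i - 1, j, false) ∈ D) := by
  refine odd_card_filter_pair _ _ (by simp) ?_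
  rintro ⟨k, l, b⟩
  cases b <;> simp [corners, Prod.ext_iff] <;> omega

theorem odd_cnt_slash (D : Finset (ℤ × ℤ × Bool)) (i j : ℤ) :
    Odd (cnt D (i + 1, j) (i, j + 1)) ↔ ¬ ((i, j, true) ∈ D ↔ (i, j, false) ∈ D) := by
  refine odd_card_filter_pair _ _ (by simp) ?_
  rintro ⟨k, l, b⟩
  cases b <;> simp [corners, Prod.ext_iff] <;> omega

theorem cnt_union {D E : Finset (ℤ × ℤ × Bool)} (h : Disjoint D E) (x y : ℤ × ℤ) :
    cnt (D ∪ E) x y = cnt D x y + cnt E x y := by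
  rw [cnt, Finset.filter_union, Finset.card_union_of_disjoint]
  · rfl
  · exact Finset.disjoint_filter_filter h

theorem cnt_sdiff {D E : Finset (ℤ × ℤ × Bool)} (h : E ⊆ D) (x y : ℤ × ℤ) :
    cnt D x y = cnt (D \ E) x y + cnt E x y := by
  rw [← cnt_union Finset.sdiff_disjoint, Finset.sdiff_union_of_subset h]

/-- The mod 2 boundary is additive, with `symmDiff` as addition of sets of triangles. -/
theorem odd_cnt_symmDiff (D E : Finset (ℤ × ℤ × Bool)) (x y : ℤ × ℤ) :
    Odd (cnt (symmDiff D E) x y) ↔ ¬ (Odd (cnt D x y) ↔ Odd (cnt E x y)) := by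
  have h1 := cnt_sdiff (D := D) (E := D ∩ E) Finset.inter_subset_left x y
  have h2 := cnt_sdiff (D := E) (E := D ∩ E) Finset.inter_subset_right x y
  have h3 : cnt (symmDiff D E) x y = cnt (D \ (D ∩ E)) x y + cnt (E \ (D ∩ E)) x y := by
    rw [← cnt_union]
    · congr 1; ext t; simp [Finset.mem_symmDiff]
    · rw [Finset.disjoint_left]; intro t; simp; tauto
  rw [h1, h2, h3]
  simp only [Nat.odd_iff]; omega

theorem cnt_singleton (t : ℤ × ℤ × Bool) (x y : ℤ × ℤ) :
    cnt {t} x y = if x ∈ corners t ∧ y ∈ corners t then 1 else 0 := by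
  rw [cnt, Finset.filter_singleton]; split_ifs <;> simp

theorem exists_mem_of_odd_cnt {D : Finset (ℤ × ℤ × Bool)} {x y : ℤ × ℤ} (h : Odd (cnt D x y)) :
    ∃ t ∈ D, x ∈ corners t ∧ y ∈ corners t := by
  have : 0 < (D.filter fun t => x ∈ corners t ∧ y ∈ corners t).card := h.pos
  obtain ⟨t, ht⟩ := Finset.card_pos.1 this
  exact ⟨t, (Finset.mem_filter.1 ht).1, (Finset.mem_filter.1 ht).2⟩

/-- The boundary of a set of triangles crosses every cut an even number of times. -/
theorem exists_other_of_odd_cnt {D : Finset (ℤ × ℤ × Bool)} (U : ℤ × ℤ → Prop) {u v : ℤ × ℤ}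
    (hu : U u) (hv : ¬ U v) (h : Odd (cnt D u v)) :
    ∃ x y, U x ∧ ¬ U y ∧ Odd (cnt D x y) ∧ (x ≠ u ∨ y ≠ v) := by
  classical
  by_contra hcon
  push Not at hcon
  set P : Finset (ℤ × ℤ) := D.biUnion corners with hP
  have hmem : ∀ t ∈ D, corners t ⊆ P := fun t ht => Finset.subset_biUnion_of_mem corners ht
  -- Double counting of the pairs across the cut, by pairs and by triangles.
  have key : ∑ x ∈ P.filter U, ∑ y ∈ P.filter (fun y => ¬ U y), cnt D x y =
      ∑ t ∈ D, ((corners t).filter U).card * ((corners t).filter (fun y => ¬ U y)).card := by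
    simp only [cnt, Finset.card_filter]
    rw [Finset.sum_congr rfl fun x _ => Finset.sum_comm, Finset.sum_comm]
    refine Finset.sum_congr rfl fun t ht => ?_
    rw [← Finset.card_filter, ← Finset.card_filter, ← Finset.card_product, Finset.card_eq_sum_ones]
    rw [← Finset.sum_product', ← Finset.sum_filter]
    refine Finset.sum_congr ?_ fun _ _ => rfl
    ext ⟨x, y⟩
    simp only [Finset.mem_filter, Finset.mem_product]
    have := @hmem t ht x
    have := @hmem t ht y
    tauto
  have heven : Even (∑ t ∈ D, ((corners t).filter U).card *
      ((corners t).filter (fun y => ¬ U y)).card) := by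
    refine Finset.even_sum _ fun t _ => ?_
    -- A triangle split as `a + b = 3` by the cut contributes `a * b`, which is 0 or 2.
    have h1 : ((corners t).filter U).card + ((corners t).filter (fun y => ¬ U y)).card = 3 := by
      rw [Finset.card_filter_add_card_filter_not, card_corners]
    generalize ((corners t).filter U).card = a at *
    generalize ((corners t).filter (fun y => ¬ U y)).card = b at *
    have : a = 0 ∧ b = 3 ∨ a = 1 ∧ b = 2 ∨ a = 2 ∧ b = 1 ∨ a = 3 ∧ b = 0 := by omega
    rcases this with ⟨rfl, rfl⟩ | ⟨rfl, rfl⟩ | ⟨rfl, rfl⟩ | ⟨rfl, rfl⟩ <;> decide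
  obtain ⟨t, ht, htu, htv⟩ := exists_mem_of_odd_cnt h
  have huP : u ∈ P.filter U := Finset.mem_filter.2 ⟨hmem t ht htu, hu⟩
  have hvP : v ∈ P.filter (fun y => ¬ U y) := Finset.mem_filter.2 ⟨hmem t ht htv, hv⟩
  have heq : ∀ x ∈ P.filter U, ∀ y ∈ P.filter (fun y => ¬ U y), ¬ (x = u ∧ y = v) →
      Even (cnt D x y) := by
    intro x hx y hy hxy
    by_contra hodd
    rw [Nat.not_even_iff_odd] at hodd
    have := hcon x y (Finset.mem_filter.1 hx).2 (Finset.mem_filter.1 hy).2 hodd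
    exact hxy this
  rw [← key, ← Finset.add_sum_erase _ _ huP, ← Finset.add_sum_erase _ _ hvP, add_assoc] at heven
  have h2 : Even (∑ y ∈ (P.filter (fun y => ¬ U y)).erase v, cnt D u y +
      ∑ x ∈ (P.filter U).erase u, ∑ y ∈ P.filter (fun y => ¬ U y), cnt D x y) := by
    refine Even.add (Finset.even_sum _ fun y hy => ?_)
      (Finset.even_sum _ fun x hx => Finset.even_sum _ fun y hy => ?_)
    · exact heq u huP y (Finset.mem_of_mem_erase hy) fun h => (Finset.ne_of_mem_erase hy) h.2
    · exact heq x (Finset.mem_of_mem_erase hx) y hy fun h => (Finset.ne_of_mem_erase hx) h.1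
  have := (Nat.even_add.1 heven).2 h2
  exact (Nat.not_even_iff_odd.2 h) this

/-- Without boundary edges, membership in `D` passes from each triangle to the next one on its left
in the same row, until it leaves the finite region. -/
theorem eq_empty_of_even_cnt {n : ℕ} {D : Finset (ℤ × ℤ × Bool)} (hD : D ⊆ trs n)
    (h : ∀ x y, Nb x y → ¬ Odd (cnt D x y)) : D = ∅ := by
  have hdown : ∀ k : ℕ, ∀ i j : ℤ, i < k → (i, j, true) ∉ D := by
    intro k
    induction k with
    | zero =>
      intro i j hi hm
      have := mem_trs_down.1 (hD hm)
      push_cast at hi; omega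
    | succ k ih =>
      intro i j hi hm
      have h1 := (odd_cnt_vertical D i j).not.1 (h _ _ (by simp [Nb]))
      have h2 := (odd_cnt_slash D (i - 1) j).not.1 (h _ _ (by simp [Nb]))
      push Not at h1 h2
      exact ih (i - 1) j (by push_cast at hi; omega) (h2.2 (h1.1 hm))
  have hdown' : ∀ i j : ℤ, (i, j, true) ∉ D := fun i j => hdown (i.toNat + 1) i j (by omega)
  refine Finset.eq_empty_of_forall_notMem ?_
  rintro ⟨i, j, b⟩ hm
  cases b
  · have h2 := (odd_cnt_slash D i j).not.1 (h _ _ (by simp [Nb]))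
    push Not at h2
    exact hdown' _ _ (h2.2 hm)
  · exact hdown' _ _ hm

/-- If no edge at the point `x` belongs to the boundary of `D`, then `D` contains all or none of the
six triangles at `x`. -/
theorem star_mem {D : Finset (ℤ × ℤ × Bool)} {i j : ℤ}
    (h : ∀ y, Nb (i, j) y → ¬ Odd (cnt D (i, j) y)) {t : ℤ × ℤ × Bool} (ht : t ∈ D)
    (hx : (i, j) ∈ corners t) {s : ℤ × ℤ × Bool} (hs : (i, j) ∈ corners s) : s ∈ D := by
  have h1 := (odd_cnt_horizontal D i j).not.1 (h _ (by simp [Nb]))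
  have h2 := (odd_cnt_vertical D i j).not.1 (h _ (by simp [Nb]))
  have h3 := (odd_cnt_slash D (i - 1) j).not.1
    (by have := h (i - 1, j + 1) (by simp [Nb]); simpa using this)
  have h4 := (odd_cnt_horizontal D (i - 1) j).not.1
    (by have := h (i - 1, j) (by simp [Nb]); rw [cnt_comm]; simpa using this)
  have h5 := (odd_cnt_vertical D i (j - 1)).not.1
    (by have := h (i, j - 1) (by simp [Nb]); rw [cnt_comm]; simpa using this)
  have h6 := (odd_cnt_slash D i (j - 1)).not.1
    (by have := h (i + 1, j - 1) (by simp [Nb]); rw [cnt_comm]; simpa using this)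
  push Not at h1 h2 h3 h4 h5 h6
  have key : ∀ t : ℤ × ℤ × Bool, (i, j) ∈ corners t → (t ∈ D ↔ (i, j, true) ∈ D) := by
    rintro ⟨k, l, b⟩ hk
    cases b
    · simp only [corners, Finset.mem_insert, Finset.mem_singleton, Prod.mk.injEq] at hk
      rcases hk with ⟨rfl, rfl⟩ | ⟨rfl, rfl⟩ | ⟨rfl, rfl⟩
      · simp at *; tauto
      · simp at *; tauto
      · simp at *; tauto
    · simp only [corners, Finset.mem_insert, Finset.mem_singleton, Prod.mk.injEq] at hk
      rcases hk with ⟨rfl, rfl⟩ | ⟨rfl, rfl⟩ | ⟨rfl, rfl⟩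
      · rfl
      · simp at *; tauto
      · simp at *; tauto
  rw [key s hs, ← key t hx]
  exact ht

/-- Boundary points of the triangle. -/
def IsBdry (n : ℕ) (p : ℤ × ℤ) : Prop := InTri n p ∧ (p.1 = 0 ∨ p.2 = 0 ∨ p.1 + p.2 = n)

/-- Otherwise all six lattice triangles around `p` would lie in `D`, but at a boundary point some of
them stick out of the region. -/
theorem exists_odd_cnt_of_isBdry {n : ℕ} {D : Finset (ℤ × ℤ × Bool)} (hD : D ⊆ trs n) {p : ℤ × ℤ}
    (hp : IsBdry n p) {t : ℤ × ℤ × Bool} (ht : t ∈ D) (hpt : p ∈ corners t) :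
    ∃ y, Nb p y ∧ Odd (cnt D p y) := by
  by_contra hcon
  push Not at hcon
  obtain ⟨i, j⟩ := p
  have key : ∀ s, (i, j) ∈ corners s → s ∈ trs n := fun s hs =>
    hD (star_mem (fun y hy => hcon y hy) ht hpt hs)
  have h1 := mem_trs_down.1 (key (i, j, true) (by simp [corners]))
  have h2 := mem_trs_down.1 (key (i - 1, j, true) (by simp [corners]))
  have h3 := mem_trs_down.1 (key (i, j - 1, true) (by simp [corners]))
  have h4 := hp.2
  simp only at h4
  omega

theorem cnt_eq_zero_of_not_nb {D : Finset (ℤ × ℤ × Bool)} {x y : ℤ × ℤ} (hne : x ≠ y)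
    (h : ¬ Nb x y) : cnt D x y = 0 := by
  rw [cnt, Finset.card_eq_zero, Finset.filter_eq_empty_iff]
  intro t _ hh
  exact h (nb_of_mem_corners hh.1 hh.2 hne)

/-! ### Filling closed walks -/

/-- The edge from `x` to `y` belongs to the standard path from the corner `(0, 0)` down to row `a.2`
and along this row to `a`. -/
def OnStd (a x y : ℤ × ℤ) : Prop :=
  (x.2 = a.2 ∧ y.2 = a.2 ∧ 0 ≤ x.1 ∧ 0 ≤ y.1 ∧ x.1 ≤ a.1 ∧ y.1 ≤ a.1) ∨
    (x.1 = 0 ∧ y.1 = 0 ∧ 0 ≤ x.2 ∧ 0 ≤ y.2 ∧ x.2 ≤ a.2 ∧ y.2 ≤ a.2)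

theorem onStd_comm (a x y : ℤ × ℤ) : OnStd a x y ↔ OnStd a y x := by
  unfold OnStd; constructor <;> (intro h; omega)

/-- `D` fills the loop made of the edge from `a` to `c` and the standard paths to its ends. -/
def FillsEdge (a c : ℤ × ℤ) (D : Finset (ℤ × ℤ × Bool)) : Prop :=
  ∀ x y, Nb x y → (Odd (cnt D x y) ↔ ¬ ((s(a, c) = s(x, y)) ↔ ¬ (OnStd a x y ↔ OnStd c x y)))

theorem FillsEdge.symm {a c : ℤ × ℤ} {D : Finset (ℤ × ℤ × Bool)} (h : FillsEdge a c D) :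
    FillsEdge c a D := by
  intro x y hxy
  rw [h x y hxy, Sym2.eq_swap]
  tauto

theorem fillsEdge_of_three {a c : ℤ × ℤ} {D : Finset (ℤ × ℤ × Bool)}
    (hh : ∀ i j : ℤ, Odd (cnt D (i, j) (i + 1, j)) ↔ ¬ ((s(a, c) = s((i, j), (i + 1, j))) ↔
      ¬ (OnStd a (i, j) (i + 1, j) ↔ OnStd c (i, j) (i + 1, j))))
    (hv : ∀ i j : ℤ, Odd (cnt D (i, j) (i, j + 1)) ↔ ¬ ((s(a, c) = s((i, j), (i, j + 1))) ↔
      ¬ (OnStd a (i, j) (i, j + 1) ↔ OnStd c (i, j) (i, j + 1))))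
    (hs : ∀ i j : ℤ, Odd (cnt D (i + 1, j) (i, j + 1)) ↔ ¬ ((s(a, c) = s((i + 1, j), (i, j + 1))) ↔
      ¬ (OnStd a (i + 1, j) (i, j + 1) ↔ OnStd c (i + 1, j) (i, j + 1)))) : FillsEdge a c D := by
  rintro ⟨i, j⟩ ⟨k, l⟩ hxy
  rcases hxy with h | h | h | h | h | h <;> simp only [Prod.mk.injEq] at h <;> obtain ⟨h1, h2⟩ := h
    <;> subst h1 <;> subst h2
  · exact hh _ _
  · rw [cnt_comm, Sym2.eq_swap (a := (_ + 1, _)), onStd_comm, onStd_comm c]; exact hh _ _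
  · exact hv _ _
  · rw [cnt_comm, Sym2.eq_swap (a := (_, _ + 1)), onStd_comm, onStd_comm c]; exact hv _ _
  · have := hs (i - 1) j; simpa using this
  · rw [cnt_comm, Sym2.eq_swap (a := (_ - 1, _ + 1)), onStd_comm, onStd_comm c]
    have := hs (k - 1) l; simpa using this

theorem onStd_horizontal (a : ℤ × ℤ) (k l : ℤ) :
    OnStd a (k, l) (k + 1, l) ↔ l = a.2 ∧ 0 ≤ k ∧ k + 1 ≤ a.1 := by
  simp only [OnStd]; omega

theorem onStd_vertical (a : ℤ × ℤ) (k l : ℤ) :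
    OnStd a (k, l) (k, l + 1) ↔ k = 0 ∧ 0 ≤ l ∧ l + 1 ≤ a.2 := by
  simp only [OnStd]; omega

theorem onStd_slash (a : ℤ × ℤ) (k l : ℤ) : OnStd a (k + 1, l) (k, l + 1) ↔ False := by
  simp only [OnStd, iff_false]
  rintro (h | h) <;> omega

/-- The standard path to the right end is the one to the left end followed by this edge, so
everything cancels. -/
theorem exists_fillsEdge_horizontal (i j : ℤ) (hi : 0 ≤ i) :
    FillsEdge (i, j) (i + 1, j) ∅ := by
  refine fillsEdge_of_three ?_ ?_ ?_ <;> intro k l <;>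
    simp only [cnt, Finset.filter_empty, Finset.card_empty, Nat.not_odd_zero, false_iff, not_not,
      onStd_horizontal, onStd_vertical, onStd_slash]
  · have : s((i, j), (i + 1, j)) = s((k, l), (k + 1, l)) ↔ k = i ∧ l = j := by
      simp only [Sym2.eq_iff, Prod.mk.injEq]; omega
    rw [this]
    omega
  · have : s((i, j), (i + 1, j)) ≠ s((k, l), (k, l + 1)) := by
      simp only [ne_eq, Sym2.eq_iff, Prod.mk.injEq]; omega
    simp [this]
  · have : s((i, j), (i + 1, j)) ≠ s((k + 1, l), (k, l + 1)) := by
      simp only [ne_eq, Sym2.eq_iff, Prod.mk.injEq]; omega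
    simp [this]

theorem exists_fillsEdge_vertical {n : ℕ} (i j : ℤ) (hi : 0 ≤ i) (hj : 0 ≤ j)
    (hn : i + (j + 1) ≤ n) : ∃ D ⊆ trs n, FillsEdge (i, j) (i, j + 1) D := by
  classical
  -- The strip between rows `j` and `j + 1`, left of column `i`.
  refine ⟨(trs n).filter fun t => t.2.1 = j ∧ t.1 < i, Finset.filter_subset _ _, ?_⟩
  have hd : ∀ k l, (k, l, true) ∈ (trs n).filter (fun t => t.2.1 = j ∧ t.1 < i) ↔
      l = j ∧ 0 ≤ k ∧ k < i := by
    intro k l; rw [Finset.mem_filter, mem_trs_down]; simp only; omega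
  have hu : ∀ k l, (k, l, false) ∈ (trs n).filter (fun t => t.2.1 = j ∧ t.1 < i) ↔
      l = j ∧ 0 ≤ k ∧ k < i := by
    intro k l; rw [Finset.mem_filter, mem_trs_up]; simp only; omega
  refine fillsEdge_of_three ?_ ?_ ?_ <;> intro k l <;>
    simp only [odd_cnt_horizontal, odd_cnt_vertical, odd_cnt_slash, hd, hu,
      onStd_horizontal, onStd_vertical, onStd_slash]
  · have : s((i, j), (i, j + 1)) ≠ s((k, l), (k + 1, l)) := by
      simp only [ne_eq, Sym2.eq_iff, Prod.mk.injEq]; omega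
    simp only [this, false_iff, not_not]
    omega
  · have : s((i, j), (i, j + 1)) = s((k, l), (k, l + 1)) ↔ k = i ∧ l = j := by
      simp only [Sym2.eq_iff, Prod.mk.injEq]; omega
    simp only [this]
    omega
  · have : s((i, j), (i, j + 1)) ≠ s((k + 1, l), (k, l + 1)) := by
      simp only [ne_eq, Sym2.eq_iff, Prod.mk.injEq]; omega
    simp [this]

theorem exists_fillsEdge_slash {n : ℕ} (i j : ℤ) (hi : 0 ≤ i) (hj : 0 ≤ j)
    (hn : i + (j + 1) ≤ n) : ∃ D ⊆ trs n, FillsEdge (i + 1, j) (i, j + 1) D := by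
  classical
  -- The strip of the vertical case with one more downward triangle at its right end.
  set D := (trs n).filter fun t => t.2.1 = j ∧ (t.1 < i ∨ t.1 = i ∧ t.2.2 = true) with hD
  refine ⟨D, Finset.filter_subset _ _, ?_⟩
  have hd : ∀ k l, (k, l, true) ∈ D ↔ l = j ∧ 0 ≤ k ∧ k < i + 1 := by
    intro k l; rw [hD, Finset.mem_filter, mem_trs_down]; simp only [and_true]; omega
  have hu : ∀ k l, (k, l, false) ∈ D ↔ l = j ∧ 0 ≤ k ∧ k < i := by
    intro k l; rw [hD, Finset.mem_filter, mem_trs_up]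
    simp only [Bool.false_eq_true, and_false, or_false]; omega
  refine fillsEdge_of_three ?_ ?_ ?_ <;> intro k l <;>
    simp only [odd_cnt_horizontal, odd_cnt_vertical, odd_cnt_slash, hd, hu,
      onStd_horizontal, onStd_vertical, onStd_slash]
  · have : s((i + 1, j), (i, j + 1)) ≠ s((k, l), (k + 1, l)) := by
      simp only [ne_eq, Sym2.eq_iff, Prod.mk.injEq]; omega
    simp only [this, false_iff, not_not]
    omega
  · have : s((i + 1, j), (i, j + 1)) ≠ s((k, l), (k, l + 1)) := by
      simp only [ne_eq, Sym2.eq_iff, Prod.mk.injEq]; omega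
    simp only [this, false_iff, not_not]
    omega
  · have : s((i + 1, j), (i, j + 1)) = s((k + 1, l), (k, l + 1)) ↔ k = i ∧ l = j := by
      simp only [Sym2.eq_iff, Prod.mk.injEq]; omega
    simp only [this, not_true, iff_false, not_not]
    omega

theorem exists_fillsEdge {n : ℕ} {a c : ℤ × ℤ} (h : (lat n).Adj a c) :
    ∃ D ⊆ trs n, FillsEdge a c D := by
  obtain ⟨⟨ha1, ha2, ha3⟩, ⟨hc1, hc2, hc3⟩, hac⟩ := h
  obtain ⟨i, j⟩ := a
  obtain ⟨k, l⟩ := c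
  rcases hac with h | h | h | h | h | h <;> simp only [Prod.mk.injEq] at h <;> obtain ⟨h1, h2⟩ := h
    <;> subst h1 <;> subst h2 <;> simp only at *
  · exact ⟨_, Finset.empty_subset _, exists_fillsEdge_horizontal _ _ ha1⟩
  · exact ⟨_, Finset.empty_subset _, (exists_fillsEdge_horizontal _ _ hc1).symm⟩
  · exact exists_fillsEdge_vertical _ _ ha1 ha2 hc3
  · obtain ⟨D, h1, h2⟩ := exists_fillsEdge_vertical _ _ hc1 hc2 ha3
    exact ⟨D, h1, h2.symm⟩
  · have := exists_fillsEdge_slash (i - 1) j hc1 ha2 hc3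
    simpa using this
  · obtain ⟨D, h1, h2⟩ := exists_fillsEdge_slash (k - 1) l ha1 hc2 ha3
    exact ⟨D, h1, by simpa using h2.symm⟩

/-- Every walk, closed up by the standard paths to its ends, is filled by a set of triangles. -/
theorem exists_fill_walk {n : ℕ} {a b : ℤ × ℤ} (p : (lat n).Walk a b) :
    ∃ D ⊆ trs n, ∀ x y, Nb x y → (Odd (cnt D x y) ↔
      ¬ (Odd (p.edges.count s(x, y)) ↔ ¬ (OnStd a x y ↔ OnStd b x y))) := by
  induction p with
  | nil => exact ⟨∅, Finset.empty_subset _, fun x y _ => by simp [cnt]⟩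
  | @cons u v w hadj q ih =>
    obtain ⟨D, hD, h⟩ := ih
    obtain ⟨E, hE, h'⟩ := exists_fillsEdge hadj
    refine ⟨symmDiff D E, fun t ht => ?_, fun x y hxy => ?_⟩
    · rcases Finset.mem_symmDiff.1 ht with h | h
      · exact hD h.1
      · exact hE h.1
    · rw [odd_cnt_symmDiff, h x y hxy, h' x y hxy, SimpleGraph.Walk.edges_cons, List.count_cons]
      by_cases he : s(u, v) = s(x, y)
      · simp only [he, beq_self_eq_true, if_true, Nat.odd_add_one]
        tauto
      · simp only [he, beq_iff_eq, if_false, add_zero]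
        tauto

/-- An edge `a b` outside of a subgraph `G` in which `a` and `b` are connected closes up a loop that
is the boundary of a set of triangles. -/
theorem exists_fill {n : ℕ} {G : SimpleGraph (ℤ × ℤ)} (hG : G ≤ lat n) {a b : ℤ × ℤ}
    (hab : (lat n).Adj a b) (hG' : ¬ G.Adj a b) (hr : G.Reachable a b) :
    ∃ D ⊆ trs n, Odd (cnt D a b) ∧ ∀ x y, Nb x y → Odd (cnt D x y) →
      s(x, y) = s(a, b) ∨ G.Adj x y := by
  obtain ⟨p⟩ := hr
  obtain ⟨D, hD, h⟩ := exists_fill_walk (p.mapLe hG)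
  obtain ⟨E, hE, h'⟩ := exists_fillsEdge hab
  have hedge : ∀ x y, Odd ((p.mapLe hG).edges.count s(x, y)) → G.Adj x y := by
    intro x y ho
    have : s(x, y) ∈ (p.mapLe hG).edges := List.count_pos_iff.1 ho.pos
    rw [SimpleGraph.Walk.edges_mapLe_eq_edges] at this
    exact p.adj_of_mem_edges this
  -- The standard paths to `a` and `b` occur in both boundaries and cancel. What remains is the walk
  -- in `G` together with the edge `a b`.
  refine ⟨symmDiff D E, fun t ht => ?_, ?_, fun x y hxy hodd => ?_⟩
  · rcases Finset.mem_symmDiff.1 ht with h | h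
    · exact hD h.1
    · exact hE h.1
  · rw [odd_cnt_symmDiff, h a b hab.2.2, h' a b hab.2.2]
    have := mt (hedge a b) hG'
    tauto
  · rw [odd_cnt_symmDiff, h x y hxy, h' x y hxy] at hodd
    by_cases he : s(a, b) = s(x, y)
    · exact Or.inl he.symm
    · refine Or.inr (hedge x y ?_)
      tauto

section

/-! ### Forests and the exchange of edges -/

/-- Remove the edge `f` and add the edge `e`. -/
def swapEdge (G : SimpleGraph (ℤ × ℤ)) (f e : Sym2 (ℤ × ℤ)) : SimpleGraph (ℤ × ℤ) :=
  G.deleteEdges {f} ⊔ SimpleGraph.fromEdgeSet {e}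

theorem swapEdge_adj {G : SimpleGraph (ℤ × ℤ)} {f e : Sym2 (ℤ × ℤ)} {x y : ℤ × ℤ} :
    (swapEdge G f e).Adj x y ↔ (G.Adj x y ∧ s(x, y) ≠ f) ∨ (s(x, y) = e ∧ x ≠ y) := by
  simp [swapEdge]

/-- `G` is a spanning forest whose components are the level sets of `c`. -/
structure Forest (n : ℕ) (c : ℤ × ℤ → ℤ) (G : SimpleGraph (ℤ × ℤ)) : Prop where
  le : G ≤ lat n
  acyclic : G.IsAcyclic
  reach : ∀ u v, InTri n u → InTri n v → (G.Reachable u v ↔ c u = c v)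

variable {n : ℕ} {c : ℤ × ℤ → ℤ} {G : SimpleGraph (ℤ × ℤ)}

theorem Forest.inTri_left (h : Forest n c G) {u v : ℤ × ℤ} (huv : G.Adj u v) : InTri n u :=
  (h.le huv).1

theorem Forest.inTri_right (h : Forest n c G) {u v : ℤ × ℤ} (huv : G.Adj u v) : InTri n v :=
  (h.le huv).2.1

theorem Forest.not_reachable (h : Forest n c G) {u v : ℤ × ℤ} (huv : G.Adj u v) :
    ¬ (G.deleteEdges {s(u, v)}).Reachable u v :=
  SimpleGraph.isBridge_iff.1 (SimpleGraph.isAcyclic_iff_forall_adj_isBridge.1 h.acyclic huv)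

theorem reachable_deleteEdges_or {u v w : ℤ × ℤ} (h : G.Reachable u w) :
    (G.deleteEdges {s(u, v)}).Reachable u w ∨ (G.deleteEdges {s(u, v)}).Reachable v w := by
  rw [SimpleGraph.reachable_iff_reflTransGen] at h
  induction h with
  | refl => exact Or.inl (SimpleGraph.Reachable.refl _)
  | @tail x y _ hxy ih =>
    by_cases he : s(x, y) = s(u, v)
    · rcases Sym2.eq_iff.1 he with ⟨_, rfl⟩ | ⟨_, rfl⟩
      · exact Or.inr (SimpleGraph.Reachable.refl _)
      · exact Or.inl (SimpleGraph.Reachable.refl _)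
    · have hadj : (G.deleteEdges {s(u, v)}).Adj x y := by simp [hxy, he]
      exact ih.imp (fun h => h.trans hadj.reachable) (fun h => h.trans hadj.reachable)

theorem reachable_of_forall_adj {V : Type*} {G H : SimpleGraph V}
    (h : ∀ x y, G.Adj x y → H.Reachable x y) {u v : V} (huv : G.Reachable u v) :
    H.Reachable u v := by
  rw [SimpleGraph.reachable_iff_reflTransGen] at huv
  induction huv with
  | refl => exact SimpleGraph.Reachable.refl _
  | tail _ hxy ih => exact ih.trans (h _ _ hxy)

/-- Deleting `u v` leaves `a` on the side of `u`. Since `a` and `b` are connected in `G`, `b` is on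
the side of `v`, and the new edge joins the two halves again. -/
theorem Forest.swapEdge (h : Forest n c G) {u v a b : ℤ × ℤ} (huv : G.Adj u v)
    (hab : (lat n).Adj a b) (ha : (G.deleteEdges {s(u, v)}).Reachable u a)
    (hb : ¬ (G.deleteEdges {s(u, v)}).Reachable u b) (hc : c a = c b) :
    Forest n c (swapEdge G s(u, v) s(a, b)) := by
  have hle : G.deleteEdges {s(u, v)} ≤ G := SimpleGraph.deleteEdges_le _
  have hGab : G.Reachable a b := (h.reach a b hab.1 hab.2.1).2 hc
  have hvb : (G.deleteEdges {s(u, v)}).Reachable v b :=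
    (reachable_deleteEdges_or ((ha.mono hle).trans hGab)).resolve_left hb
  have hle' : G.deleteEdges {s(u, v)} ≤ SignTriangles.swapEdge G s(u, v) s(a, b) := le_sup_left
  have hadj : (SignTriangles.swapEdge G s(u, v) s(a, b)).Adj a b :=
    swapEdge_adj.2 (Or.inr ⟨rfl, hab.2.2.ne⟩)
  refine ⟨?_, ?_, fun x y hx hy => ?_⟩
  · intro x y hxy
    rcases swapEdge_adj.1 hxy with hh | hh
    · exact h.le hh.1
    · rcases Sym2.eq_iff.1 hh.1 with ⟨rfl, rfl⟩ | ⟨rfl, rfl⟩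
      · exact hab
      · exact hab.symm
  · exact SimpleGraph.IsAcyclic.sup_edge_of_not_reachable (u := a) (v := b)
      (fun hr => hb (ha.trans hr)) (h.acyclic.anti hle)
  · rw [← h.reach x y hx hy]
    constructor
    · refine reachable_of_forall_adj fun x y hxy => ?_
      rcases swapEdge_adj.1 hxy with hh | hh
      · exact hh.1.reachable
      · rcases Sym2.eq_iff.1 hh.1 with ⟨rfl, rfl⟩ | ⟨rfl, rfl⟩
        · exact hGab
        · exact hGab.symm
    · refine reachable_of_forall_adj fun x y hxy => ?_
      by_cases he : s(x, y) = s(u, v)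
      · have huv' : (SignTriangles.swapEdge G s(u, v) s(a, b)).Reachable u v :=
          ((ha.mono hle').trans hadj.reachable).trans (hvb.mono hle').symm
        rcases Sym2.eq_iff.1 he with ⟨rfl, rfl⟩ | ⟨rfl, rfl⟩
        · exact huv'
        · exact huv'.symm
      · exact (swapEdge_adj.2 (Or.inl ⟨hxy, he⟩)).reachable

/-- Rotation in a triangle with two edges of the forest. -/
theorem Forest.rotate (h : Forest n c G) {u v w : ℤ × ℤ} (huv : G.Adj u v) (huw : G.Adj u w)
    (hvw : (lat n).Adj v w) : Forest n c (SignTriangles.swapEdge G s(u, v) s(v, w)) := by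
  rw [Sym2.eq_swap (a := v)]
  refine h.swapEdge huv hvw.symm ?_ (h.not_reachable huv) ?_
  · refine SimpleGraph.Adj.reachable ?_
    have : w ≠ v := hvw.2.2.ne.symm
    simp [huw, this, huv.ne]
  · rw [← (h.reach w v hvw.2.1 hvw.1)]
    exact huw.symm.reachable.trans huv.reachable

/-- The edge `a b` and edges of `G` make up the boundary of the set `D` of triangles. -/
structure Fill (n : ℕ) (G : SimpleGraph (ℤ × ℤ)) (a b : ℤ × ℤ) (D : Finset (ℤ × ℤ × Bool)) :
    Prop where
  sub : D ⊆ trs n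
  odd : Odd (cnt D a b)
  closed : ∀ x y, x ≠ y → Odd (cnt D x y) → s(x, y) = s(a, b) ∨ G.Adj x y

theorem Forest.exists_fill (h : Forest n c G) {a b : ℤ × ℤ} (hab : (lat n).Adj a b)
    (hG : ¬ G.Adj a b) (hr : c a = c b) : ∃ D, Fill n G a b D := by
  obtain ⟨D, h1, h2, h3⟩ := SignTriangles.exists_fill h.le hab hG
    ((h.reach a b hab.1 hab.2.1).2 hr)
  refine ⟨D, h1, h2, fun x y hne ho => h3 x y ?_ ho⟩
  obtain ⟨t, _, hx, hy⟩ := exists_mem_of_odd_cnt ho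
  exact nb_of_mem_corners hx hy hne

/-- Removing an edge of the forest on the boundary of `D` separates the ends of `a b`. -/
theorem Fill.separates {a b : ℤ × ℤ} {D : Finset (ℤ × ℤ × Bool)} (hD : Fill n G a b D)
    (h : Forest n c G) {u v : ℤ × ℤ} (huv : G.Adj u v) (ho : Odd (cnt D u v)) :
    ((G.deleteEdges {s(u, v)}).Reachable u a ∧ ¬ (G.deleteEdges {s(u, v)}).Reachable u b) ∨
    ((G.deleteEdges {s(u, v)}).Reachable u b ∧ ¬ (G.deleteEdges {s(u, v)}).Reachable u a) := by
  -- Cut by the side of `u` after deleting `u v`. The boundary crosses this cut at `u v`, hence once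
  -- more. No other forest edge crosses it, so the second crossing is `a b`.
  obtain ⟨x, y, hx, hy, hxy, hne⟩ := exists_other_of_odd_cnt
    (fun x => (G.deleteEdges {s(u, v)}).Reachable u x) (SimpleGraph.Reachable.refl _)
    (h.not_reachable huv) ho
  have hxy' : x ≠ y := by rintro rfl; exact hy hx
  rcases hD.closed x y hxy' hxy with he | he
  · rcases Sym2.eq_iff.1 he with ⟨rfl, rfl⟩ | ⟨rfl, rfl⟩
    · exact Or.inl ⟨hx, hy⟩
    · exact Or.inr ⟨hx, hy⟩
  · exfalso
    by_cases hs : s(x, y) = s(u, v)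
    · rcases Sym2.eq_iff.1 hs with ⟨rfl, rfl⟩ | ⟨rfl, rfl⟩
      · simp at hne
      · exact h.not_reachable huv hx
    · have : (G.deleteEdges {s(u, v)}).Adj x y := by simp [he, hs]
      exact hy (hx.trans this.reachable)

theorem Fill.reachable {a b : ℤ × ℤ} {D : Finset (ℤ × ℤ × Bool)} (hD : Fill n G a b D)
    (h : Forest n c G) {u v : ℤ × ℤ} (huv : G.Adj u v) (ho : Odd (cnt D u v)) :
    G.Reachable u a ∨ G.Reachable u b := by
  have hle : G.deleteEdges {s(u, v)} ≤ G := SimpleGraph.deleteEdges_le _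
  rcases hD.separates h huv ho with hh | hh
  · exact Or.inl (hh.1.mono hle)
  · exact Or.inr (hh.1.mono hle)

theorem Fill.forest_swapEdge {a b : ℤ × ℤ} {D : Finset (ℤ × ℤ × Bool)} (hD : Fill n G a b D)
    (h : Forest n c G) (hab : (lat n).Adj a b) (hc : c a = c b) {u v : ℤ × ℤ} (huv : G.Adj u v)
    (ho : Odd (cnt D u v)) : Forest n c (swapEdge G s(u, v) s(a, b)) := by
  rcases hD.separates h huv ho with hh | hh
  · exact h.swapEdge huv hab hh.1 hh.2 hc
  · rw [Sym2.eq_swap (a := a)]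
    exact h.swapEdge huv hab.symm hh.1 hh.2 hc.symm

/-- A boundary edge in a forest would be a bridge and hence the only boundary edge across its cut,
against parity. So the boundary is empty. -/
theorem eq_empty_of_forest (h : Forest n c G) {D : Finset (ℤ × ℤ × Bool)} (hD : D ⊆ trs n)
    (hc : ∀ x y, x ≠ y → Odd (cnt D x y) → G.Adj x y) : D = ∅ := by
  refine eq_empty_of_even_cnt hD fun u v huv ho => ?_
  have hadj := hc u v huv.ne ho
  obtain ⟨x, y, hx, hy, hxy, hne⟩ := exists_other_of_odd_cnt
    (fun x => (G.deleteEdges {s(u, v)}).Reachable u x) (SimpleGraph.Reachable.refl _)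
    (h.not_reachable hadj) ho
  have hxy' : x ≠ y := by rintro rfl; exact hy hx
  have he := hc x y hxy' hxy
  by_cases hs : s(x, y) = s(u, v)
  · rcases Sym2.eq_iff.1 hs with ⟨rfl, rfl⟩ | ⟨rfl, rfl⟩
    · simp at hne
    · exact h.not_reachable hadj hx
  · have : (G.deleteEdges {s(u, v)}).Adj x y := by simp [he, hs]
    exact hy (hx.trans this.reachable)

/-! ### The inside of a loop. -/

theorem exists_corners_of_nb {x y : ℤ × ℤ} (h : Nb x y) :
    ∃ t, x ∈ corners t ∧ y ∈ corners t := by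
  obtain ⟨i, j⟩ := x
  rcases h with rfl | h | rfl | h | rfl | h
  · exact ⟨(i, j, true), by simp [corners], by simp [corners]⟩
  · exact ⟨(y.1, y.2, true), by simp [corners, h], by simp [corners]⟩
  · exact ⟨(i, j, true), by simp [corners], by simp [corners]⟩
  · exact ⟨(y.1, y.2, true), by simp [corners, h], by simp [corners]⟩
  · exact ⟨(i - 1, j, true), by simp [corners], by simp [corners]⟩
  · exact ⟨(y.1 - 1, y.2, true), by simp [corners, h], by simp [corners]⟩

/-- The loop made of `a b` and edges of the forest encloses only points of the component of `a`,
because every component reaches the boundary. -/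
theorem Fill.eq_of_mem_corners {a b : ℤ × ℤ} {D : Finset (ℤ × ℤ × Bool)} (hD : Fill n G a b D)
    (h : Forest n c G) (hab : (lat n).Adj a b) (hc : c a = c b)
    (hb : ∀ x, InTri n x → ∃ p, IsBdry n p ∧ c p = c x)
    {t : ℤ × ℤ × Bool} (ht : t ∈ D) {w : ℤ × ℤ} (hw : w ∈ corners t) : c w = c a := by
  by_contra hne
  have hwT : InTri n w := inTri_of_mem_corners (hD.sub ht) hw
  -- Boundary edges of `D` lie in the component of `a`, so none touches the component of `w`.
  have heven : ∀ x y, Nb x y → c x = c w → ¬ Odd (cnt D x y) := by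
    intro x y hxy hx ho
    rcases hD.closed x y hxy.ne ho with he | he
    · rcases Sym2.eq_iff.1 he with ⟨rfl, rfl⟩ | ⟨rfl, rfl⟩
      · exact hne hx.symm
      · exact hne (hx.symm.trans hc.symm)
    · rcases hD.reachable h he ho with hr | hr
      · exact hne (hx.symm.trans ((h.reach _ _ (h.inTri_left he) hab.1).1 hr))
      · exact hne (hx.symm.trans (((h.reach _ _ (h.inTri_left he) hab.2.1).1 hr).trans hc.symm))
  -- Being a corner of a triangle of `D` thus spreads over the whole component of `w`, up to the
  -- boundary of the region.
  have hprop : ∀ x, G.Reachable w x → ∃ s ∈ D, x ∈ corners s := by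
    intro x hx
    rw [SimpleGraph.reachable_iff_reflTransGen] at hx
    induction hx with
    | refl => exact ⟨t, ht, hw⟩
    | @tail x y hwx hxy ih =>
      obtain ⟨s, hs, hxs⟩ := ih
      obtain ⟨r, hxr, hyr⟩ := exists_corners_of_nb (h.le hxy).2.2
      refine ⟨r, ?_, hyr⟩
      rw [← SimpleGraph.reachable_iff_reflTransGen] at hwx
      have hcx : c x = c w := ((h.reach _ _ hwT (h.inTri_left hxy)).1 hwx).symm
      exact star_mem (i := x.1) (j := x.2) (fun y hy => heven x y hy hcx) hs hxs hxr
  obtain ⟨p, hp, hpc⟩ := hb w hwT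
  obtain ⟨s, hs, hps⟩ := hprop p ((h.reach _ _ hwT hp.1).2 hpc.symm)
  obtain ⟨y, hy, ho⟩ := exists_odd_cnt_of_isBdry hD.sub hp hs hps
  exact heven p y hy hpc ho

theorem cnt_le_two (D : Finset (ℤ × ℤ × Bool)) {x y : ℤ × ℤ} (hne : x ≠ y) : cnt D x y ≤ 2 := by
  have key : ∀ {x y : ℤ × ℤ} {s t : ℤ × ℤ × Bool},
      (∀ r, x ∈ corners r ∧ y ∈ corners r → r = s ∨ r = t) → cnt D x y ≤ 2 := by
    intro x y s t h
    refine le_trans (Finset.card_le_card (t := {s, t}) fun r hr => ?_) Finset.card_le_two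
    simpa using h r (Finset.mem_filter.1 hr).2
  have hh : ∀ i j : ℤ, cnt D (i, j) (i + 1, j) ≤ 2 := fun i j =>
    key (s := (i, j, true)) (t := (i, j - 1, false)) (by
      rintro ⟨k, l, b⟩; cases b <;> simp [corners, Prod.ext_iff] <;> omega)
  have hv : ∀ i j : ℤ, cnt D (i, j) (i, j + 1) ≤ 2 := fun i j =>
    key (s := (i, j, true)) (t := (i - 1, j, false)) (by
      rintro ⟨k, l, b⟩; cases b <;> simp [corners, Prod.ext_iff] <;> omega)
  have hs : ∀ i j : ℤ, cnt D (i, j) (i - 1, j + 1) ≤ 2 := fun i j =>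
    key (s := (i - 1, j, true)) (t := (i - 1, j, false)) (by
      rintro ⟨k, l, b⟩; cases b <;> simp [corners, Prod.ext_iff] <;> omega)
  by_cases hxy : Nb x y
  · rcases hxy with h | h | h | h | h | h
    · rw [h]; exact hh x.1 x.2
    · rw [h, cnt_comm]; exact hh y.1 y.2
    · rw [h]; exact hv x.1 x.2
    · rw [h, cnt_comm]; exact hv y.1 y.2
    · rw [h]; exact hs x.1 x.2
    · rw [h, cnt_comm]; exact hs y.1 y.2
  · rw [cnt_eq_zero_of_not_nb hne hxy]; omega

theorem cnt_pos {D : Finset (ℤ × ℤ × Bool)} {t : ℤ × ℤ × Bool} (ht : t ∈ D) {x y : ℤ × ℤ}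
    (hx : x ∈ corners t) (hy : y ∈ corners t) : 0 < cnt D x y :=
  Finset.card_pos.2 ⟨t, Finset.mem_filter.2 ⟨ht, hx, hy⟩⟩

/-- Fillings of loops are nested. -/
theorem Fill.subset {a b u w : ℤ × ℤ} {D S : Finset (ℤ × ℤ × Bool)} (hD : Fill n G a b D)
    (hS : Fill n G u w S) (h : Forest n c G) {t : ℤ × ℤ × Bool} (ht : t ∈ D) (hu : u ∈ corners t)
    (hw : w ∈ corners t) : S ⊆ D := by
  rw [← Finset.sdiff_eq_empty_iff_subset]
  have hZsub : S \ D ⊆ trs n := Finset.sdiff_subset.trans hS.sub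
  -- If an edge other than `a b` and outside `G` were on the boundary of `S \ D`, some triangle of
  -- `D` would contain it: for `u w` this is `t`, otherwise parity of `S` gives one. By parity there
  -- would be two, and with the one in `S \ D` that makes three triangles at one edge.
  have hZ : ∀ x y, x ≠ y → Odd (cnt (S \ D) x y) → s(x, y) = s(a, b) ∨ G.Adj x y := by
    intro x y hxy ho
    by_contra hcon
    push Not at hcon
    have hDe : ¬ Odd (cnt D x y) := fun hodd => (hD.closed x y hxy hodd).elim hcon.1 hcon.2
    have h1 : cnt S x y = cnt (S \ D) x y + cnt (S ∩ D) x y := by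
      have := cnt_sdiff (D := S) (E := S ∩ D) Finset.inter_subset_left x y
      rwa [Finset.sdiff_inter_self_left] at this
    have h2 : cnt D x y = cnt (D \ S) x y + cnt (S ∩ D) x y := by
      have := cnt_sdiff (D := D) (E := S ∩ D) Finset.inter_subset_right x y
      rwa [Finset.sdiff_inter_self_right] at this
    have h3 : cnt (D ∪ S \ D) x y = cnt D x y + cnt (S \ D) x y :=
      cnt_union Finset.disjoint_sdiff x y
    have h4 := cnt_le_two (D ∪ S \ D) hxy
    rw [Nat.odd_iff] at ho hDe
    by_cases he : s(x, y) = s(u, w)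
    · have h5 : 0 < cnt D x y := by
        rw [cnt_congr D he]; exact cnt_pos ht hu hw
      omega
    · have hSe : ¬ Odd (cnt S x y) := fun hodd => (hS.closed x y hxy hodd).elim he hcon.2
      rw [Nat.odd_iff] at hSe
      omega
  by_cases hodd : Odd (cnt (S \ D) a b)
  · exfalso
    -- If `a b` is on both boundaries, it cancels in the disjoint union, whose boundary is then
    -- contained in the forest.
    have hW : D ∪ S \ D = ∅ := by
      refine eq_empty_of_forest h (Finset.union_subset hD.sub hZsub) fun x y hxy ho => ?_
      rw [cnt_union Finset.disjoint_sdiff] at ho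
      by_cases he : s(x, y) = s(a, b)
      · rw [cnt_congr D he, cnt_congr _ he] at ho
        exact absurd (hD.odd.add_odd hodd) (Nat.not_even_iff_odd.2 ho)
      · rcases Nat.even_or_odd (cnt D x y) with hp | hp
        · exact (hZ x y hxy ((Nat.odd_add'.1 ho).2 hp)).resolve_left he
        · exact (hD.closed x y hxy hp).resolve_left he
    have : t ∈ D ∪ S \ D := Finset.mem_union_left _ ht
    rw [hW] at this
    simp at this
  · refine eq_empty_of_forest h hZsub fun x y hxy ho => (hZ x y hxy ho).resolve_left fun he => ?_
    rw [cnt_congr _ he] at ho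
    exact hodd ho

end

/-! ### Rotations in triangles connect forests with the same components. -/

section

variable {n : ℕ} {c : ℤ × ℤ → ℤ} {G : SimpleGraph (ℤ × ℤ)}

/-- `H` arises from `G` by rotation in a triangle with exactly two edges of `G`. -/
def Rotates (n : ℕ) (G H : SimpleGraph (ℤ × ℤ)) : Prop :=
  ∃ t ∈ trs n, ∃ u v w, corners t = {u, v, w} ∧ G.Adj u v ∧ G.Adj u w ∧ ¬ G.Adj v w ∧
    H = swapEdge G s(u, v) s(v, w)

theorem lat_adj_of_mem_corners {t : ℤ × ℤ × Bool} (ht : t ∈ trs n) {x y : ℤ × ℤ}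
    (hx : x ∈ corners t) (hy : y ∈ corners t) (hne : x ≠ y) : (lat n).Adj x y :=
  ⟨inTri_of_mem_corners ht hx, inTri_of_mem_corners ht hy, nb_of_mem_corners hx hy hne⟩

theorem Rotates.forest {H : SimpleGraph (ℤ × ℤ)} (hr : Rotates n G H) (h : Forest n c G) :
    Forest n c H := by
  obtain ⟨t, ht, u, v, w, hc, huv, huw, hvw, rfl⟩ := hr
  refine h.rotate huv huw (lat_adj_of_mem_corners ht (by simp [hc]) (by simp [hc]) ?_)
  rintro rfl
  have := card_corners t
  rw [hc] at this
  have h3 : ({u, v, v} : Finset (ℤ × ℤ)).card ≤ 2 := by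
    simpa using Finset.card_le_two (a := u) (b := v)
  omega

theorem forest_of_reflTransGen {H : SimpleGraph (ℤ × ℤ)}
    (hr : Relation.ReflTransGen (Rotates n) G H) (h : Forest n c G) : Forest n c H := by
  induction hr with
  | refl => exact h
  | tail _ hs ih => exact hs.forest ih

theorem swapEdge_swapEdge {e f g : Sym2 (ℤ × ℤ)} (hg : g ∉ G.edgeSet) :
    swapEdge (swapEdge G f g) g e = swapEdge G f e := by
  ext x y
  simp only [swapEdge_adj]
  have : s(x, y) = g → ¬ G.Adj x y := by rintro rfl; exact hg
  tauto

/-- A conjugation: `p` is replaced by `q` only while `r` is exchanged for `s`, and then restored. -/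
theorem swapEdge_swapEdge_swapEdge {p q r s : Sym2 (ℤ × ℤ)} (hp : p ∈ G.edgeSet)
    (hq : q ∉ G.edgeSet) (hpq : p ≠ q) (hpr : p ≠ r) (hps : p ≠ s) (hqs : q ≠ s) :
    swapEdge (swapEdge (swapEdge G p q) r s) q p = swapEdge G r s := by
  ext x y
  simp only [swapEdge_adj]
  have h1 : s(x, y) = p → G.Adj x y := by rintro rfl; exact hp
  have h2 : s(x, y) = q → ¬ G.Adj x y := by rintro rfl; exact hq
  have h3 : G.Adj x y → x ≠ y := fun h => h.ne
  generalize s(x, y) = z at *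
  generalize G.Adj x y = A at *
  generalize (x ≠ y) = B at *
  by_cases e1 : z = p
  · subst e1
    tauto
  · by_cases e2 : z = q
    · subst e2
      tauto
    · tauto

theorem odd_cnt_singleton {t : ℤ × ℤ × Bool} {u v w x y : ℤ × ℤ} (hc : corners t = {u, v, w})
    (hxy : x ≠ y) :
    Odd (cnt {t} x y) ↔ s(x, y) = s(u, v) ∨ s(x, y) = s(u, w) ∨ s(x, y) = s(v, w) := by
  rw [cnt_singleton, hc]
  simp only [Finset.mem_insert, Finset.mem_singleton, Sym2.eq_iff]
  constructor
  · intro h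
    split_ifs at h with h'
    · grind
    · simp at h
  · intro h
    rw [if_pos (by grind)]
    exact odd_one

/-- The step of the exchange lemma: the third corner `w` of a triangle at `u v` inside the loop is
on the side of `u`. -/
theorem exchange_step {a b u v : ℤ × ℤ} {D : Finset (ℤ × ℤ × Bool)}
    (ih : ∀ (G' : SimpleGraph (ℤ × ℤ)) (a' b' u' v' : ℤ × ℤ) (D' : Finset (ℤ × ℤ × Bool)),
      D'.card < D.card → Forest n c G' → Fill n G' a' b' D' → (lat n).Adj a' b' →
      c a' = c b' → ¬ G'.Adj a' b' → G'.Adj u' v' → Odd (cnt D' u' v') →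
      Relation.ReflTransGen (Rotates n) G' (swapEdge G' s(u', v') s(a', b')))
    (h : Forest n c G) (hD : Fill n G a b D) (hab : (lat n).Adj a b) (hcab : c a = c b) (hGab : ¬ G.Adj a b)
    (huv : G.Adj u v) (ho : Odd (cnt D u v)) {t : ℤ × ℤ × Bool} (ht : t ∈ D) {w : ℤ × ℤ}
    (hwu : w ≠ u) (hwv : w ≠ v) (hc : corners t = {u, v, w})
    (hUw : (G.deleteEdges {s(u, v)}).Reachable u w) :
    Relation.ReflTransGen (Rotates n) G (swapEdge G s(u, v) s(a, b)) := by
  have hle : G.deleteEdges {s(u, v)} ≤ G := SimpleGraph.deleteEdges_le _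
  have htT : t ∈ trs n := hD.sub ht
  have hut : u ∈ corners t := by simp [hc]
  have hvt : v ∈ corners t := by simp [hc]
  have hwt : w ∈ corners t := by simp [hc]
  have hsep := hD.separates h huv ho
  have hvw : ¬ G.Adj v w := by
    intro hadj
    have h1 : (G.deleteEdges {s(u, v)}).Adj v w := by
      simp [hadj, hwu, huv.ne.symm]
    exact h.not_reachable huv (hUw.trans h1.symm.reachable)
  have hvw' : (lat n).Adj v w := lat_adj_of_mem_corners htT hvt hwt hwv.symm
  have huw' : (lat n).Adj u w := lat_adj_of_mem_corners htT hut hwt hwu.symm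
  have hcuw : c u = c w := (h.reach u w huw'.1 huw'.2.1).1 (hUw.mono hle)
  have hcuv : c u = c v := (h.reach u v huw'.1 hvw'.1).1 huv.reachable
  have huwab : s(u, w) ≠ s(a, b) := by
    intro he
    rcases Sym2.eq_iff.1 he with ⟨rfl, rfl⟩ | ⟨rfl, rfl⟩
    · rcases hsep with hh | hh
      · exact hh.2 hUw
      · exact hh.2 (SimpleGraph.Reachable.refl _)
    · rcases hsep with hh | hh
      · exact hh.2 (SimpleGraph.Reachable.refl _)
      · exact hh.2 hUw
  have huvab : s(u, v) ≠ s(a, b) := by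
    intro he
    rw [← SimpleGraph.mem_edgeSet, ← he] at hGab
    exact hGab huv
  have huvuw : s(u, v) ≠ s(u, w) := by simp [hwv.symm, hwu.symm]
  have huvvw : s(u, v) ≠ s(v, w) := by simp [hwu.symm, huv.ne]
  have huwvw : s(u, w) ≠ s(v, w) := by simp [hwu.symm, huv.ne]
  have hF1 : Forest n c (swapEdge G s(u, v) s(v, w)) := by
    rw [Sym2.eq_swap (a := v)]
    exact h.swapEdge huv hvw'.symm hUw (h.not_reachable huv) (hcuw.symm.trans hcuv)
  -- First exchange `u v` for `v w`. If `u w` is in `G`, this is a rotation in `t`, with `S` empty.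
  -- If not, `S` fills the loop closed by `u w`. An edge of that loop is lent to `u w`, the rotation
  -- is made, and the loan is undone, the two outer exchanges by induction inside `S`.
  obtain ⟨S, hSD, htS, hS, hSuv, hSuw, hreach⟩ : ∃ S ⊆ D, t ∉ S ∧
      (∀ x y, x ≠ y → Odd (cnt S x y) → s(x, y) = s(u, w) ∨ G.Adj x y) ∧ ¬ Odd (cnt S u v) ∧
      (¬ G.Adj u w → Odd (cnt S u w)) ∧
      Relation.ReflTransGen (Rotates n) G (swapEdge G s(u, v) s(v, w)) := by
    by_cases huw : G.Adj u w
    · refine ⟨∅, by simp, by simp, fun x y _ ho => ?_, ?_, fun hh => absurd huw hh,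
        Relation.ReflTransGen.single ⟨t, htT, u, v, w, hc, huv, huw, hvw, rfl⟩⟩
      · simp [cnt] at ho
      · simp [cnt]
    · obtain ⟨S, hS⟩ := h.exists_fill huw' huw hcuw
      have hSD : S ⊆ D := hD.subset hS h ht hut hwt
      have hSuv : ¬ Odd (cnt S u v) := by
        intro hodd
        rcases hS.separates h huv hodd with hh | hh
        · exact hh.2 hUw
        · exact hh.2 (SimpleGraph.Reachable.refl _)
      -- If `t` were in `S`, both triangles at `u v` would be in `S`, hence in `D`, although `u v`
      -- is on the boundary of `D`.
      have htS : t ∉ S := by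
        intro htS
        have h1 := cnt_pos htS hut hvt
        have h2 := cnt_sdiff hSD u v
        have h3 := cnt_le_two D huv.ne
        rw [Nat.odd_iff] at hSuv ho
        omega
      have hcard : S.card < D.card := Finset.card_lt_card
        ⟨hSD, fun hh => htS (hh ht)⟩
      -- The cut that isolates `u`: the boundary of `S` leaves `u` by an edge other than `u w`. From
      -- here `u` is called `x`.
      obtain ⟨x, y, rfl, hy, hxy, hne⟩ := exists_other_of_odd_cnt (fun x => x = u) rfl
        hwu hS.odd
      have hyw : y ≠ w := by simpa using hne
      have hyv : y ≠ v := by rintro rfl; exact hSuv hxy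
      have hadj : G.Adj x y := (hS.closed x y (Ne.symm hy) hxy).resolve_left (by
        intro he
        rcases Sym2.eq_iff.1 he with ⟨_, h⟩ | ⟨h, _⟩
        · exact hyw h
        · exact hwu h.symm)
      have hFa : Forest n c (swapEdge G s(x, y) s(x, w)) :=
        hS.forest_swapEdge h huw' hcuw hadj hxy
      have hxyxv : s(x, v) ≠ s(x, y) := by simp [hyv.symm, Ne.symm hy]
      have hxyxw : s(x, w) ≠ s(x, y) := by simp [hyw.symm, Ne.symm hy]
      have hxyvw : s(x, y) ≠ s(v, w) := by
        intro he
        rcases Sym2.eq_iff.1 he with ⟨h, _⟩ | ⟨h, _⟩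
        · exact huv.ne h
        · exact hwu h.symm
      have step1 := ih G x w x y S hcard h hS huw' hcuw huw hadj hxy
      have hrot : Rotates n (swapEdge G s(x, y) s(x, w))
          (swapEdge (swapEdge G s(x, y) s(x, w)) s(x, v) s(v, w)) := by
        refine ⟨t, htT, x, v, w, hc, ?_, ?_, ?_, rfl⟩
        · exact swapEdge_adj.2 (Or.inl ⟨huv, hxyxv⟩)
        · exact swapEdge_adj.2 (Or.inr ⟨rfl, hwu.symm⟩)
        · rw [swapEdge_adj]
          rintro (hh | hh)
          · exact hvw hh.1
          · exact huwvw hh.1.symm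
      have hFb := hrot.forest hFa
      set Gb := swapEdge (swapEdge G s(x, y) s(x, w)) s(x, v) s(v, w) with hGb
      have hbxw : Gb.Adj x w :=
        swapEdge_adj.2 (Or.inl ⟨swapEdge_adj.2 (Or.inr ⟨rfl, hwu.symm⟩), huvuw.symm⟩)
      have hbxy : ¬ Gb.Adj x y := by
        rw [hGb, swapEdge_adj, swapEdge_adj]
        have := hxyxw.symm
        clear * - this hxyvw
        tauto
      have hfill : Fill n Gb x y S := by
        refine ⟨hS.sub, hxy, fun p q hpq hodd => ?_⟩
        by_cases h1 : s(p, q) = s(x, y)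
        · exact Or.inl h1
        · right
          have h2 : s(p, q) ≠ s(x, v) := fun he => hSuv (by rwa [cnt_congr S he] at hodd)
          rw [hGb, swapEdge_adj, swapEdge_adj]
          rcases hS.closed p q hpq hodd with h3 | h3
          · exact Or.inl ⟨Or.inr ⟨h3, hpq⟩, h2⟩
          · exact Or.inl ⟨Or.inl ⟨h3, h1⟩, h2⟩
      have step3 := ih Gb x y x w S hcard hFb hfill (h.le hadj)
        ((h.reach _ _ (h.inTri_left hadj) (h.inTri_right hadj)).1 hadj.reachable) hbxy hbxw hS.odd
      have hfin : swapEdge Gb s(x, w) s(x, y) = swapEdge G s(x, v) s(v, w) := by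
        exact swapEdge_swapEdge_swapEdge hadj huw hxyxw.symm hxyxv.symm hxyvw huwvw
      rw [hfin] at step3
      exact ⟨S, hSD, htS, hS.closed, hSuv, fun _ => hS.odd,
        step1.trans ((Relation.ReflTransGen.single hrot).trans step3)⟩
  by_cases hvwab : s(v, w) = s(a, b)
  · rwa [← hvwab]
  refine hreach.trans ?_
  have hE : insert t S ⊆ D := Finset.insert_subset ht hSD
  -- Once `v w` has replaced `u v`, the loop closed by `a b` runs along `v w` and bounds what is
  -- left of `D` after removing `t` and `S`. So `v w` can be exchanged for `a b` by induction.
  set D1 := D \ insert t S with hD1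
  have hpar : ∀ x y, x ≠ y → (Odd (cnt D1 x y) ↔ ¬ (Odd (cnt D x y) ↔
      ¬ (Odd (cnt S x y) ↔
        (s(x, y) = s(u, v) ∨ s(x, y) = s(u, w) ∨ s(x, y) = s(v, w))))) := by
    intro x y hxy
    rw [← odd_cnt_singleton hc hxy]
    have h1 := cnt_sdiff hE x y
    have h2 : cnt (insert t S) x y = cnt {t} x y + cnt S x y := by
      rw [Finset.insert_eq, cnt_union (by simpa using htS)]
    rw [← hD1] at h1
    simp only [Nat.odd_iff]
    omega
  have hcard : D1.card < D.card := Finset.card_lt_card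
    ⟨Finset.sdiff_subset, fun hh => by simpa [hD1] using hh ht⟩
  have hSab : ¬ Odd (cnt S a b) := fun hodd =>
    (hS a b hab.2.2.ne hodd).elim huwab.symm hGab
  have hvwG1 : (swapEdge G s(u, v) s(v, w)).Adj v w := swapEdge_adj.2 (Or.inr ⟨rfl, hwv.symm⟩)
  have hDvw : ¬ Odd (cnt D v w) := fun hodd => (hD.closed v w hwv.symm hodd).elim hvwab hvw
  have hSvw : ¬ Odd (cnt S v w) := fun hodd => (hS v w hwv.symm hodd).elim huwvw.symm hvw
  have hfill : Fill n (swapEdge G s(u, v) s(v, w)) a b D1 := by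
    refine ⟨Finset.sdiff_subset.trans hD.sub, ?_, fun x y hxy hodd => ?_⟩
    · rw [hpar a b hab.2.2.ne]
      have := hD.odd
      have h1 := huvab.symm
      have h2 := huwab.symm
      have h3 := Ne.symm hvwab
      clear * - this hSab h1 h2 h3
      tauto
    · rw [hpar x y hxy] at hodd
      by_cases e0 : s(x, y) = s(a, b)
      · exact Or.inl e0
      right
      rw [swapEdge_adj]
      by_cases e1 : s(x, y) = s(v, w)
      · exact Or.inr ⟨e1, hxy⟩
      left
      by_cases e2 : s(x, y) = s(u, v)
      · exfalso
        rw [cnt_congr D e2, cnt_congr S e2] at hodd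
        clear * - hodd e2 ho hSuv
        tauto
      refine ⟨?_, e2⟩
      by_contra hadj
      have h1 : ¬ Odd (cnt D x y) := fun hodd => (hD.closed x y hxy hodd).elim e0 hadj
      by_cases e3 : s(x, y) = s(u, w)
      · have h2 : Odd (cnt S x y) := by
          rw [cnt_congr S e3]
          refine hSuw fun hh => hadj ?_
          rw [← SimpleGraph.mem_edgeSet, e3]; exact hh
        clear * - hodd e3 h1 h2
        tauto
      · have h2 : ¬ Odd (cnt S x y) := fun hodd => (hS x y hxy hodd).elim e3 hadj
        clear * - hodd e1 e2 e3 h1 h2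
        tauto
  have hoddvw : Odd (cnt D1 v w) := by
    rw [hpar v w hwv.symm]
    clear * - hDvw hSvw
    tauto
  have hGab1 : ¬ (swapEdge G s(u, v) s(v, w)).Adj a b := by
    rw [swapEdge_adj]
    rintro (hh | hh)
    · exact hGab hh.1
    · exact hvwab hh.1.symm
  have := ih _ a b v w D1 hcard hF1 hfill hab hcab hGab1 hvwG1 hoddvw
  rwa [swapEdge_swapEdge hvw] at this

/-- An edge of the loop closed up by `a b` can be exchanged for `a b` by rotations in triangles. -/
theorem exchange (hb : ∀ x, InTri n x → ∃ p, IsBdry n p ∧ c p = c x) (N : ℕ) :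
    ∀ (G : SimpleGraph (ℤ × ℤ)) (a b u v : ℤ × ℤ) (D : Finset (ℤ × ℤ × Bool)),
      D.card < N → Forest n c G → Fill n G a b D → (lat n).Adj a b →
      c a = c b → ¬ G.Adj a b → G.Adj u v → Odd (cnt D u v) →
      Relation.ReflTransGen (Rotates n) G (swapEdge G s(u, v) s(a, b)) := by
  induction N with
  | zero => intro _ _ _ _ _ _ hcard; omega
  | succ N ih =>
    intro G a b u v D hcard h hD hab hca hGab huv ho
    obtain ⟨t, ht, hut, hvt⟩ := exists_mem_of_odd_cnt ho
    obtain ⟨w, hwu, hwv, hc⟩ := exists_third_corner hut hvt huv.ne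
    -- The loop encloses only its own component, so after deleting `u v` the corner `w` is on one of
    -- the two sides. The two cases are symmetric.
    have hw : G.Reachable u w := by
      rw [h.reach u w (h.inTri_left huv) (inTri_of_mem_corners (hD.sub ht) (by simp [hc]))]
      exact (hD.eq_of_mem_corners h hab hca hb ht hut).trans
        (hD.eq_of_mem_corners h hab hca hb ht (by simp [hc])).symm
    have ih' : ∀ (G' : SimpleGraph (ℤ × ℤ)) (a' b' u' v' : ℤ × ℤ)
        (D' : Finset (ℤ × ℤ × Bool)), D'.card < D.card → Forest n c G' → Fill n G' a' b' D' →
        (lat n).Adj a' b' → c a' = c b' → ¬ G'.Adj a' b' → G'.Adj u' v' → Odd (cnt D' u' v') →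
        Relation.ReflTransGen (Rotates n) G' (swapEdge G' s(u', v') s(a', b')) :=
      fun G' a' b' u' v' D' hlt => ih G' a' b' u' v' D' (by omega)
    rcases reachable_deleteEdges_or (v := v) hw with hU | hV
    · exact exchange_step ih' h hD hab hca hGab huv ho ht hwu hwv hc hU
    · have := exchange_step ih' h hD hab hca hGab huv.symm (by rwa [cnt_comm]) ht hwv hwu
        (by rw [hc, Finset.insert_comm]) (by rwa [Sym2.eq_swap] )
      rwa [Sym2.eq_swap (a := v)] at this

/-- Any two spanning forests with the same components are connected by rotations in triangles. -/
theorem Forest.reflTransGen_rotates (hb : ∀ x, InTri n x → ∃ p, IsBdry n p ∧ c p = c x)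
    {G H : SimpleGraph (ℤ × ℤ)} (hG : Forest n c G) (hH : Forest n c H) :
    Relation.ReflTransGen (Rotates n) G H := by
  have hfin : H.edgeSet.Finite := by
    have : H.edgeSet ⊆ Set.image (fun p : (ℤ × ℤ) × (ℤ × ℤ) => s(p.1, p.2))
        ((Set.Icc (0, 0) ((n : ℤ), (n : ℤ))) ×ˢ (Set.Icc (0, 0) ((n : ℤ), (n : ℤ)))) := by
      intro e
      induction e with
      | h x y =>
        intro he
        obtain ⟨⟨h1, h2, h3⟩, ⟨h4, h5, h6⟩, _⟩ := hH.le (show H.Adj x y from he)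
        refine ⟨(x, y), ⟨⟨⟨h1, h2⟩, ?_⟩, ⟨⟨h4, h5⟩, ?_⟩⟩, rfl⟩
        · exact ⟨show x.1 ≤ n by omega, show x.2 ≤ n by omega⟩
        · exact ⟨show y.1 ≤ n by omega, show y.2 ≤ n by omega⟩
    exact ((((Set.finite_Icc _ _).prod (Set.finite_Icc _ _))).image _).subset this
  -- Induction on the number of edges of `H` missing in `G`.
  induction hk : (H.edgeSet \ G.edgeSet).ncard using Nat.strong_induction_on generalizing G with
  | _ k ih =>
  by_cases hle : H.edgeSet ⊆ G.edgeSet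
  · have hGH : G = H := by
      refine le_antisymm (fun x y hxy => ?_) (SimpleGraph.edgeSet_subset_edgeSet.1 hle)
      by_contra hn
      have hr : H.Reachable x y := by
        rw [hH.reach x y (hG.inTri_left hxy) (hG.inTri_right hxy),
          ← hG.reach x y (hG.inTri_left hxy) (hG.inTri_right hxy)]
        exact hxy.reachable
      refine hG.not_reachable hxy (hr.mono fun p q hpq => ?_)
      have h1 : G.Adj p q := SimpleGraph.edgeSet_subset_edgeSet.1 hle hpq
      rw [SimpleGraph.deleteEdges_adj]
      refine ⟨h1, fun he => hn ?_⟩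
      rw [Set.mem_singleton_iff] at he
      rw [← SimpleGraph.mem_edgeSet, ← he]
      exact hpq
    rw [hGH]
  · obtain ⟨e, heH, heG⟩ := Set.not_subset.1 hle
    induction e with
    | h a b =>
    have hab : (lat n).Adj a b := hH.le heH
    have hca : c a = c b := (hH.reach a b hab.1 hab.2.1).1 (SimpleGraph.Adj.reachable heH)
    obtain ⟨D, hD⟩ := hG.exists_fill hab heG hca
    -- If every forest edge on the loop were in `H`, the entire loop would lie in the forest `H`. So
    -- an edge not wanted by `H` can be given up for `a b`.
    obtain ⟨u, v, huv, hodd, hG', hH'⟩ : ∃ u v, u ≠ v ∧ Odd (cnt D u v) ∧ G.Adj u v ∧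
        ¬ H.Adj u v := by
      by_contra hcon
      push Not at hcon
      have := eq_empty_of_forest hH hD.sub fun x y hxy ho => by
        rcases hD.closed x y hxy ho with he | he
        · rw [← SimpleGraph.mem_edgeSet, he]; exact heH
        · exact hcon x y hxy ho he
      have ho := hD.odd
      simp [this, cnt] at ho
    have hstep := exchange hb (D.card + 1) G a b u v D (by omega) hG hD hab hca heG hG' hodd
    refine hstep.trans (ih _ ?_ (forest_of_reflTransGen hstep hG) rfl)
    rw [← hk]
    refine Set.ncard_lt_ncard ⟨?_, fun hh => ?_⟩ (hfin.subset Set.sdiff_subset)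
    · intro e
      induction e with
      | h x y =>
      rintro ⟨h1, h2⟩
      refine ⟨h1, fun h3 => h2 (swapEdge_adj.2 (Or.inl ⟨h3, fun he => hH' ?_⟩))⟩
      rw [← SimpleGraph.mem_edgeSet, ← he]; exact h1
    · exact (hh ⟨heH, heG⟩).2 (swapEdge_adj.2 (Or.inr ⟨rfl, hab.2.2.ne⟩))

end

/-! ### Groves in skew coordinates -/

/-- The lattice point at position `p.1` of row `p.2`. -/
def toPt (n : ℕ) (p : ℤ × ℤ) : ℤ × ℤ := (-n + p.2 + 2 * p.1, -p.2)

theorem toPt_injective (n : ℕ) : Function.Injective (toPt n) := by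
  rintro ⟨i, j⟩ ⟨k, l⟩ h
  simp only [toPt, Prod.mk.injEq] at h ⊢
  omega

theorem mem_points_iff {n : ℕ} {x : ℤ × ℤ} : x ∈ points n ↔ ∃ p, InTri n p ∧ toPt n p = x := by
  obtain ⟨a, b⟩ := x
  simp only [points, Set.mem_ofPred_eq, InTri, toPt, Prod.mk.injEq, Int.ModEq]
  constructor
  · rintro ⟨h1, h2, h3⟩
    refine ⟨((a + n + b) / 2, -b), ?_, ?_⟩ <;>
      rcases abs_cases a with h | h <;> rcases abs_cases b with h' | h' <;> simp only <;> omega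
  · rintro ⟨⟨i, j⟩, h1, h2, h3⟩
    simp only at *
    rcases abs_cases a with h | h <;> rcases abs_cases b with h' | h' <;> omega

theorem toPt_mem_points {n : ℕ} {p : ℤ × ℤ} : toPt n p ∈ points n ↔ InTri n p := by
  rw [mem_points_iff]
  constructor
  · rintro ⟨q, hq, he⟩
    rwa [← toPt_injective n he]
  · exact fun h => ⟨p, h, rfl⟩

/-- The skew coordinates of a point. -/
def skew (n : ℕ) (x : ℤ × ℤ) : ℤ × ℤ := ((x.1 + n + x.2) / 2, -x.2)

theorem skew_toPt (n : ℕ) (p : ℤ × ℤ) : skew n (toPt n p) = p := by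
  obtain ⟨i, j⟩ := p
  simp only [skew, toPt, Prod.mk.injEq]
  omega

theorem toPt_skew {n : ℕ} {x : ℤ × ℤ} (hx : x ∈ points n) : toPt n (skew n x) = x := by
  obtain ⟨p, _, rfl⟩ := mem_points_iff.1 hx
  rw [skew_toPt]

theorem inTri_skew {n : ℕ} {x : ℤ × ℤ} (hx : x ∈ points n) : InTri n (skew n x) := by
  obtain ⟨p, hp, rfl⟩ := mem_points_iff.1 hx
  rwa [skew_toPt]

/-- Skew coordinates as an embedding. -/
def skewEmb (n : ℕ) : points n ↪ ℤ × ℤ where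
  toFun x := skew n x
  inj' x y h := Subtype.ext (by rw [← toPt_skew x.2, ← toPt_skew y.2]; exact congrArg _ h)

theorem nb_iff_neighbours {n : ℕ} {p q : ℤ × ℤ} :
    Neighbours (toPt n p) (toPt n q) ↔ Nb p q := by
  obtain ⟨i, j⟩ := p
  obtain ⟨k, l⟩ := q
  simp only [Neighbours, Nb, toPt, Prod.mk.injEq]
  rcases abs_cases (-(n : ℤ) + j + 2 * i - (-(n : ℤ) + l + 2 * k)) with h | h <;>
    rcases abs_cases (-j - -l) with h' | h' <;> omega

/-- The label of a point in the identity configuration. -/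
def idLabel (n : ℕ) (p : ℤ × ℤ) : ℤ :=
  if p.2 ≤ p.1 then p.1 else if 2 * p.2 ≤ n then p.2 else -p.2

/-- The boundary set with the label of `b`. -/
def part (n : ℕ) (b : ℤ × ℤ) : Set (ℤ × ℤ) :=
  toPt n '' {p | IsBdry n p ∧ idLabel n p = idLabel n b}

theorem part_congr {n : ℕ} {b b' : ℤ × ℤ} (h : idLabel n b = idLabel n b') :
    part n b = part n b' := by
  rw [part, part, h]

theorem part_corner_left (n : ℕ) : part n (0, 0) = {(-(n : ℤ), 0)} := by
  have : {p | IsBdry n p ∧ idLabel n p = idLabel n (0, 0)} = {((0 : ℤ), (0 : ℤ))} := by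
    ext ⟨i, j⟩
    simp only [IsBdry, InTri, idLabel, Set.mem_ofPred_eq, Set.mem_singleton_iff, Prod.mk.injEq]
    split_ifs <;> omega
  rw [part, this, Set.image_singleton]
  simp [toPt]

theorem part_corner_right (n : ℕ) : part n ((n : ℤ), 0) = {((n : ℤ), 0)} := by
  have : {p | IsBdry n p ∧ idLabel n p = idLabel n ((n : ℤ), 0)} = {((n : ℤ), (0 : ℤ))} := by
    ext ⟨i, j⟩
    simp only [IsBdry, InTri, idLabel, Set.mem_ofPred_eq, Set.mem_singleton_iff, Prod.mk.injEq]
    split_ifs <;> omega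
  rw [part, this, Set.image_singleton, toPt, Set.singleton_eq_singleton_iff, Prod.mk.injEq]
  simp only; omega

theorem part_corner_below (n : ℕ) : part n (0, (n : ℤ)) = {(0, -(n : ℤ))} := by
  have : {p | IsBdry n p ∧ idLabel n p = idLabel n (0, (n : ℤ))} = {((0 : ℤ), (n : ℤ))} := by
    ext ⟨i, j⟩
    simp only [IsBdry, InTri, idLabel, Set.mem_ofPred_eq, Set.mem_singleton_iff, Prod.mk.injEq]
    split_ifs <;> omega
  rw [part, this, Set.image_singleton]
  simp [toPt]

theorem part_left {n : ℕ} {k : ℤ} (h0 : 0 < k) (hk : 2 * k < n) :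
    part n (k, 0) = {(-(n : ℤ) + 2 * k, 0), (-(n : ℤ) + k, -k)} := by
  have : {p | IsBdry n p ∧ idLabel n p = idLabel n (k, 0)} = {(k, (0 : ℤ)), ((0 : ℤ), k)} := by
    ext ⟨i, j⟩
    simp only [IsBdry, InTri, idLabel, Set.mem_ofPred_eq, Set.mem_insert_iff,
      Set.mem_singleton_iff, Prod.mk.injEq]
    split_ifs <;> omega
  rw [part, this, Set.image_pair]
  simp [toPt]

theorem part_right {n : ℕ} {k : ℤ} (h0 : 0 < k) (hk : 2 * k < n) :
    part n ((n : ℤ) - k, 0) = {((n : ℤ) - 2 * k, 0), ((n : ℤ) - k, -k)} := by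
  have : {p | IsBdry n p ∧ idLabel n p = idLabel n ((n : ℤ) - k, 0)} =
      {((n : ℤ) - k, (0 : ℤ)), ((n : ℤ) - k, k)} := by
    ext ⟨i, j⟩
    simp only [IsBdry, InTri, idLabel, Set.mem_ofPred_eq, Set.mem_insert_iff,
      Set.mem_singleton_iff, Prod.mk.injEq]
    split_ifs <;> omega
  rw [part, this, Set.image_pair]
  simp only [toPt]
  congr 2 <;> ring_nf

theorem part_row {n : ℕ} {k : ℤ} (h0 : (n : ℤ) < 2 * k) (hk : k < n) :
    part n (0, k) = {(-(n : ℤ) + k, -k), ((n : ℤ) - k, -k)} := by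
  have : {p | IsBdry n p ∧ idLabel n p = idLabel n (0, k)} =
      {((0 : ℤ), k), ((n : ℤ) - k, k)} := by
    ext ⟨i, j⟩
    simp only [IsBdry, InTri, idLabel, Set.mem_ofPred_eq, Set.mem_insert_iff,
      Set.mem_singleton_iff, Prod.mk.injEq]
    split_ifs <;> omega
  rw [part, this, Set.image_pair]
  simp only [toPt]
  congr 2 <;> ring_nf

theorem part_middle {n : ℕ} {k : ℤ} (hk : (n : ℤ) = 2 * k) :
    part n (k, 0) = {(0, 0), (-k, -k), (k, -k)} := by
  have : {p | IsBdry n p ∧ idLabel n p = idLabel n (k, 0)} =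
      {(k, (0 : ℤ)), ((0 : ℤ), k), (k, k)} := by
    ext ⟨i, j⟩
    simp only [IsBdry, InTri, idLabel, Set.mem_ofPred_eq, Set.mem_insert_iff,
      Set.mem_singleton_iff, Prod.mk.injEq]
    split_ifs <;> omega
  rw [part, this, Set.image_insert_eq, Set.image_pair]
  simp only [toPt, hk]
  congr 1
  · congr 1; ring
  · congr 2 <;> ring_nf

/-- The seven kinds of boundary sets become the level sets of the single function `idLabel` on the
boundary. -/
theorem mem_boundaryParts {n : ℕ} {P : Set (ℤ × ℤ)} :
    P ∈ boundaryParts n ↔ ∃ b, IsBdry n b ∧ P = part n b := by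
  simp only [boundaryParts, Set.mem_ofPred_eq]
  constructor
  · rintro (rfl | rfl | rfl | ⟨i, h1, h2, h3, rfl⟩ | ⟨i, h1, h2, h3, rfl⟩ | ⟨i, h1, h2, rfl⟩ |
      ⟨h, rfl⟩)
    · exact ⟨(0, 0), by simp [IsBdry, InTri], (part_corner_left n).symm⟩
    · exact ⟨(n, 0), by simp [IsBdry, InTri], (part_corner_right n).symm⟩
    · exact ⟨(0, n), by simp [IsBdry, InTri], (part_corner_below n).symm⟩
    · rw [Int.ModEq] at h3
      obtain ⟨k, rfl⟩ : ∃ k, i = n - 2 * k := ⟨(n - i) / 2, by omega⟩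
      refine ⟨(k, 0), by simp [IsBdry, InTri]; omega, ?_⟩
      have e1 : -((n : ℤ) - 2 * k) = -n + 2 * k := by ring
      have e2 : (-(n : ℤ) - (n - 2 * k)) / 2 = -n + k := by omega
      have e3 : (-(n : ℤ) + (n - 2 * k)) / 2 = -k := by omega
      rw [part_left (by omega) (by omega), e1, e2, e3]
    · rw [Int.ModEq] at h3
      obtain ⟨k, rfl⟩ : ∃ k, i = n - 2 * k := ⟨(n - i) / 2, by omega⟩
      refine ⟨(n - k, 0), by simp [IsBdry, InTri]; omega, ?_⟩
      have e2 : ((n : ℤ) + (n - 2 * k)) / 2 = n - k := by omega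
      have e3 : (-(n : ℤ) + (n - 2 * k)) / 2 = -k := by omega
      rw [part_right (by omega) (by omega), e2, e3]
    · exact ⟨(0, i), by simp [IsBdry, InTri]; omega, (part_row h1 h2).symm⟩
    · obtain ⟨k, hk⟩ := h
      refine ⟨((k : ℤ), 0), by simp [IsBdry, InTri]; omega, ?_⟩
      rw [part_middle (by omega)]
      have : (n : ℤ) / 2 = k := by omega
      rw [this]
  · rintro ⟨⟨i, j⟩, hb, rfl⟩
    -- A nonnegative label is found on the top row, a negative one on the left side below the
    -- middle.
    have hcl : (∃ k : ℤ, 0 ≤ k ∧ k ≤ n ∧ idLabel n (i, j) = idLabel n (k, 0)) ∨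
        ∃ k : ℤ, (n : ℤ) < 2 * k ∧ k ≤ n ∧ idLabel n (i, j) = idLabel n (0, k) := by
      simp only [IsBdry, InTri] at hb
      by_cases h1 : j ≤ i
      · exact Or.inl ⟨i, by omega, by omega, by simp only [idLabel]; split_ifs <;> omega⟩
      · by_cases h2 : 2 * j ≤ n
        · exact Or.inl ⟨j, by omega, by omega, by simp only [idLabel]; split_ifs <;> omega⟩
        · exact Or.inr ⟨j, by omega, by omega, by simp only [idLabel]; split_ifs <;> omega⟩
    rcases hcl with ⟨k, h0, h1, h2⟩ | ⟨k, h0, h1, h2⟩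
    · rw [part_congr h2]
      rcases eq_or_lt_of_le h0 with rfl | h0
      · exact Or.inl (part_corner_left n)
      rcases eq_or_lt_of_le h1 with rfl | h1
      · exact Or.inr (Or.inl (part_corner_right n))
      rcases lt_trichotomy (2 * k) n with h | h | h
      · refine Or.inr (Or.inr (Or.inr (Or.inl ⟨n - 2 * k, by omega, by omega, ?_, ?_⟩)))
        · rw [Int.ModEq]; omega
        · rw [part_left h0 h]
          congr 2
          · omega
          · congr 1 <;> omega
      · refine Or.inr (Or.inr (Or.inr (Or.inr (Or.inr (Or.inr ⟨?_, ?_⟩)))))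
        · exact (Int.even_coe_nat n).1 ⟨k, by omega⟩
        · rw [part_middle h.symm]
          have : (n : ℤ) / 2 = k := by omega
          rw [this]
      · refine Or.inr (Or.inr (Or.inr (Or.inr (Or.inl ⟨2 * k - n, by omega, by omega, ?_, ?_⟩))))
        · rw [Int.ModEq]; omega
        · have := part_right (n := n) (k := n - k) (by omega) (by omega)
          have e1 : (n : ℤ) - 2 * (n - k) = 2 * k - n := by ring
          have e2 : ((n : ℤ) + (2 * k - n)) / 2 = k := by omega
          have e3 : (-(n : ℤ) + (2 * k - n)) / 2 = -(n - k) := by omega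
          rw [sub_sub_cancel, e1] at this
          rw [this, e2, e3]
    · rw [part_congr h2]
      rcases eq_or_lt_of_le h1 with rfl | h1
      · exact Or.inr (Or.inr (Or.inl (part_corner_below n)))
      · exact Or.inr (Or.inr (Or.inr (Or.inr (Or.inr (Or.inl ⟨k, h0, h1, part_row h0 h1⟩)))))

/-- The boundary points have the labels of the identity configuration, and every label occurs on
the boundary. -/
structure Valid (n : ℕ) (c : ℤ × ℤ → ℤ) : Prop where
  bdry : ∀ p, IsBdry n p → c p = idLabel n p
  onBdry : ∀ x, InTri n x → ∃ p, IsBdry n p ∧ c p = c x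

/-! ### Groves are forests with valid labels. -/

theorem exists_reachable_of_map {V W : Type*} {f : V ↪ W} {G : SimpleGraph V} {a : V} {w : W}
    (h : (G.map f).Reachable (f a) w) : ∃ b, f b = w ∧ G.Reachable a b := by
  rw [SimpleGraph.reachable_iff_reflTransGen] at h
  induction h with
  | refl => exact ⟨a, rfl, SimpleGraph.Reachable.refl _⟩
  | tail _ hxy ih =>
    obtain ⟨b, rfl, hb⟩ := ih
    obtain ⟨p, q, hpq, h1, rfl⟩ := (SimpleGraph.map_adj f G _ _).1 hxy
    rw [f.injective h1] at hpq
    exact ⟨q, rfl, hb.trans hpq.reachable⟩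

theorem reachable_map_iff {V W : Type*} {f : V ↪ W} {G : SimpleGraph V} {a b : V} :
    (G.map f).Reachable (f a) (f b) ↔ G.Reachable a b := by
  constructor
  · intro h
    obtain ⟨b', hb, h'⟩ := exists_reachable_of_map h
    rwa [f.injective hb] at h'
  · exact fun h => h.map (SimpleGraph.Embedding.map f G).toHom

theorem isAcyclic_map {V W : Type*} {f : V ↪ W} {G : SimpleGraph V} (h : G.IsAcyclic) :
    (G.map f).IsAcyclic := by
  rw [SimpleGraph.isAcyclic_iff_forall_adj_isBridge] at *
  intro x y hxy
  obtain ⟨a, b, hab, rfl, rfl⟩ := (SimpleGraph.map_adj f G _ _).1 hxy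
  rw [SimpleGraph.isBridge_iff]
  intro hr
  refine SimpleGraph.isBridge_iff.1 (h hab) ?_
  rw [← reachable_map_iff (f := f)]
  refine hr.mono fun p q hpq => ?_
  rw [SimpleGraph.deleteEdges_adj] at hpq
  obtain ⟨p, q, hpq', rfl, rfl⟩ := (SimpleGraph.map_adj f G _ _).1 hpq.1
  refine (SimpleGraph.map_adj f _ _ _).2 ⟨p, q, ?_, rfl, rfl⟩
  rw [SimpleGraph.deleteEdges_adj]
  refine ⟨hpq', fun he => hpq.2 ?_⟩
  rw [Set.mem_singleton_iff] at he ⊢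
  have := congrArg (Sym2.map f) he
  simpa using this

/-- A grove, in skew coordinates, is a spanning forest with valid labels. -/
theorem exists_forest_of_isGrove {n : ℕ} {G : SimpleGraph (points n)} (hG : IsGrove n G) :
    ∃ c, Valid n c ∧ Forest n c (G.map (skewEmb n)) := by
  classical
  set H := G.map (skewEmb n) with hH
  have hex : ∀ x : points n, ∃ b : points n, IsBdry n (skew n b) ∧ G.Reachable x b := by
    intro x
    obtain ⟨P, ⟨hP, hPK⟩, _⟩ := hG.component_contains (G.connectedComponentMk x)
    obtain ⟨b, hb, rfl⟩ := mem_boundaryParts.1 hP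
    obtain ⟨y, hy, hyb⟩ := hPK ⟨b, ⟨hb, rfl⟩, rfl⟩
    refine ⟨y, by rw [hyb, skew_toPt]; exact hb, ?_⟩
    exact (SimpleGraph.ConnectedComponent.exact hy).symm
  have hpartK : ∀ b : points n, IsBdry n (skew n b) →
      part n (skew n b) ⊆ Subtype.val '' (G.connectedComponentMk b).supp := by
    intro b hb
    obtain ⟨K, hK⟩ := hG.contained_in_component _ (mem_boundaryParts.2 ⟨skew n b, hb, rfl⟩)
    obtain ⟨y, hy, hyb⟩ := hK ⟨skew n b, ⟨hb, rfl⟩, rfl⟩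
    rw [toPt_skew b.2] at hyb
    have : y = b := Subtype.ext hyb
    subst this
    have : G.connectedComponentMk y = K := hy
    rwa [this]
  -- Uniqueness of the boundary set in a component gives one direction, its containment in a
  -- component the other.
  have hiff : ∀ b b' : points n, IsBdry n (skew n b) → IsBdry n (skew n b') →
      (G.Reachable b b' ↔ idLabel n (skew n b) = idLabel n (skew n b')) := by
    intro b b' hb hb'
    constructor
    · intro hr
      obtain ⟨P, _, huniq⟩ := hG.component_contains (G.connectedComponentMk b)
      have h1 := huniq _ ⟨mem_boundaryParts.2 ⟨skew n b, hb, rfl⟩, hpartK b hb⟩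
      have h2 := huniq _ ⟨mem_boundaryParts.2 ⟨skew n b', hb', rfl⟩, by
        rw [SimpleGraph.ConnectedComponent.sound hr]; exact hpartK b' hb'⟩
      have h3 : toPt n (skew n b) ∈ part n (skew n b') := by
        rw [h2, ← h1]; exact ⟨_, ⟨hb, rfl⟩, rfl⟩
      obtain ⟨p, hp, hpe⟩ := h3
      rw [← toPt_injective n hpe]
      exact hp.2
    · intro he
      have h1 : toPt n (skew n b') ∈ part n (skew n b) := ⟨_, ⟨hb', he.symm⟩, rfl⟩
      obtain ⟨y, hy, hyb⟩ := hpartK b hb h1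
      rw [toPt_skew b'.2] at hyb
      have : y = b' := Subtype.ext hyb
      subst this
      exact (SimpleGraph.ConnectedComponent.exact hy).symm
  choose β hβ hβr using hex
  let pt : ∀ p : ℤ × ℤ, InTri n p → points n := fun p hp => ⟨toPt n p, toPt_mem_points.2 hp⟩
  have hpt : ∀ p hp, skewEmb n (pt p hp) = p := fun p hp => skew_toPt n p
  -- The label of a point is that of a chosen boundary point in its component. The value 0 outside
  -- the triangle is irrelevant.
  let c : ℤ × ℤ → ℤ := fun p => if hp : InTri n p then idLabel n (skew n (β (pt p hp))) else 0
  have hc : ∀ p (hp : InTri n p), c p = idLabel n (skew n (β (pt p hp))) :=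
    fun p hp => dif_pos hp
  have hbd : ∀ p (hp : IsBdry n p), c p = idLabel n p := by
    intro p hp
    have hs : skew n (pt p hp.1 : ℤ × ℤ) = p := hpt p hp.1
    have h1 := (hiff (pt p hp.1) (β (pt p hp.1)) (by rw [hs]; exact hp) (hβ _)).1 (hβr _)
    exact (hc p hp.1).trans (h1.symm.trans (congrArg _ hs))
  refine ⟨c, ⟨hbd, fun x hx => ?_⟩, ⟨?_, isAcyclic_map hG.acyclic, fun u v hu hv => ?_⟩⟩
  · refine ⟨_, hβ (pt x hx), ?_⟩
    rw [hbd _ (hβ _), hc x hx]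
  · intro x y hxy
    obtain ⟨a, b, hab, rfl, rfl⟩ := (SimpleGraph.map_adj _ _ _ _).1 hxy
    refine ⟨inTri_skew a.2, inTri_skew b.2, ?_⟩
    rw [← nb_iff_neighbours (n := n)]
    have := hG.lattice a b hab
    rwa [← toPt_skew a.2, ← toPt_skew b.2] at this
  · rw [hc u hu, hc v hv, ← hiff _ _ (hβ _) (hβ _)]
    have h1 := reachable_map_iff (f := skewEmb n) (G := G) (a := pt u hu) (b := pt v hv)
    rw [hpt u hu, hpt v hv] at h1
    rw [h1]
    exact ⟨fun h => ((hβr _).symm.trans h).trans (hβr _),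
      fun h => ((hβr _).trans h).trans (hβr _).symm⟩

/-- Converse of `exists_forest_of_isGrove`: since each label occurs on the boundary, each component
contains the boundary set of its label and no other. -/
theorem isGrove_comap {n : ℕ} {c : ℤ × ℤ → ℤ} {G : SimpleGraph (ℤ × ℤ)} (h : Forest n c G)
    (hc : Valid n c) : IsGrove n (G.comap (skewEmb n)) ∧ (G.comap (skewEmb n)).map (skewEmb n) = G := by
  have hmap : (G.comap (skewEmb n)).map (skewEmb n) = G := by
    refine le_antisymm (SimpleGraph.map_comap_le _ _) fun x y hxy => ?_
    refine (SimpleGraph.map_adj _ _ _ _).2 ⟨⟨toPt n x, toPt_mem_points.2 (h.inTri_left hxy)⟩,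
      ⟨toPt n y, toPt_mem_points.2 (h.inTri_right hxy)⟩, ?_, skew_toPt n x, skew_toPt n y⟩
    rw [SimpleGraph.comap_adj]
    show G.Adj (skew n (toPt n x)) (skew n (toPt n y))
    rwa [skew_toPt, skew_toPt]
  refine ⟨?_, hmap⟩
  have hreach : ∀ a b : points n, (G.comap (skewEmb n)).Reachable a b ↔
      c (skew n a) = c (skew n b) := by
    intro a b
    rw [← reachable_map_iff (f := skewEmb n), hmap]
    exact h.reach _ _ (inTri_skew a.2) (inTri_skew b.2)
  have hsub : ∀ (b : points n), IsBdry n (skew n b) → ∀ a : points n,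
      (part n (skew n b) ⊆ Subtype.val '' ((G.comap (skewEmb n)).connectedComponentMk a).supp ↔
        c (skew n a) = c (skew n b)) := by
    intro b hb a
    constructor
    · intro hh
      obtain ⟨y, hy, hyb⟩ := hh ⟨skew n b, ⟨hb, rfl⟩, rfl⟩
      rw [toPt_skew b.2] at hyb
      have : y = b := Subtype.ext hyb
      subst this
      exact (hreach _ _).1 (SimpleGraph.ConnectedComponent.exact hy).symm
    · rintro hab _ ⟨p, ⟨hp, hpb⟩, rfl⟩
      refine ⟨⟨toPt n p, toPt_mem_points.2 hp.1⟩, ?_, rfl⟩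
      refine SimpleGraph.ConnectedComponent.sound ((hreach _ _).2 ?_)
      rw [skew_toPt, hab, hc.bdry p hp, hc.bdry _ hb, hpb]
  refine ⟨fun u v huv => ?_, h.acyclic.of_comap _, fun K => ?_, fun P hP => ?_⟩
  · have := (h.le (SimpleGraph.comap_adj.1 huv)).2.2
    rw [← nb_iff_neighbours (n := n)] at this
    have h1 : toPt n (skewEmb n u) = u := toPt_skew u.2
    have h2 : toPt n (skewEmb n v) = v := toPt_skew v.2
    rwa [h1, h2] at this
  · induction K using SimpleGraph.ConnectedComponent.ind with
    | h a =>
    obtain ⟨b, hb, hba⟩ := hc.onBdry _ (inTri_skew a.2)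
    have hbs : skew n (toPt n b) = b := skew_toPt n b
    refine ⟨part n b, ⟨mem_boundaryParts.2 ⟨b, hb, rfl⟩, ?_⟩, ?_⟩
    · have := hsub ⟨toPt n b, toPt_mem_points.2 hb.1⟩ (by rw [hbs]; exact hb) a
      rw [hbs] at this
      exact this.2 hba.symm
    · rintro P ⟨hP, hPK⟩
      obtain ⟨b', hb', rfl⟩ := mem_boundaryParts.1 hP
      have hbs' : skew n (toPt n b') = b' := skew_toPt n b'
      have := hsub ⟨toPt n b', toPt_mem_points.2 hb'.1⟩ (by rw [hbs']; exact hb') a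
      rw [hbs'] at this
      refine part_congr ?_
      rw [← hc.bdry _ hb, ← hc.bdry _ hb', hba, ← this.1 hPK]
  · obtain ⟨b, hb, rfl⟩ := mem_boundaryParts.1 hP
    have hbs : skew n (toPt n b) = b := skew_toPt n b
    have := hsub ⟨toPt n b, toPt_mem_points.2 hb.1⟩ (by rw [hbs]; exact hb)
      ⟨toPt n b, toPt_mem_points.2 hb.1⟩
    rw [hbs] at this
    exact ⟨_, this.2 rfl⟩

/-! ### The array of a graph in skew coordinates -/

open Classical in
/-- The entry of the array of `G` at the downward triangle with upper left corner `p`. -/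
noncomputable def entry (G : SimpleGraph (ℤ × ℤ)) (p : ℤ × ℤ) : ℤ :=
  1 - (if G.Adj p (p.1 + 1, p.2) then 1 else 0) - (if G.Adj p (p.1, p.2 + 1) then 1 else 0) -
    (if G.Adj (p.1 + 1, p.2) (p.1, p.2 + 1) then 1 else 0)

/-- The upper left corner of the downward triangle with lower vertex `x`, in skew coordinates. -/
def corner (n : ℕ) (x : ℤ × ℤ) : ℤ × ℤ := ((skew n x).1, (skew n x).2 - 1)

/-- The triangular array of a graph in skew coordinates. -/
noncomputable def arr (n : ℕ) (G : SimpleGraph (ℤ × ℤ)) : TriArray n := fun x =>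
  entry G (corner n x)

theorem mem_cells_iff {n : ℕ} {x : ℤ × ℤ} :
    x ∈ cells n ↔ ∃ i j, 0 ≤ i ∧ 0 ≤ j ∧ i + j + 1 ≤ (n : ℤ) ∧ x = toPt n (i, j + 1) := by
  have h1 : ∀ i j : ℤ, downTriangle (toPt n (i, j + 1)) =
      {toPt n (i, j + 1), toPt n (i, j), toPt n (i + 1, j)} := by
    intro i j
    simp only [downTriangle, toPt]
    congr 2
    · ext <;> simp; ring
    · congr 1; ext <;> simp; ring
  constructor
  · intro hx
    have hx0 : x ∈ points n := hx (by simp [downTriangle])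
    obtain ⟨⟨i, j⟩, hij, rfl⟩ := mem_points_iff.1 hx0
    obtain ⟨j, rfl⟩ : ∃ k, j = k + 1 := ⟨j - 1, by ring⟩
    have hx' : downTriangle (toPt n (i, j + 1)) ⊆ points n := hx
    rw [h1] at hx'
    have h2 := toPt_mem_points.1 (hx' (by simp : toPt n (i, j) ∈ _))
    have h3 := toPt_mem_points.1 (hx' (by simp : toPt n (i + 1, j) ∈ _))
    simp only [InTri] at hij h2 h3
    exact ⟨i, j, by omega, by omega, by omega, rfl⟩
  · rintro ⟨i, j, hi, hj, hn, rfl⟩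
    show downTriangle (toPt n (i, j + 1)) ⊆ points n
    rw [h1]
    rintro _ (rfl | rfl | rfl) <;> rw [toPt_mem_points] <;> simp only [InTri] <;> omega

theorem corner_toPt (n : ℕ) (i j : ℤ) : corner n (toPt n (i, j + 1)) = (i, j) := by
  rw [corner, skew_toPt]; simp

theorem arrayOf_eq_arr {n : ℕ} (G : SimpleGraph (points n)) :
    arrayOf G = arr n (G.map (skewEmb n)) := by
  classical
  funext ⟨x, hx⟩
  obtain ⟨i, j, hi, hj, hn, rfl⟩ := mem_cells_iff.1 hx
  have hT1 : toPt n (i, j) ∈ points n := toPt_mem_points.2 ⟨hi, hj, by simp only; omega⟩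
  have hT2 : toPt n (i + 1, j) ∈ points n :=
    toPt_mem_points.2 ⟨by simp only; omega, hj, by simp only; omega⟩
  have hT3 : toPt n (i, j + 1) ∈ points n :=
    toPt_mem_points.2 ⟨hi, by simp only; omega, by simp only; omega⟩
  set P : points n := ⟨_, hT1⟩ with hP
  set Q : points n := ⟨_, hT2⟩ with hQ
  set R : points n := ⟨_, hT3⟩ with hR
  have hadj : ∀ {p q : ℤ × ℤ} (hp : toPt n p ∈ points n) (hq : toPt n q ∈ points n),
      (G.map (skewEmb n)).Adj p q ↔ G.Adj ⟨_, hp⟩ ⟨_, hq⟩ := by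
    intro p q hp hq
    have h1 : skewEmb n ⟨_, hp⟩ = p := skew_toPt n p
    have h2 : skewEmb n ⟨_, hq⟩ = q := skew_toPt n q
    conv_lhs => rw [← h1, ← h2]
    exact SimpleGraph.map_adj_apply
  have hPQ : P ≠ Q := fun h => by
    have := toPt_injective n (congrArg Subtype.val h); simp at this
  have hPR : P ≠ R := fun h => by
    have := toPt_injective n (congrArg Subtype.val h); simp at this
  have hQR : Q ≠ R := fun h => by
    have := toPt_injective n (congrArg Subtype.val h); simp at this
  have hdown : ∀ v : points n, (v : ℤ × ℤ) ∈ downTriangle (toPt n (i, j + 1)) ↔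
      v = P ∨ v = Q ∨ v = R := by
    intro v
    simp only [hP, hQ, hR, Subtype.ext_iff, downTriangle, toPt, Set.mem_insert_iff,
      Set.mem_singleton_iff, Prod.ext_iff]
    omega
  have hset : {e ∈ G.edgeSet | ∀ v ∈ e, (v : ℤ × ℤ) ∈ downTriangle (toPt n (i, j + 1))} =
      ((({s(P, Q), s(P, R), s(Q, R)} : Finset (Sym2 (points n))).filter
        (fun e => e ∈ G.edgeSet) : Finset (Sym2 (points n))) : Set (Sym2 (points n))) := by
    ext e
    induction e using Sym2.ind with
    | h a b =>
    simp only [Set.mem_ofPred_eq, SimpleGraph.mem_edgeSet, Sym2.mem_iff, forall_eq_or_imp,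
      forall_eq, hdown, Finset.coe_filter, Finset.mem_insert, Finset.mem_singleton, Sym2.eq_iff]
    constructor
    · rintro ⟨h, h1, h2⟩
      have := h.ne
      refine ⟨?_, h⟩
      rcases h1 with rfl | rfl | rfl <;> rcases h2 with rfl | rfl | rfl <;> simp at this ⊢
    · rintro ⟨(⟨rfl, rfl⟩ | ⟨rfl, rfl⟩) | (⟨rfl, rfl⟩ | ⟨rfl, rfl⟩) | (⟨rfl, rfl⟩ | ⟨rfl, rfl⟩), h⟩ <;>
        simp [h]
  simp only [arrayOf, arr]
  rw [hset, Set.ncard_coe_finset, Finset.card_filter, corner_toPt, entry, Finset.sum_insert,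
    Finset.sum_insert, Finset.sum_singleton]
  · simp only [SimpleGraph.mem_edgeSet, hadj hT1 hT2, hadj hT1 hT3, hadj hT2 hT3]
    push_cast
    ring
  · simp [hPQ, hPR]
  · simp only [Finset.mem_insert, Finset.mem_singleton, Sym2.eq_iff]
    tauto

theorem isAlternatingSignTriangle_arr {n : ℕ} {c : ℤ × ℤ → ℤ} {G : SimpleGraph (ℤ × ℤ)}
    (h : Forest n c G) (hc : Valid n c) : IsAlternatingSignTriangle (arr n G) := by
  obtain ⟨h1, h2⟩ := isGrove_comap h hc
  exact ⟨_, h1, by rw [arrayOf_eq_arr, h2]⟩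

theorem exists_forest_of_isAlternatingSignTriangle {n : ℕ} {A : TriArray n}
    (h : IsAlternatingSignTriangle A) : ∃ c G, Valid n c ∧ Forest n c G ∧ A = arr n G := by
  obtain ⟨G, hG, rfl⟩ := h
  obtain ⟨c, hc, hf⟩ := exists_forest_of_isGrove hG
  exact ⟨c, _, hc, hf, arrayOf_eq_arr G⟩

/-! ### Moves -/

/-- Reachability through alternating sign triangles by adding sub-triangles. -/
def Reach (n : ℕ) : TriArray n → TriArray n → Prop :=
  Relation.ReflTransGen fun B C : TriArray n =>
    IsAlternatingSignTriangle B ∧ IsAlternatingSignTriangle C ∧ AddsSubTriangle B C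

/-- Every edge lies in exactly one downward triangle. This makes the effect of an exchange on the
array local. -/
theorem ite_eq_of_mem_corners {p x y : ℤ × ℤ} (hx : x ∈ corners (p.1, p.2, true))
    (hy : y ∈ corners (p.1, p.2, true)) (hxy : x ≠ y) (r : ℤ × ℤ) :
    (if r = p then (1 : ℤ) else 0) =
      (if s(r, (r.1 + 1, r.2)) = s(x, y) then 1 else 0) +
      (if s(r, (r.1, r.2 + 1)) = s(x, y) then 1 else 0) +
      (if s((r.1 + 1, r.2), (r.1, r.2 + 1)) = s(x, y) then 1 else 0) := by
  obtain ⟨i, j⟩ := p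
  obtain ⟨k, l⟩ := r
  simp only [corners, Finset.mem_insert, Finset.mem_singleton] at hx hy
  by_cases h : k = i ∧ l = j
  · obtain ⟨rfl, rfl⟩ := h
    rcases hx with rfl | rfl | rfl <;> rcases hy with rfl | rfl | rfl <;> simp at hxy ⊢
  · rw [if_neg (by rwa [Prod.mk.injEq]), if_neg, if_neg, if_neg]
    · rfl
    all_goals
      rw [Sym2.eq_iff]
      rcases hx with rfl | rfl | rfl <;> rcases hy with rfl | rfl | rfl <;>
        simp only [Prod.mk.injEq] <;> omega

theorem entry_swapEdge {G : SimpleGraph (ℤ × ℤ)} {p q x y z w : ℤ × ℤ}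
    (hx : x ∈ corners (p.1, p.2, true)) (hy : y ∈ corners (p.1, p.2, true)) (hxy : G.Adj x y)
    (hz : z ∈ corners (q.1, q.2, true)) (hw : w ∈ corners (q.1, q.2, true)) (hzw : ¬ G.Adj z w)
    (hne : z ≠ w) (r : ℤ × ℤ) :
    entry (swapEdge G s(x, y) s(z, w)) r =
      entry G r + (if r = p then 1 else 0) - (if r = q then 1 else 0) := by
  classical
  have hind : ∀ a b : ℤ × ℤ, a ≠ b →
      (if (swapEdge G s(x, y) s(z, w)).Adj a b then (1 : ℤ) else 0) =
      (if G.Adj a b then 1 else 0) - (if s(a, b) = s(x, y) then 1 else 0) +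
        (if s(a, b) = s(z, w) then 1 else 0) := by
    intro a b hab
    have h1 : s(a, b) = s(x, y) → G.Adj a b := fun h => by
      rw [← SimpleGraph.mem_edgeSet, h]; exact hxy
    have h2 : s(a, b) = s(z, w) → ¬ G.Adj a b := fun h => by
      rw [← SimpleGraph.mem_edgeSet, h]; exact hzw
    simp only [swapEdge_adj]
    generalize s(x, y) = f at *
    generalize s(z, w) = e at *
    by_cases ha : G.Adj a b <;> by_cases hb : s(a, b) = f <;>
      by_cases hc : s(a, b) = e <;> simp [ha, hb, hc, hab] at h1 h2 ⊢ <;> simp_all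
  rw [ite_eq_of_mem_corners hx hy hxy.ne, ite_eq_of_mem_corners hz hw hne, entry, entry,
    hind _ _ (by simp [Prod.ext_iff]),
    hind _ _ (by simp [Prod.ext_iff]), hind _ _ (by simp)]
  ring

/-- An edge in the downward triangle `p` may be replaced by one in the downward triangle `q`. -/
def Allowed (p q : ℤ × ℤ) : Prop :=
  q = p ∨ q = (p.1 - 1, p.2) ∨ q = (p.1 + 1, p.2 - 1) ∨ q = (p.1, p.2 + 1)

/-- The array gains 1 at `p` and loses 1 at `q`. For the three nontrivial displacements in `Allowed`
this is one of the three sub-triangles; for `q = p` nothing changes. -/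
theorem reach_swapEdge {n : ℕ} {c c' : ℤ × ℤ → ℤ} {G : SimpleGraph (ℤ × ℤ)} {p q x y z w : ℤ × ℤ}
    (hG : Forest n c G) (hc : Valid n c) (hc' : Valid n c')
    (hH : Forest n c' (swapEdge G s(x, y) s(z, w)))
    (hp : (p.1, p.2, true) ∈ trs n) (hq : (q.1, q.2, true) ∈ trs n) (hpq : Allowed p q)
    (hx : x ∈ corners (p.1, p.2, true)) (hy : y ∈ corners (p.1, p.2, true)) (hxy : G.Adj x y)
    (hz : z ∈ corners (q.1, q.2, true)) (hw : w ∈ corners (q.1, q.2, true)) (hzw : ¬ G.Adj z w)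
    (hne : z ≠ w) : Reach n (arr n G) (arr n (swapEdge G s(x, y) s(z, w))) := by
  have hent : ∀ i j (h : toPt n (i, j + 1) ∈ cells n),
      arr n (swapEdge G s(x, y) s(z, w)) ⟨_, h⟩ =
      arr n G ⟨_, h⟩ + (if (i, j) = p then 1 else 0) - (if (i, j) = q then 1 else 0) := by
    intro i j h
    simp only [arr, corner_toPt]
    exact entry_swapEdge hx hy hxy hz hw hzw hne _
  have hfun : ∀ (u : ℤ × ℤ) (a b d : ℤ), (∀ i j, toPt n (i, j + 1) ∈ cells n →
      (if toPt n (i, j + 1) = (u.1 - 1, u.2 - 1) then a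
        else if toPt n (i, j + 1) = (u.1 + 1, u.2 - 1) then b
        else if toPt n (i, j + 1) = (u.1, u.2 - 2) then d else 0) =
        (if (i, j) = p then 1 else 0) - (if (i, j) = q then (1 : ℤ) else 0)) →
      arr n (swapEdge G s(x, y) s(z, w)) = arr n G + subTriangle n u a b d := by
    intro u a b d h
    funext ⟨t, ht⟩
    obtain ⟨i, j, _, _, _, rfl⟩ := mem_cells_iff.1 ht
    rw [hent i j ht, Pi.add_apply, subTriangle, h i j ht]
    ring
  obtain ⟨p1, p2⟩ := p
  have hstep : ∀ u : ℤ × ℤ, (u.1 - 1, u.2 - 1) ∈ cells n → (u.1 + 1, u.2 - 1) ∈ cells n →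
      (u.1, u.2 - 2) ∈ cells n →
      (arr n (swapEdge G s(x, y) s(z, w)) = arr n G + subTriangle n u (-1) 1 0 ∨
        arr n (swapEdge G s(x, y) s(z, w)) = arr n G + subTriangle n u 1 0 (-1) ∨
        arr n (swapEdge G s(x, y) s(z, w)) = arr n G + subTriangle n u 0 (-1) 1) →
      Reach n (arr n G) (arr n (swapEdge G s(x, y) s(z, w))) := fun u h1 h2 h3 h4 =>
    Relation.ReflTransGen.single ⟨isAlternatingSignTriangle_arr hG hc,
      isAlternatingSignTriangle_arr hH hc', u, h1, h2, h3, h4⟩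
  have hcell : ∀ (i j : ℤ) (v : ℤ × ℤ), 0 ≤ i → 0 ≤ j → i + j + 1 ≤ (n : ℤ) →
      v = toPt n (i, j + 1) → v ∈ cells n := fun i j v h1 h2 h3 h4 =>
    mem_cells_iff.2 ⟨i, j, h1, h2, h3, h4⟩
  have hp' := mem_trs_down.1 hp
  rcases hpq with rfl | rfl | rfl | rfl
  · have : arr n (swapEdge G s(x, y) s(z, w)) = arr n G := by
      funext ⟨t, ht⟩
      obtain ⟨i, j, _, _, _, rfl⟩ := mem_cells_iff.1 ht
      rw [hent i j ht]; ring
    rw [this]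
    exact Relation.ReflTransGen.refl
  · have hq' := mem_trs_down.1 hq
    simp only at hq' hp'
    -- The sub-triangle sits around the upward triangle between the two cells, and `u` is the top
    -- vertex of that triangle.
    refine hstep (toPt n (p1, p2)) ?_ ?_ ?_ (Or.inl (hfun _ _ _ _ ?_))
    · exact hcell (p1 - 1) p2 _ (by omega) (by omega) (by omega) (by ext <;> simp [toPt] <;> ring)
    · exact hcell p1 p2 _ (by omega) (by omega) (by omega) (by ext <;> simp [toPt] <;> ring)
    · exact hcell (p1 - 1) (p2 + 1) _ (by omega) (by omega) (by omega)
        (by ext <;> simp [toPt] <;> ring)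
    · intro i j _
      simp only [toPt, Prod.mk.injEq]
      split_ifs <;> omega
  · have hq' := mem_trs_down.1 hq
    simp only at hq' hp'
    refine hstep (toPt n (p1 + 1, p2 - 1)) ?_ ?_ ?_ (Or.inr (Or.inr (hfun _ _ _ _ ?_)))
    · exact hcell p1 (p2 - 1) _ (by omega) (by omega) (by omega)
        (by ext <;> simp [toPt] <;> ring)
    · exact hcell (p1 + 1) (p2 - 1) _ (by omega) (by omega) (by omega)
        (by ext <;> simp [toPt] <;> ring)
    · exact hcell p1 p2 _ (by omega) (by omega) (by omega) (by ext <;> simp [toPt] <;> ring)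
    · intro i j _
      simp only [toPt, Prod.mk.injEq]
      split_ifs <;> omega
  · have hq' := mem_trs_down.1 hq
    simp only at hq' hp'
    refine hstep (toPt n (p1 + 1, p2)) ?_ ?_ ?_ (Or.inr (Or.inl (hfun _ _ _ _ ?_)))
    · exact hcell p1 p2 _ (by omega) (by omega) (by omega) (by ext <;> simp [toPt] <;> ring)
    · exact hcell (p1 + 1) p2 _ (by omega) (by omega) (by omega)
        (by ext <;> simp [toPt] <;> ring)
    · exact hcell p1 (p2 + 1) _ (by omega) (by omega) (by omega)
        (by ext <;> simp [toPt] <;> ring)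
    · intro i j _
      simp only [toPt, Prod.mk.injEq]
      split_ifs <;> omega

section

variable {n : ℕ} {c : ℤ × ℤ → ℤ} {G : SimpleGraph (ℤ × ℤ)}

/-! ### Rotations act on arrays -/

/-- The edges of an upward triangle lie in three downward triangles, which are cyclically
ordered. -/
theorem exists_allowed_of_corners_up {i j : ℤ} {u v w : ℤ × ℤ} (ht : (i, j, false) ∈ trs n)
    (hc : corners (i, j, false) = {u, v, w}) (hw : u ≠ v ∧ u ≠ w ∧ v ≠ w) :
    ∃ p q r : ℤ × ℤ, ((p.1, p.2, true) ∈ trs n ∧ u ∈ corners (p.1, p.2, true) ∧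
      v ∈ corners (p.1, p.2, true)) ∧ ((q.1, q.2, true) ∈ trs n ∧ u ∈ corners (q.1, q.2, true) ∧
      w ∈ corners (q.1, q.2, true)) ∧ ((r.1, r.2, true) ∈ trs n ∧ v ∈ corners (r.1, r.2, true) ∧
      w ∈ corners (r.1, r.2, true)) ∧ (Allowed p r ∨ Allowed q r ∧ Allowed p q) := by
  have hu : u ∈ corners (i, j, false) := by simp [hc]
  have hv : v ∈ corners (i, j, false) := by simp [hc]
  have hw' : w ∈ corners (i, j, false) := by simp [hc]
  have ht' := mem_trs_up.1 ht
  -- The permitted cycle is `(i, j)`, `(i, j + 1)`, `(i + 1, j)` and back. From one cell another is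
  -- reached directly or through the third.
  have key : ∀ e f g : ℤ × ℤ, e ∈ ({(i, j), (i + 1, j), (i, j + 1)} : Finset (ℤ × ℤ)) →
      f ∈ ({(i, j), (i + 1, j), (i, j + 1)} : Finset (ℤ × ℤ)) →
      g ∈ ({(i, j), (i + 1, j), (i, j + 1)} : Finset (ℤ × ℤ)) → e ≠ f → e ≠ g → f ≠ g →
      Allowed e g ∨ Allowed f g ∧ Allowed e f := by
    intro e f g he hf hg h1 h2 h3
    simp only [Finset.mem_insert, Finset.mem_singleton] at he hf hg
    rcases he with rfl | rfl | rfl <;> rcases hf with rfl | rfl | rfl <;>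
      rcases hg with rfl | rfl | rfl <;> simp [Allowed] at h1 h2 h3 ⊢
  have hd : ∀ e : ℤ × ℤ, e ∈ ({(i, j), (i + 1, j), (i, j + 1)} : Finset (ℤ × ℤ)) →
      (e.1, e.2, true) ∈ trs n := by
    intro e he
    simp only [Finset.mem_insert, Finset.mem_singleton] at he
    rw [mem_trs_down]
    rcases he with rfl | rfl | rfl <;> simp only <;> omega
  have hown : ∀ x y z : ℤ × ℤ, x ∈ corners (i, j, false) → y ∈ corners (i, j, false) →
      z ∈ corners (i, j, false) → x ≠ y → x ≠ z → y ≠ z →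
      ∃ e ∈ ({(i, j), (i + 1, j), (i, j + 1)} : Finset (ℤ × ℤ)), x ∈ corners (e.1, e.2, true) ∧
        y ∈ corners (e.1, e.2, true) ∧ z ∉ corners (e.1, e.2, true) := by
    intro x y z hx hy hz h1 h2 h3
    simp only [corners, Finset.mem_insert, Finset.mem_singleton] at hx hy hz
    rcases hx with rfl | rfl | rfl <;> rcases hy with rfl | rfl | rfl <;>
      rcases hz with rfl | rfl | rfl <;> simp [corners] at h1 h2 h3 ⊢
  obtain ⟨h1, h2, h3⟩ := hw
  obtain ⟨p, hp, hp1, hp2, hp3⟩ := hown u v w hu hv hw' h1 h2 h3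
  obtain ⟨q, hq, hq1, hq2, hq3⟩ := hown u w v hu hw' hv h2 h1 h3.symm
  obtain ⟨r, hr, hr1, hr2, hr3⟩ := hown v w u hv hw' hu h3 h1.symm h2.symm
  exact ⟨p, q, r, ⟨hd p hp, hp1, hp2⟩, ⟨hd q hq, hq1, hq2⟩, ⟨hd r hr, hr1, hr2⟩,
    key p q r hp hq hr (by rintro rfl; exact hp3 hq2) (by rintro rfl; exact hp3 hr2)
      (by rintro rfl; exact hq3 hr1)⟩

theorem ne_of_corners_eq {t : ℤ × ℤ × Bool} {u v w : ℤ × ℤ} (hc : corners t = {u, v, w}) :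
    u ≠ v ∧ u ≠ w ∧ v ≠ w := by
  have h := card_corners t
  rw [hc] at h
  refine ⟨?_, ?_, ?_⟩ <;> rintro rfl
  · rw [Finset.insert_eq_of_mem (by simp)] at h
    have := Finset.card_le_two (a := u) (b := w); omega
  · rw [Finset.insert_eq_of_mem (by simp)] at h
    have := Finset.card_le_two (a := v) (b := u); omega
  · rw [Finset.pair_eq_singleton] at h
    have := Finset.card_le_two (a := u) (b := v); omega

theorem swapEdge_swapEdge_of_mem {e f g : Sym2 (ℤ × ℤ)} (hf : f ∈ G.edgeSet) (hfg : f ≠ g)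
    (hef : e ≠ f) (heg : e ≠ g) : swapEdge (swapEdge G f g) e f = swapEdge G e g := by
  ext x y
  simp only [swapEdge_adj]
  have h1 : s(x, y) = f → G.Adj x y := by rintro rfl; exact hf
  have h2 : G.Adj x y → x ≠ y := fun h => h.ne
  generalize s(x, y) = d at *
  by_cases hd : d = f
  · subst hd; simp [h1, h2, hfg, hef.symm]
  · by_cases hd' : d = g
    · subst hd'; simp [hd, heg.symm]
    · simp [hd, hd']

/-- A downward triangle keeps its number of edges, so rotating in it does not change the array. In
an upward triangle the rotation is one permitted exchange or a product of two. -/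
theorem Rotates.reach {H : SimpleGraph (ℤ × ℤ)} (hr : Rotates n G H) (h : Forest n c G)
    (hc : Valid n c) : Reach n (arr n G) (arr n H) := by
  have hH := hr.forest h
  obtain ⟨⟨i, j, b⟩, ht, u, v, w, hco, huv, huw, hvw, rfl⟩ := hr
  have hne := ne_of_corners_eq hco
  have hu : u ∈ corners (i, j, b) := by simp [hco]
  have hv : v ∈ corners (i, j, b) := by simp [hco]
  have hw : w ∈ corners (i, j, b) := by simp [hco]
  cases b with
  | true =>
    exact reach_swapEdge (p := (i, j)) (q := (i, j)) h hc hc hH ht ht (Or.inl rfl) hu hv huv hv hw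
      hvw hne.2.2
  | false =>
    obtain ⟨p, q, r, ⟨hp, hp1, hp2⟩, ⟨hq, hq1, hq2⟩, ⟨hr, hr1, hr2⟩, hall⟩ :=
      exists_allowed_of_corners_up ht hco hne
    rcases hall with hall | ⟨hqr, hpq⟩
    · exact reach_swapEdge h hc hc hH hp hr hall hp1 hp2 huv hr1 hr2 hvw hne.2.2
    · have hle : (lat n).Adj w v := lat_adj_of_mem_corners ht hw hv hne.2.2.symm
      have h1 := h.rotate huw huv hle
      rw [Sym2.eq_swap (a := w)] at h1
      have e1 : s(u, v) ≠ s(u, w) := by simp [hne]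
      have e2 : s(u, v) ≠ s(v, w) := by simp [hne]
      have e3 : s(u, w) ≠ s(v, w) := by simp [hne]
      -- In the wrong direction `u w` first moves to `v w`, and then `u v` takes the vacated place
      -- `u w`.
      have key : swapEdge (swapEdge G s(u, w) s(v, w)) s(u, v) s(u, w) =
          swapEdge G s(u, v) s(v, w) := swapEdge_swapEdge_of_mem huw e3 e1 e2
      have r1 := reach_swapEdge h hc hc h1 hq hr hqr hq1 hq2 huw hr1 hr2 hvw hne.2.2
      have r2 := reach_swapEdge (x := u) (y := v) (z := u) (w := w) h1 hc hc (key ▸ hH) hp hq hpq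
        hp1 hp2 (swapEdge_adj.2 (Or.inl ⟨huv, e1⟩)) hq1 hq2
        (by rw [swapEdge_adj]; simp [e3]) hne.2.1
      rw [key] at r2
      exact r1.trans r2

theorem Forest.reach_arr {H : SimpleGraph (ℤ × ℤ)} (h : Forest n c G) (hH : Forest n c H)
    (hc : Valid n c) : Reach n (arr n G) (arr n H) := by
  have := h.reflTransGen_rotates hc.onBdry hH
  induction this with
  | refl => exact Relation.ReflTransGen.refl
  | tail h1 h2 ih =>
    have hf := forest_of_reflTransGen h1 h
    exact (ih hf).trans (h2.reach hf hc)

/-! ### Moving a leaf -/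

/-- `G` is a spanning forest in which the vertex `y` is isolated, and whose other components are
level sets of `c`. -/
structure Bare (n : ℕ) (c : ℤ × ℤ → ℤ) (y : ℤ × ℤ) (G : SimpleGraph (ℤ × ℤ)) : Prop where
  le : G ≤ lat n
  acyclic : G.IsAcyclic
  isolated : ∀ x, ¬ G.Adj y x
  reach : ∀ u v, InTri n u → InTri n v → u ≠ y → v ≠ y → (G.Reachable u v ↔ c u = c v)

theorem sup_edge_adj {y q a b : ℤ × ℤ} :
    (G ⊔ SimpleGraph.edge y q).Adj a b ↔ G.Adj a b ∨ (s(a, b) = s(y, q) ∧ a ≠ b) := by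
  rw [SimpleGraph.sup_adj, SimpleGraph.edge_adj, Sym2.eq_iff]

/-- The leaf `y` can be contracted to its only neighbour `q`. -/
theorem reachable_sup_edge_iff {y q : ℤ × ℤ} (hy : ∀ x, ¬ G.Adj y x) (hq : q ≠ y) (u v : ℤ × ℤ) :
    (G ⊔ SimpleGraph.edge y q).Reachable u v ↔
      G.Reachable (if u = y then q else u) (if v = y then q else v) := by
  have hproj : ∀ w, (G ⊔ SimpleGraph.edge y q).Reachable w (if w = y then q else w) := by
    intro w
    split_ifs with h
    · subst h
      exact (sup_edge_adj.2 (Or.inr ⟨rfl, hq.symm⟩)).reachable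
    · exact SimpleGraph.Reachable.refl _
  constructor
  · intro h
    rw [SimpleGraph.reachable_iff_reflTransGen] at h
    induction h with
    | refl => exact SimpleGraph.Reachable.refl _
    | @tail a b _ hab ih =>
      refine ih.trans ?_
      rcases sup_edge_adj.1 hab with hab' | ⟨he, _⟩
      · have ha : a ≠ y := by rintro rfl; exact hy _ hab'
        have hb : b ≠ y := by rintro rfl; exact hy _ hab'.symm
        rw [if_neg ha, if_neg hb]
        exact hab'.reachable
      · rcases Sym2.eq_iff.1 he with ⟨rfl, rfl⟩ | ⟨rfl, rfl⟩ <;> simp [hq]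
  · exact fun h => ((hproj u).trans (h.mono le_sup_left)).trans (hproj v).symm

theorem Bare.forest {y : ℤ × ℤ} (h : Bare n c y G) {q : ℤ × ℤ} (hq : (lat n).Adj y q) :
    Forest n (Function.update c y (c q)) (G ⊔ SimpleGraph.edge y q) := by
  have hqy : q ≠ y := hq.ne.symm
  refine ⟨sup_le h.le ?_, h.acyclic.sup_edge_of_not_reachable ?_, fun u v hu hv => ?_⟩
  · intro a b hab
    rw [SimpleGraph.edge_adj] at hab
    rcases hab.1 with ⟨rfl, rfl⟩ | ⟨rfl, rfl⟩
    · exact hq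
    · exact hq.symm
  · intro hr
    rw [SimpleGraph.reachable_iff_reflTransGen] at hr
    rcases Relation.ReflTransGen.cases_head hr with rfl | ⟨x, hx, _⟩
    · exact hqy rfl
    · exact h.isolated _ hx
  · have hval : ∀ w, Function.update c y (c q) w = c (if w = y then q else w) := by
      intro w
      by_cases hw : w = y <;> simp [hw]
    have hne : ∀ w, (if w = y then q else w) ≠ y := by
      intro w
      split_ifs with hw
      · exact hqy
      · exact hw
    have hT : ∀ w, InTri n w → InTri n (if w = y then q else w) := by
      intro w hw
      split_ifs
      · exact hq.2.1
      · exact hw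
    rw [reachable_sup_edge_iff h.isolated hqy, h.reach _ _ (hT u hu) (hT v hv) (hne u) (hne v),
      hval, hval]

theorem Valid.update (hc : Valid n c) {y q : ℤ × ℤ} (hy : ¬ IsBdry n y) (hq : (lat n).Adj y q) :
    Valid n (Function.update c y (c q)) := by
  have hne : ∀ p, IsBdry n p → p ≠ y := by rintro p hp rfl; exact hy hp
  refine ⟨fun p hp => ?_, fun x hx => ?_⟩
  · rw [Function.update_of_ne (hne p hp), hc.bdry p hp]
  · by_cases hxy : x = y
    · subst hxy
      obtain ⟨p, hp, hpq⟩ := hc.onBdry q hq.2.1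
      exact ⟨p, hp, by rw [Function.update_of_ne (hne p hp), Function.update_self, hpq]⟩
    · obtain ⟨p, hp, hpq⟩ := hc.onBdry x hx
      exact ⟨p, hp, by rw [Function.update_of_ne (hne p hp), Function.update_of_ne hxy, hpq]⟩

theorem Bare.reach_sup_edge {y : ℤ × ℤ} (h : Bare n c y G) (hc : Valid n c) (hy : ¬ IsBdry n y)
    {q q' : ℤ × ℤ} (hq : (lat n).Adj y q) (hq' : (lat n).Adj y q') {p p' : ℤ × ℤ}
    (hp : (p.1, p.2, true) ∈ trs n) (hp' : (p'.1, p'.2, true) ∈ trs n) (hpp : Allowed p p')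
    (h1 : y ∈ corners (p.1, p.2, true)) (h2 : q ∈ corners (p.1, p.2, true))
    (h3 : y ∈ corners (p'.1, p'.2, true)) (h4 : q' ∈ corners (p'.1, p'.2, true)) :
    Reach n (arr n (G ⊔ SimpleGraph.edge y q)) (arr n (G ⊔ SimpleGraph.edge y q')) := by
  by_cases hqq : q = q'
  · subst hqq; exact Relation.ReflTransGen.refl
  have hiso : ∀ a b, G.Adj a b → ∀ x, s(a, b) ≠ s(y, x) := by
    intro a b hab x he
    rw [← SimpleGraph.mem_edgeSet, he] at hab
    exact h.isolated _ hab
  have key : G ⊔ SimpleGraph.edge y q' = swapEdge (G ⊔ SimpleGraph.edge y q) s(y, q) s(y, q') := by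
    ext a b
    rw [swapEdge_adj, sup_edge_adj, sup_edge_adj]
    have hab : G.Adj a b → s(a, b) ≠ s(y, q) := fun h => hiso a b h q
    tauto
  have hf' := h.forest hq'
  rw [key] at hf' ⊢
  refine reach_swapEdge (h.forest hq) (hc.update hy hq) (hc.update hy hq') hf' hp hp' hpp h1 h2
    (sup_edge_adj.2 (Or.inr ⟨rfl, hq.ne⟩)) h3 h4 ?_ hq'.ne
  rw [sup_edge_adj]
  rintro (h5 | ⟨h5, _⟩)
  · exact h.isolated _ h5
  · rw [Sym2.eq_iff] at h5
    rcases h5 with ⟨_, h5⟩ | ⟨_, h5⟩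
    · exact hqq h5.symm
    · exact hq'.ne h5.symm

/-- A leaf may be moved to any neighbouring vertex. -/
theorem Bare.reach_leaf {y : ℤ × ℤ} (h : Bare n c y G) (hc : Valid n c) (hy : ¬ IsBdry n y)
    {q q' : ℤ × ℤ} (hq : (lat n).Adj y q) (hq' : (lat n).Adj y q') :
    Reach n (arr n (G ⊔ SimpleGraph.edge y q)) (arr n (G ⊔ SimpleGraph.edge y q')) := by
  obtain ⟨i, j⟩ := y
  have hyT := hq.1
  simp only [IsBdry, not_and] at hy
  have hint := hy hyT
  simp only [InTri] at hyT
  have hlat : ∀ r, r = (i + 1, j) ∨ r = (i, j + 1) ∨ r = (i - 1, j + 1) ∨ r = (i - 1, j) ∨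
      r = (i, j - 1) ∨ r = (i + 1, j - 1) → (lat n).Adj (i, j) r := by
    rintro r hr
    refine ⟨hyT, ?_, ?_⟩
    · simp only [InTri]
      rcases hr with rfl | rfl | rfl | rfl | rfl | rfl <;> simp only <;> omega
    · simp only [Nb]
      rcases hr with rfl | rfl | rfl | rfl | rfl | rfl <;> simp
  have hnb : ∀ r, (lat n).Adj (i, j) r → r = (i + 1, j) ∨ r = (i, j + 1) ∨ r = (i - 1, j + 1) ∨
      r = (i - 1, j) ∨ r = (i, j - 1) ∨ r = (i + 1, j - 1) := by
    rintro ⟨k, l⟩ hr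
    have := hr.2.2
    simp only [Nb, Prod.mk.injEq] at this ⊢
    omega
  have ht1 : (i, j, true) ∈ trs n := mem_trs_down.2 (by omega)
  have ht2 : (i - 1, j, true) ∈ trs n := mem_trs_down.2 (by omega)
  have ht3 : (i, j - 1, true) ∈ trs n := mem_trs_down.2 (by omega)
  have hy' : ¬ IsBdry n (i, j) := by rw [IsBdry, not_and]; exact hy
  -- The six neighbours in cyclic order. The steps alternate between staying in a downward triangle
  -- at `y` and passing to the next one in the permitted direction, so the leaf can turn all the way
  -- round.
  have s1 := h.reach_sup_edge hc hy' (hlat (i + 1, j) (by simp)) (hlat (i, j + 1) (by simp))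
    (p := (i, j)) (p' := (i, j)) ht1 ht1 (by simp [Allowed]) (by simp [corners])
    (by simp [corners]) (by simp [corners]) (by simp [corners])
  have s2 := h.reach_sup_edge hc hy' (hlat (i, j + 1) (by simp)) (hlat (i - 1, j + 1) (by simp))
    (p := (i, j)) (p' := (i - 1, j)) ht1 ht2 (by simp [Allowed]) (by simp [corners])
    (by simp [corners]) (by simp [corners]) (by simp [corners])
  have s3 := h.reach_sup_edge hc hy' (hlat (i - 1, j + 1) (by simp)) (hlat (i - 1, j) (by simp))
    (p := (i - 1, j)) (p' := (i - 1, j)) ht2 ht2 (by simp [Allowed]) (by simp [corners])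
    (by simp [corners]) (by simp [corners]) (by simp [corners])
  have s4 := h.reach_sup_edge hc hy' (hlat (i - 1, j) (by simp)) (hlat (i, j - 1) (by simp))
    (p := (i - 1, j)) (p' := (i, j - 1)) ht2 ht3 (by simp [Allowed]) (by simp [corners])
    (by simp [corners]) (by simp [corners]) (by simp [corners])
  have s5 := h.reach_sup_edge hc hy' (hlat (i, j - 1) (by simp)) (hlat (i + 1, j - 1) (by simp))
    (p := (i, j - 1)) (p' := (i, j - 1)) ht3 ht3 (by simp [Allowed]) (by simp [corners])
    (by simp [corners]) (by simp [corners]) (by simp [corners])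
  have s6 := h.reach_sup_edge hc hy' (hlat (i + 1, j - 1) (by simp)) (hlat (i + 1, j) (by simp))
    (p := (i, j - 1)) (p' := (i, j)) ht3 ht1 (by simp [Allowed]) (by simp [corners])
    (by simp [corners]) (by simp [corners]) (by simp [corners])
  have hto : Reach n (arr n (G ⊔ SimpleGraph.edge (i, j) q))
      (arr n (G ⊔ SimpleGraph.edge (i, j) (i + 1, j))) := by
    rcases hnb q hq with rfl | rfl | rfl | rfl | rfl | rfl
    · exact Relation.ReflTransGen.refl
    · exact s2.trans (s3.trans (s4.trans (s5.trans s6)))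
    · exact s3.trans (s4.trans (s5.trans s6))
    · exact s4.trans (s5.trans s6)
    · exact s5.trans s6
    · exact s6
  refine hto.trans ?_
  rcases hnb q' hq' with rfl | rfl | rfl | rfl | rfl | rfl
  · exact Relation.ReflTransGen.refl
  · exact s1
  · exact s1.trans s2
  · exact s1.trans (s2.trans s3)
  · exact s1.trans (s2.trans (s3.trans s4))
  · exact s1.trans (s2.trans (s3.trans (s4.trans s5)))

/-! ### Changing the label of a vertex -/

/-- The lattice graph on the points of `S`. -/
def latOn (n : ℕ) (S : Set (ℤ × ℤ)) : SimpleGraph (ℤ × ℤ) where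
  Adj u v := (lat n).Adj u v ∧ u ∈ S ∧ v ∈ S
  symm := ⟨fun _ _ h => ⟨h.1.symm, h.2.2, h.2.1⟩⟩
  loopless := ⟨fun _ h => h.1.ne rfl⟩

/-- Any two points of `S` are connected inside `S`. -/
def ConnOn (n : ℕ) (S : Set (ℤ × ℤ)) : Prop := ∀ u ∈ S, ∀ v ∈ S, (latOn n S).Reachable u v

/-- The points with label `κ`. -/
def level (n : ℕ) (c : ℤ × ℤ → ℤ) (κ : ℤ) : Set (ℤ × ℤ) := {p | InTri n p ∧ c p = κ}

theorem Forest.connOn (h : Forest n c G) (κ : ℤ) : ConnOn n (level n c κ) := by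
  rintro u ⟨hu, huκ⟩ v ⟨hv, hvκ⟩
  have hr := (h.reach u v hu hv).2 (huκ.trans hvκ.symm)
  rw [SimpleGraph.reachable_iff_reflTransGen] at hr
  clear hvκ hv
  induction hr with
  | refl => exact SimpleGraph.Reachable.refl _
  | @tail a b hua hab ih =>
    refine ih.trans (SimpleGraph.Adj.reachable ⟨h.le hab, ?_, ?_⟩)
    · refine ⟨h.inTri_left hab, ?_⟩
      rw [← huκ]
      exact ((h.reach u a hu (h.inTri_left hab)).1
        ((SimpleGraph.reachable_iff_reflTransGen _ _).2 hua)).symm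
    · refine ⟨h.inTri_right hab, ?_⟩
      rw [← huκ]
      exact ((h.reach u b hu (h.inTri_right hab)).1
        (((SimpleGraph.reachable_iff_reflTransGen _ _).2 hua).trans hab.reachable)).symm

/-- Take a spanning forest of the graph of all edges with equal labels at both ends that avoid `y`.
Only the level of `y` is affected, and it stays connected by assumption. -/
theorem Forest.exists_bare (h : Forest n c G) {y : ℤ × ℤ}
    (hcon : ConnOn n (level n c (c y) \ {y})) : ∃ H, Bare n c y H := by
  let B : SimpleGraph (ℤ × ℤ) :=
    { Adj := fun u v => (lat n).Adj u v ∧ c u = c v ∧ u ≠ y ∧ v ≠ y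
      symm := ⟨fun _ _ h => ⟨h.1.symm, h.2.1.symm, h.2.2.2, h.2.2.1⟩⟩
      loopless := ⟨fun _ h => h.1.ne rfl⟩ }
  obtain ⟨H, hle, hac, hre⟩ := B.exists_isAcyclic_reachable_eq_le
  refine ⟨H, fun a b hab => (hle hab).1, hac, fun x hx => (hle hx).2.2.1 rfl,
    fun u v hu hv huy hvy => ?_⟩
  have : H.Reachable u v ↔ B.Reachable u v := by rw [hre]
  rw [this]
  constructor
  · intro hr
    rw [SimpleGraph.reachable_iff_reflTransGen] at hr
    clear hv hvy this
    induction hr with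
    | refl => rfl
    | tail _ hab ih => exact ih.trans hab.2.1
  · intro he
    by_cases hcy : c u = c y
    · refine (hcon u ⟨⟨hu, hcy⟩, huy⟩ v ⟨⟨hv, he ▸ hcy⟩, hvy⟩).mono fun a b hab => ?_
      exact ⟨hab.1, hab.2.1.1.2.trans hab.2.2.1.2.symm, hab.2.1.2, hab.2.2.2⟩
    · refine (h.connOn (c u) u ⟨hu, rfl⟩ v ⟨hv, he.symm⟩).mono fun a b hab => ?_
      refine ⟨hab.1, hab.2.1.2.trans hab.2.2.2.symm, ?_, ?_⟩
      · rintro rfl; exact hcy hab.2.1.2.symm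
      · rintro rfl; exact hcy hab.2.2.2.symm

/-- A vertex may get the label of a neighbour if the rest of its component stays connected. -/
theorem Forest.exists_update (h : Forest n c G) (hc : Valid n c) {x y : ℤ × ℤ}
    (hy : ¬ IsBdry n y) (hx : (lat n).Adj y x) (hcon : ConnOn n (level n c (c y) \ {y})) :
    ∃ H, Forest n (Function.update c y (c x)) H ∧ Reach n (arr n G) (arr n H) := by
  obtain ⟨B, hB⟩ := h.exists_bare hcon
  -- The point `y` is interior but its component meets the boundary, so `y` has a neighbour with its
  -- own label. As a leaf at `q` it starts with the old label.
  obtain ⟨q, hq, hqy⟩ : ∃ q, (lat n).Adj y q ∧ c q = c y := by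
    obtain ⟨p, hp, hpy⟩ := hc.onBdry y hx.1
    have hr := (h.reach y p hx.1 hp.1).2 hpy.symm
    rw [SimpleGraph.reachable_iff_reflTransGen] at hr
    rcases Relation.ReflTransGen.cases_head hr with rfl | ⟨q, hq, _⟩
    · exact absurd hp hy
    · exact ⟨q, h.le hq, ((h.reach y q hx.1 (h.inTri_right hq)).1 hq.reachable).symm⟩
  have h1 := hB.forest hq
  rw [hqy, Function.update_eq_self] at h1
  exact ⟨_, hB.forest hx, (h.reach_arr h1 hc).trans (hB.reach_leaf hc hy hq hx)⟩

end

section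

variable {n : ℕ} {c : ℤ × ℤ → ℤ}

/-! ### Connected sets of lattice points -/

/-- Removing `S` from a connected set keeps it connected if the neighbours of `S` stay connected. -/
theorem ConnOn.sdiff {K S : Set (ℤ × ℤ)} (hK : ConnOn n K)
    (h : ∀ u ∈ K \ S, ∀ v ∈ K \ S, (∃ s ∈ S, (lat n).Adj u s) → (∃ s ∈ S, (lat n).Adj v s) →
      (latOn n (K \ S)).Reachable u v) : ConnOn n (K \ S) := by
  intro u hu v hv
  have hr := hK u hu.1 v hv.1
  rw [SimpleGraph.reachable_iff_reflTransGen] at hr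
  -- While the path is inside `S`, `w` remembers a point outside, adjacent to `S` and already
  -- connected to `u`.
  suffices H : ∀ a, Relation.ReflTransGen (latOn n K).Adj u a →
      (a ∉ S → (latOn n (K \ S)).Reachable u a) ∧
      (a ∈ S → ∃ w ∈ K \ S, (∃ s ∈ S, (lat n).Adj w s) ∧ (latOn n (K \ S)).Reachable u w) from
    (H v hr).1 hv.2
  intro a ha
  induction ha with
  | refl => exact ⟨fun _ => SimpleGraph.Reachable.refl _, fun h => absurd h hu.2⟩
  | @tail a b _ hab ih =>
    by_cases haS : a ∈ S
    · obtain ⟨w, hw, hws, hur⟩ := ih.2 haS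
      exact ⟨fun hb => hur.trans (h w hw b ⟨hab.2.2, hb⟩ hws ⟨a, haS, hab.1.symm⟩),
        fun _ => ⟨w, hw, hws, hur⟩⟩
    · refine ⟨fun hb => (ih.1 haS).trans (SimpleGraph.Adj.reachable ?_), fun hb => ?_⟩
      · exact ⟨hab.1, ⟨hab.2.1, haS⟩, hab.2.2, hb⟩
      · exact ⟨a, ⟨hab.2.1, haS⟩, ⟨b, hb, hab.1⟩, ih.1 haS⟩

theorem ConnOn.exists_adj {K S : Set (ℤ × ℤ)} (hK : ConnOn n K) {u v : ℤ × ℤ} (hu : u ∈ K)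
    (huS : u ∈ S) (hv : v ∈ K) (hvS : v ∉ S) : ∃ a ∈ K ∩ S, ∃ b ∈ K \ S, (lat n).Adj a b := by
  have hr := hK u hu v hv
  rw [SimpleGraph.reachable_iff_reflTransGen] at hr
  by_contra hcon
  push Not at hcon
  suffices H : ∀ a, Relation.ReflTransGen (latOn n K).Adj u a → a ∈ S from hvS (H v hr)
  intro a ha
  induction ha with
  | refl => exact huS
  | @tail a b _ hab ih =>
    by_contra hb
    exact hcon a ⟨hab.2.1, ih⟩ b ⟨hab.2.2, hb⟩ hab.1

theorem lat_adj_right {i j : ℤ} (h1 : InTri n (i, j)) (h2 : InTri n (i + 1, j)) :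
    (lat n).Adj (i, j) (i + 1, j) := ⟨h1, h2, by simp [Nb]⟩

theorem lat_adj_down {i j : ℤ} (h1 : InTri n (i, j)) (h2 : InTri n (i, j + 1)) :
    (lat n).Adj (i, j) (i, j + 1) := ⟨h1, h2, by simp [Nb]⟩

/-- A horizontal segment is connected. -/
theorem reachable_row {S : Set (ℤ × ℤ)} {j p q : ℤ} (hpq : p ≤ q)
    (h : ∀ i, p ≤ i → i ≤ q → InTri n (i, j) ∧ (i, j) ∈ S) :
    (latOn n S).Reachable (p, j) (q, j) := by
  induction q, hpq using Int.leInduction with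
  | base => exact SimpleGraph.Reachable.refl _
  | succ q hq ih =>
    refine (ih fun i h1 h2 => h i h1 (by omega)).trans (SimpleGraph.Adj.reachable ?_)
    have h1 := h q hq (by omega)
    have h2 := h (q + 1) (by omega) le_rfl
    exact ⟨lat_adj_right h1.1 h2.1, h1.2, h2.2⟩

/-- A segment along a column is connected. -/
theorem reachable_column {S : Set (ℤ × ℤ)} {i p q : ℤ} (hpq : p ≤ q)
    (h : ∀ j, p ≤ j → j ≤ q → InTri n (i, j) ∧ (i, j) ∈ S) :
    (latOn n S).Reachable (i, p) (i, q) := by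
  induction q, hpq using Int.leInduction with
  | base => exact SimpleGraph.Reachable.refl _
  | succ q hq ih =>
    refine (ih fun i h1 h2 => h i h1 (by omega)).trans (SimpleGraph.Adj.reachable ?_)
    have h1 := h q hq (by omega)
    have h2 := h (q + 1) (by omega) le_rfl
    exact ⟨lat_adj_down h1.1 h2.1, h1.2, h2.2⟩

/-! ### The number of equal horizontal pairs -/

/-- The left points of the horizontal pairs of neighbours. -/
noncomputable def pairs (n : ℕ) : Finset (ℤ × ℤ) :=
  (Finset.Icc (0 : ℤ) n ×ˢ Finset.Icc (0 : ℤ) n).filter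
    fun p => InTri n p ∧ InTri n (p.1 + 1, p.2)

theorem mem_pairs {p : ℤ × ℤ} : p ∈ pairs n ↔ InTri n p ∧ InTri n (p.1 + 1, p.2) := by
  rw [pairs, Finset.mem_filter, Finset.mem_product, Finset.mem_Icc, Finset.mem_Icc]
  simp only [InTri]
  omega

/-- The number of horizontal pairs of neighbours with equal labels. -/
noncomputable def equalPairs (n : ℕ) (c : ℤ × ℤ → ℤ) : ℕ :=
  ∑ p ∈ pairs n, if c p = c (p.1 + 1, p.2) then 1 else 0

theorem equalPairs_le (c : ℤ × ℤ → ℤ) : equalPairs n c ≤ (pairs n).card := by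
  rw [equalPairs, ← Finset.card_filter]
  exact Finset.card_filter_le _ _

/-- Only the pairs with left points `(i - 1, j)` and `(i, j)` involve the changed point. Both sides
are kept as sums to avoid subtraction in `ℕ`. -/
theorem equalPairs_update {i j : ℤ} (hi : 0 < i) (hj : 0 < j) (hij : i + j < n) (v : ℤ) :
    equalPairs n (Function.update c (i, j) v) + (if c (i - 1, j) = c (i, j) then 1 else 0) +
      (if c (i, j) = c (i + 1, j) then 1 else 0) =
    equalPairs n c + (if c (i - 1, j) = v then 1 else 0) + (if v = c (i + 1, j) then 1 else 0) := by
  have h1 : (i, j) ∈ pairs n := mem_pairs.2 (by simp only [InTri]; omega)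
  have h2 : (i - 1, j) ∈ (pairs n).erase (i, j) :=
    Finset.mem_erase.2 ⟨by simp, mem_pairs.2 (by simp only [InTri]; omega)⟩
  have hsum : ∀ d : ℤ × ℤ → ℤ, equalPairs n d = (if d (i, j) = d (i + 1, j) then 1 else 0) +
      ((if d (i - 1, j) = d (i, j) then 1 else 0) +
      ∑ p ∈ ((pairs n).erase (i, j)).erase (i - 1, j),
        if d p = d (p.1 + 1, p.2) then 1 else 0) := by
    intro d
    rw [equalPairs, ← Finset.add_sum_erase _ _ h1, ← Finset.add_sum_erase _ _ h2]
    simp only [sub_add_cancel]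
  have hrest : ∑ p ∈ ((pairs n).erase (i, j)).erase (i - 1, j),
      (if Function.update c (i, j) v p = Function.update c (i, j) v (p.1 + 1, p.2)
        then 1 else 0) =
      ∑ p ∈ ((pairs n).erase (i, j)).erase (i - 1, j), if c p = c (p.1 + 1, p.2) then 1 else 0 := by
    refine Finset.sum_congr rfl fun p hp => ?_
    obtain ⟨k, l⟩ := p
    simp only [Finset.mem_erase, ne_eq, Prod.mk.injEq] at hp
    rw [Function.update_of_ne (by rw [ne_eq, Prod.mk.injEq]; tauto),
      Function.update_of_ne (by rw [ne_eq, Prod.mk.injEq]; simp only; omega)]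
  rw [hsum, hsum c, hrest, Function.update_self, Function.update_of_ne (by simp),
    Function.update_of_ne (by simp)]
  ring

/-! ### Dismantling a horizontal run -/

/-- The points from `l` to `r` in row `j`. -/
def run (l r j : ℤ) : Set (ℤ × ℤ) := {p | p.2 = j ∧ l ≤ p.1 ∧ p.1 ≤ r}

/-- A set of valid labelings with connected components that is closed under changing the label
of a vertex to the one of a neighbour when the component stays connected. -/
structure Closed (n : ℕ) (P : (ℤ × ℤ → ℤ) → Prop) : Prop where
  valid : ∀ c, P c → Valid n c
  conn : ∀ c, P c → ∀ κ, ConnOn n (level n c κ)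
  update : ∀ c, P c → ∀ x y, ¬ IsBdry n y → (lat n).Adj y x →
    ConnOn n (level n c (c y) \ {y}) → P (Function.update c y (c x))

theorem level_update_of_ne {y : ℤ × ℤ} {v κ : ℤ} (hv : v ≠ κ) :
    level n (Function.update c y v) κ = level n c κ \ {y} := by
  ext p
  by_cases hp : p = y
  · subst hp; simp [level, hv]
  · simp [level, hp]

/-- In the interior, a horizontal run of one label can be removed if the rest of its component is
connected; this increases the number of equal horizontal pairs. -/
theorem Closed.exists_equalPairs_lt {P : (ℤ × ℤ → ℤ) → Prop} (hP : Closed n P) {j κ : ℤ}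
    (hj : 0 < j) (m : ℕ) : ∀ (c : ℤ × ℤ → ℤ) (l : ℤ), P c → 0 < l → l + m + j < n →
      (∀ i, l ≤ i → i ≤ l + m → c (i, j) = κ) → c (l - 1, j) ≠ κ → c (l + m + 1, j) ≠ κ →
      ConnOn n (level n c κ \ run l (l + m) j) →
      ∃ c', P c' ∧ equalPairs n c < equalPairs n c' := by
  induction m with
  | zero =>
    intro c l hc hl hlj hκ h1 h2 hcon
    have hly := hκ l le_rfl (by simp)
    have hrun : run l (l + (0 : ℕ)) j = {(l, j)} := by
      ext ⟨a, b⟩; simp [run]; omega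
    rw [hrun, ← hly] at hcon
    have hadj : (lat n).Adj (l, j) (l - 1, j) := by
      refine ⟨?_, ?_, by simp [Nb]⟩ <;> simp only [InTri] <;> omega
    refine ⟨_, hP.update c hc (l - 1, j) (l, j) (by simp only [IsBdry, InTri]; omega) hadj hcon, ?_⟩
    -- A single point matches neither horizontal neighbour before and the left one afterwards.
    have := equalPairs_update (c := c) hl hj (n := n) (by omega) (c (l - 1, j))
    simp only [Nat.cast_zero, add_zero] at h2
    rw [hly, if_neg h1, if_neg (Ne.symm h2), if_pos rfl] at this
    omega
  | succ m ih =>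
    intro c l hc hl hlj hκ h1 h2 hcon
    push_cast at *
    have hT : ∀ i, l - 1 ≤ i → i ≤ l + (m + 1) + 1 → InTri n (i, j) := by
      intro i hi hi'; simp only [InTri]; omega
    have hnb : ∀ i, l ≤ i → i ≤ l + (m + 1) → ¬ IsBdry n (i, j) := by
      intro i hi hi'; simp only [IsBdry, InTri]; omega
    -- The component reaches the boundary, so it is larger than the run. Some point `a` of the run
    -- touches the remainder and must be removed last.
    obtain ⟨p, hp, hpl⟩ := (hP.valid c hc).onBdry (l, j) (hT l (by omega) (by omega))
    have hpr : p ∉ run l (l + (m + 1)) j := by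
      rintro ⟨h3, h4, h5⟩
      obtain ⟨a, b⟩ := p
      simp only at h3 h4 h5
      subst h3
      exact hnb a h4 h5 hp
    obtain ⟨⟨a, b⟩, ⟨haK, har⟩, w, hw, haw⟩ := (hP.conn c hc κ).exists_adj
      (S := run l (l + (m + 1)) j) (u := (l, j)) (v := p)
      ⟨hT l (by omega) (by omega), hκ l le_rfl (by omega)⟩ ⟨rfl, le_rfl, by simp only; omega⟩
      ⟨hp.1, by rw [hpl, hκ l le_rfl (by omega)]⟩ hpr
    obtain ⟨hb, hal, har⟩ := har
    simp only at hb hal har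
    subst hb
    have hwa : (lat n).Adj w (a, b) := haw.symm
    -- removing an end of the run whose remainder still contains `a`
    have hremove : ∀ l' r' e : ℤ, l' ≤ a → a ≤ r' → l ≤ l' → r' ≤ l + (m + 1) →
        run l (l + (m + 1)) b = insert (e, b) (run l' r' b) → (e < l' ∨ r' < e) →
        ConnOn n (level n c κ \ {(e, b)}) := by
      intro l' r' e h3 h4 h5 h6 hrun he
      have hsub : ∀ x, x ∈ level n c κ \ run l (l + (m + 1)) b → x ∈ level n c κ \ {(e, b)} := by
        rintro x ⟨hx, hx'⟩
        refine ⟨hx, fun h => hx' ?_⟩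
        rw [hrun]; exact Or.inl h
      have hmono : latOn n (level n c κ \ run l (l + (m + 1)) b) ≤
          latOn n (level n c κ \ {(e, b)}) := fun x y hxy =>
        ⟨hxy.1, hsub _ hxy.2.1, hsub _ hxy.2.2⟩
      have hseg : ∀ i, l' ≤ i → i ≤ r' → InTri n (i, b) ∧ (i, b) ∈ level n c κ \ {(e, b)} := by
        intro i hi hi'
        refine ⟨hT i (by omega) (by omega), ⟨hT i (by omega) (by omega),
          hκ i (by omega) (by omega)⟩, ?_⟩
        simp; omega
      have htoa : ∀ x ∈ level n c κ \ {(e, b)},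
          (latOn n (level n c κ \ {(e, b)})).Reachable x (a, b) := by
        rintro ⟨x1, x2⟩ ⟨hx, hxe⟩
        by_cases hxr : (x1, x2) ∈ run l (l + (m + 1)) b
        · rw [hrun] at hxr
          rcases hxr with h | ⟨h7, h8, h9⟩
          · exact absurd h hxe
          · simp only at h7 h8 h9
            subst h7
            rcases le_total x1 a with h | h
            · exact reachable_row h fun i hi hi' => hseg i (by omega) (by omega)
            · exact (reachable_row h fun i hi hi' => hseg i (by omega) (by omega)).symm
        · refine ((hcon _ ⟨hx, hxr⟩ w hw).mono hmono).trans (SimpleGraph.Adj.reachable ?_)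
          exact ⟨hwa, hsub _ hw, (hseg a h3 h4).2⟩
      exact fun u hu v hv => (htoa u hu).trans (htoa v hv).symm
    -- Remove the end of the run that is not `a`. One equal pair inside the run is lost and one with
    -- the outer neighbour is gained, so the strict gain comes from the final single point.
    by_cases hla : l < a
    · have hrun : run l (l + (m + 1)) b = insert (l, b) (run (l + 1) (l + 1 + m) b) := by
        ext ⟨x, y⟩; simp only [run, Set.mem_ofPred_eq, Set.mem_insert_iff, Prod.mk.injEq]; omega
      have hcon' := hremove _ _ _ (by omega) (by omega) (by omega) (by omega) hrun (by omega)
      have hly := hκ l le_rfl (by omega)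
      have hadj : (lat n).Adj (l, b) (l - 1, b) := ⟨hT _ (by omega) (by omega),
        hT _ (by omega) (by omega), by simp [Nb]⟩
      have hP' := hP.update c hc (l - 1, b) (l, b) (hnb l le_rfl (by omega)) hadj
        (by rw [hly]; exact hcon')
      have hM := equalPairs_update (c := c) hl hj (n := n) (by omega) (c (l - 1, b))
      rw [hly, hκ (l + 1) (by omega) (by omega), if_neg h1, if_pos rfl, if_pos rfl] at hM
      suffices H : ∃ c', P c' ∧ equalPairs n (Function.update c (l, b) (c (l - 1, b))) <
          equalPairs n c' by
        obtain ⟨c', hc', hlt⟩ := H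
        exact ⟨c', hc', by omega⟩
      refine ih _ (l + 1) hP' (by omega) (by omega) ?_ ?_ ?_ ?_
      · intro i hi hi'
        rw [Function.update_of_ne (by simp; omega)]
        exact hκ i (by omega) (by omega)
      · rw [add_sub_cancel_right, Function.update_self]; exact h1
      · rw [Function.update_of_ne (by simp; omega)]
        convert h2 using 3; ring
      · rw [level_update_of_ne h1, Set.sdiff_sdiff, Set.singleton_union, ← hrun]
        exact hcon
    · have hrun : run l (l + (m + 1)) b = insert (l + (m + 1), b) (run l (l + m) b) := by
        ext ⟨x, y⟩; simp only [run, Set.mem_ofPred_eq, Set.mem_insert_iff, Prod.mk.injEq]; omega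
      have hcon' := hremove _ _ _ (by omega) (by omega) (by omega) (by omega) hrun (by omega)
      have hly := hκ (l + (m + 1)) (by omega) (by omega)
      have hadj : (lat n).Adj (l + (m + 1), b) (l + (m + 1) + 1, b) := ⟨hT _ (by omega) (by omega),
        hT _ (by omega) (by omega), by simp [Nb]⟩
      have hP' := hP.update c hc (l + (m + 1) + 1, b) (l + (m + 1), b)
        (hnb _ (by omega) (by omega)) hadj (by rw [hly]; exact hcon')
      have hM := equalPairs_update (c := c) (i := l + (m + 1)) (by omega) hj (n := n) (by omega)
        (c (l + (m + 1) + 1, b))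
      rw [hly, hκ (l + (m + 1) - 1) (by omega) (by omega), if_neg (Ne.symm h2), if_pos rfl,
        if_pos rfl] at hM
      suffices H : ∃ c', P c' ∧ equalPairs n (Function.update c (l + (m + 1), b)
          (c (l + (m + 1) + 1, b))) < equalPairs n c' by
        obtain ⟨c', hc', hlt⟩ := H
        exact ⟨c', hc', by omega⟩
      refine ih _ l hP' hl (by omega) ?_ ?_ ?_ ?_
      · intro i hi hi'
        rw [Function.update_of_ne (by simp; omega)]
        exact hκ i (by omega) (by omega)
      · rw [Function.update_of_ne (by simp; omega)]; exact h1
      · rw [show l + (m : ℤ) + 1 = l + (m + 1) by ring, Function.update_self]; exact h2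
      · rw [level_update_of_ne h2, Set.sdiff_sdiff, Set.singleton_union, ← hrun]
        exact hcon

end

section

variable {n : ℕ} {c : ℤ × ℤ → ℤ}

/-! ### Labelings with the maximal number of equal horizontal pairs -/

/-- A labeling in which no horizontal run in the interior can be dismantled. -/
structure Tight (n : ℕ) (c : ℤ × ℤ → ℤ) : Prop where
  valid : Valid n c
  conn : ∀ κ, ConnOn n (level n c κ)
  not_connOn : ∀ j l r κ : ℤ, 0 < j → 0 < l → l ≤ r → r + j < n →
    (∀ i, l ≤ i → i ≤ r → c (i, j) = κ) → c (l - 1, j) ≠ κ → c (r + 1, j) ≠ κ →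
    ¬ ConnOn n (level n c κ \ run l r j)

theorem Closed.tight {P : (ℤ × ℤ → ℤ) → Prop} (hP : Closed n P) (hc : P c)
    (hmax : ∀ c', P c' → equalPairs n c' ≤ equalPairs n c) : Tight n c := by
  refine ⟨hP.valid c hc, hP.conn c hc, fun j l r κ hj hl hlr hrj hκ h1 h2 hcon => ?_⟩
  obtain ⟨m, rfl⟩ : ∃ m : ℕ, r = l + m := ⟨(r - l).toNat, by omega⟩
  obtain ⟨c', hc', hlt⟩ := hP.exists_equalPairs_lt hj m c l hc hl hrj hκ h1 h2 hcon
  exact absurd (hmax c' hc') (by omega)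

theorem exists_run {f : ℤ → ℤ} {p m q : ℤ} (hpm : p ≤ m) (hmq : m ≤ q) (hp : f p ≠ f m)
    (hq : f q ≠ f m) : ∃ l r, p < l ∧ l ≤ m ∧ m ≤ r ∧ r < q ∧ (∀ i, l ≤ i → i ≤ r → f i = f m) ∧
      f (l - 1) ≠ f m ∧ f (r + 1) ≠ f m := by
  obtain ⟨a, ⟨ham, ha⟩, hamax⟩ := Int.exists_greatest_of_bdd (P := fun z => z ≤ m ∧ f z ≠ f m)
    ⟨m, fun z hz => hz.1⟩ ⟨p, hpm, hp⟩
  obtain ⟨b, ⟨hbm, hb⟩, hbmin⟩ := Int.exists_least_of_bdd (P := fun z => m ≤ z ∧ f z ≠ f m)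
    ⟨m, fun z hz => hz.1⟩ ⟨q, hmq, hq⟩
  have h1 : a ≠ m := by rintro rfl; exact ha rfl
  have h2 : b ≠ m := by rintro rfl; exact hb rfl
  have h3 := hamax p ⟨hpm, hp⟩
  have h4 := hbmin q ⟨hmq, hq⟩
  refine ⟨a + 1, b - 1, by omega, by omega, by omega, by omega, fun i hi hi' => ?_, by simpa,
    by simpa⟩
  by_contra hne
  rcases le_total i m with h | h
  · have := hamax i ⟨h, hne⟩; omega
  · have := hbmin i ⟨h, hne⟩; omega

/-- Between equal labels of the row `j` in the columns from `a` to `b` there are no other labels. -/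
def ConvexIn (c : ℤ × ℤ → ℤ) (j a b κ : ℤ) : Prop :=
  ∀ p q, a ≤ p → q ≤ b → c (p, j) = κ → c (q, j) = κ → ∀ i, p ≤ i → i ≤ q → c (i, j) = κ

/-- A run with no neighbours above and a segment of neighbours below (or conversely) of its label
is impossible. -/
theorem Tight.false_of_run (h : Tight n c) {j l r κ : ℤ} (hj : 0 < j) (hl : 0 < l) (hlr : l ≤ r)
    (hrj : r + j < n) (hκ : ∀ i, l ≤ i → i ≤ r → c (i, j) = κ) (h1 : c (l - 1, j) ≠ κ)
    (h2 : c (r + 1, j) ≠ κ)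
    (hnb : ((∀ i, l ≤ i → i ≤ r + 1 → c (i, j - 1) ≠ κ) ∧ ConvexIn c (j + 1) (l - 1) r κ) ∨
      ((∀ i, l - 1 ≤ i → i ≤ r → c (i, j + 1) ≠ κ) ∧ ConvexIn c (j - 1) l (r + 1) κ)) : False := by
  -- The outside neighbours of the run with its label form a segment on one side only, hence they
  -- stay connected without the run.
  refine h.not_connOn j l r κ hj hl hlr hrj hκ h1 h2 ((h.conn κ).sdiff ?_)
  have hadj : ∀ u ∈ level n c κ \ run l r j, (∃ s ∈ run l r j, (lat n).Adj u s) →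
      (u.2 = j - 1 ∧ l ≤ u.1 ∧ u.1 ≤ r + 1) ∨ (u.2 = j + 1 ∧ l - 1 ≤ u.1 ∧ u.1 ≤ r) := by
    rintro ⟨a, b⟩ ⟨⟨hT, ha⟩, har⟩ ⟨⟨x, y⟩, ⟨rfl, hx1, hx2⟩, hadj⟩
    simp only [run, Set.mem_ofPred_eq, not_and, not_le] at har hx1 hx2 ⊢
    have hn := hadj.2.2
    simp only [Nb, Prod.mk.injEq] at hn
    by_cases hby : b = y
    · subst hby
      exfalso
      by_cases hal : a = l - 1
      · subst hal; exact h1 ha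
      · by_cases har' : a = r + 1
        · subst har'; exact h2 ha
        · have := har rfl; omega
    · omega
  have hT1 : ∀ i, l ≤ i → i ≤ r + 1 → InTri n (i, j - 1) := by
    intro i hi hi'; simp only [InTri]; omega
  have hT2 : ∀ i, l - 1 ≤ i → i ≤ r → InTri n (i, j + 1) := by
    intro i hi hi'; simp only [InTri]; omega
  have hseg : ∀ j' a b : ℤ, j' ≠ j → (∀ i, a ≤ i → i ≤ b → InTri n (i, j')) →
      ConvexIn c j' a b κ → ∀ p q, a ≤ p → p ≤ b → a ≤ q → q ≤ b → c (p, j') = κ →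
      c (q, j') = κ → (latOn n (level n c κ \ run l r j)).Reachable (p, j') (q, j') := by
    intro j' a b hj' hT hconv
    have key : ∀ p q, a ≤ p → q ≤ b → c (p, j') = κ → c (q, j') = κ → p ≤ q →
        (latOn n (level n c κ \ run l r j)).Reachable (p, j') (q, j') := by
      intro p q hp hq hcp hcq hpq
      refine reachable_row hpq fun i hi hi' => ?_
      have hTi := hT i (by omega) (by omega)
      exact ⟨hTi, ⟨hTi, hconv p q hp hq hcp hcq i hi hi'⟩, fun hr => hj' hr.1⟩
    intro p q hp hp' hq hq' hcp hcq
    rcases le_total p q with hpq | hpq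
    · exact key p q hp hq' hcp hcq hpq
    · exact (key q p hq hp' hcq hcp hpq).symm
  intro u hu v hv hus hvs
  have hu' := hadj u hu hus
  have hv' := hadj v hv hvs
  obtain ⟨u1, u2⟩ := u
  obtain ⟨v1, v2⟩ := v
  simp only at hu' hv'
  rcases hnb with ⟨hno, hconv⟩ | ⟨hno, hconv⟩
  · rcases hu' with ⟨rfl, hu1, hu2⟩ | ⟨rfl, hu1, hu2⟩
    · exact absurd hu.1.2 (hno _ hu1 hu2)
    rcases hv' with ⟨rfl, hv1, hv2⟩ | ⟨rfl, hv1, hv2⟩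
    · exact absurd hv.1.2 (hno _ hv1 hv2)
    exact hseg _ _ _ (by omega) hT2 hconv u1 v1 hu1 hu2 hv1 hv2 hu.1.2 hv.1.2
  · rcases hu' with ⟨rfl, hu1, hu2⟩ | ⟨rfl, hu1, hu2⟩
    swap
    · exact absurd hu.1.2 (hno _ hu1 hu2)
    rcases hv' with ⟨rfl, hv1, hv2⟩ | ⟨rfl, hv1, hv2⟩
    swap
    · exact absurd hv.1.2 (hno _ hv1 hv2)
    exact hseg _ _ _ (by omega) hT1 hconv u1 v1 hu1 hu2 hv1 hv2 hu.1.2 hv.1.2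

/-- A gap in a row cannot be bridged from below. -/
theorem Tight.fill_above (h : Tight n c) (m : ℕ) : ∀ p q κ : ℤ, 0 ≤ p → p ≤ q → q + m ≤ n →
    c (p, m) = κ → c (q, m) = κ → (∀ i, p ≤ i → i < q → c (i, m + 1) = κ) →
    ∀ i, p ≤ i → i ≤ q → c (i, (m : ℤ)) = κ := by
  induction m with
  | zero =>
    intro p q κ hp hpq hqn hcp hcq _ i hi hi'
    have hrow : ∀ i : ℤ, 0 ≤ i → i ≤ n → c (i, 0) = i := by
      intro i h0 h1
      rw [h.valid.bdry _ (by simp [IsBdry, InTri]; omega)]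
      simp [idLabel, h0]
    simp only [Nat.cast_zero, add_zero] at *
    rw [hrow p hp (by omega)] at hcp
    rw [hrow q (by omega) hqn] at hcq
    rw [hrow i (by omega) (by omega)]
    omega
  | succ m ih =>
    intro p q κ hp hpq hqn hcp hcq hrow i hi hi'
    push_cast at *
    by_contra hne
    obtain ⟨l, r, hpl, hli, hir, hrq, hlr, h1, h2⟩ := exists_run
      (f := fun x => c (x, (m : ℤ) + 1)) hi hi' (by rw [hcp]; exact Ne.symm hne)
      (by rw [hcq]; exact Ne.symm hne)
    -- A maximal run of a different label in the gap has only `κ` below it. Above it, its label is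
    -- convex by induction, being bridged from below by the run itself.
    refine h.false_of_run (by omega) (by omega) (by omega) (by omega) hlr h1 h2 (Or.inr ⟨?_, ?_⟩)
    · intro k hk hk'
      rw [hrow k (by omega) (by omega)]
      exact Ne.symm hne
    · intro a b ha hb hca hcb k hk hk'
      rw [add_sub_cancel_right] at *
      exact ih a b _ (by omega) (by omega) (by omega) hca hcb
        (fun x hx hx' => hlr x (by omega) (by omega)) k hk hk'

/-- A gap in a row cannot be bridged from above. -/
theorem Tight.fill_below (h : Tight n c) (m : ℕ) : ∀ p q j κ : ℤ, (n : ℤ) ≤ j + m → 0 ≤ j → 0 ≤ p →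
    p ≤ q → q + j + 1 ≤ n → c (p, j + 1) = κ → c (q, j + 1) = κ →
    (∀ i, p < i → i ≤ q → c (i, j) = κ) → ∀ i, p ≤ i → i ≤ q → c (i, j + 1) = κ := by
  induction m with
  -- Vacuous, since row `j + 1` then lies outside the triangle.
  | zero => intros; omega
  | succ m ih =>
    intro p q j κ hm hj hp hpq hqn hcp hcq hrow i hi hi'
    push_cast at *
    by_contra hne
    obtain ⟨l, r, hpl, hli, hir, hrq, hlr, h1, h2⟩ := exists_run
      (f := fun x => c (x, j + 1)) hi hi' (by rw [hcp]; exact Ne.symm hne)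
      (by rw [hcq]; exact Ne.symm hne)
    refine h.false_of_run (by omega) (by omega) (by omega) (by omega) hlr h1 h2 (Or.inl ⟨?_, ?_⟩)
    · intro k hk hk'
      rw [add_sub_cancel_right, hrow k (by omega) (by omega)]
      exact Ne.symm hne
    · intro a b ha hb hca hcb k hk hk'
      exact ih a b (j + 1) _ (by omega) (by omega) (by omega) (by omega) (by omega) hca hcb
        (fun x hx hx' => hlr x (by omega) (by omega)) k hk hk'

/-- The walk is split at its first passage from row `j + 1` to row `j`. Both pieces are shorter than
the whole, as needed for the induction in `Tight.eq_of_walk`. -/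
theorem exists_last_step_up {S : Set (ℤ × ℤ)} {j : ℤ} {u v : ℤ × ℤ} (w : (latOn n S).Walk u v)
    (hu : j + 1 ≤ u.2) (hv : v.2 ≤ j) : ∃ (a b : ℤ × ℤ) (w₁ : (latOn n S).Walk u a)
      (w₂ : (latOn n S).Walk b v), (latOn n S).Adj a b ∧ a.2 = j + 1 ∧ b.2 = j ∧
      w₁.length < w.length ∧ w₂.length < w.length := by
  induction w with
  | nil => omega
  | @cons x y z hxy w ih =>
    by_cases hy : j + 1 ≤ y.2
    · obtain ⟨a, b, w₁, w₂, hab, ha, hb, h1, h2⟩ := ih hy hv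
      refine ⟨a, b, .cons hxy w₁, w₂, hab, ha, hb, ?_, ?_⟩ <;>
        simp only [SimpleGraph.Walk.length_cons] <;> omega
    · have hn := hxy.1.2.2
      simp only [Nb, Prod.ext_iff] at hn
      refine ⟨x, y, .nil, w, hxy, by omega, by omega, ?_, ?_⟩ <;> simp

theorem exists_last_step_down {S : Set (ℤ × ℤ)} {j : ℤ} {u v : ℤ × ℤ} (w : (latOn n S).Walk u v)
    (hu : u.2 ≤ j) (hv : j + 1 ≤ v.2) : ∃ (a b : ℤ × ℤ) (w₁ : (latOn n S).Walk u a)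
      (w₂ : (latOn n S).Walk b v), (latOn n S).Adj a b ∧ a.2 = j ∧ b.2 = j + 1 ∧
      w₁.length < w.length ∧ w₂.length < w.length := by
  induction w with
  | nil => omega
  | @cons x y z hxy w ih =>
    by_cases hy : y.2 ≤ j
    · obtain ⟨a, b, w₁, w₂, hab, ha, hb, h1, h2⟩ := ih hy hv
      refine ⟨a, b, .cons hxy w₁, w₂, hab, ha, hb, ?_, ?_⟩ <;>
        simp only [SimpleGraph.Walk.length_cons] <;> omega
    · have hn := hxy.1.2.2
      simp only [Nb, Prod.ext_iff] at hn
      refine ⟨x, y, .nil, w, hxy, by omega, by omega, ?_, ?_⟩ <;> simp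

/-- Induction on the length of the walk. If its first step leaves row `j`, consider the first
return, at `v`. The excursion fills a segment of the adjacent row by induction, so the part of row
`j` between `p` and `v` is filled by `Tight.fill_above` or `Tight.fill_below`. The rest of the walk
covers the remainder. -/
theorem Tight.eq_of_walk (h : Tight n c) {κ : ℤ} (N : ℕ) : ∀ (p q j : ℤ)
    (w : (latOn n (level n c κ)).Walk (p, j) (q, j)), w.length ≤ N →
    (p, j) ∈ level n c κ → ∀ i, (p ≤ i ∧ i ≤ q ∨ q ≤ i ∧ i ≤ p) → c (i, j) = κ := by
  induction N with
  | zero =>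
    intro p q j w hw hp i hi
    have := SimpleGraph.Walk.eq_of_length_eq_zero (Nat.le_zero.1 hw)
    simp only [Prod.mk.injEq, and_true] at this
    have : i = p := by omega
    rw [this]; exact hp.2
  | succ N ih =>
    intro p q j w hw hp i hi
    cases w with
    | nil =>
      have : i = p := by omega
      rw [this]; exact hp.2
    | @cons _ u _ hpu w =>
      obtain ⟨p1, j1⟩ := u
      simp only [SimpleGraph.Walk.length_cons] at hw
      have hn := hpu.1.2.2
      simp only [Nb, Prod.mk.injEq] at hn
      have hpT := hp.1
      simp only [InTri] at hpT
      rcases lt_trichotomy j1 j with hj | hj | hj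
      · obtain rfl : j = j1 + 1 := by omega
        obtain ⟨⟨z, z2⟩, ⟨v, v2⟩, w₁, w₂, hab, hz, hv, h1, h2⟩ :=
          exists_last_step_down w (j := j1) le_rfl le_rfl
        simp only at hz hv
        subst hz hv
        have hzv := hab.1.2.2
        simp only [Nb, Prod.mk.injEq] at hzv
        have i1 := ih _ _ _ w₁ (by omega) hpu.2.2
        have i2 := ih _ _ _ w₂ (by omega) hab.2.2
        have hvT := hab.2.2.1
        have huT := hpu.2.2.1
        simp only [InTri] at hvT huT
        have hcv : c (v, z2 + 1) = κ := hab.2.2.2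
        have hseg : ∀ i, (p ≤ i ∧ i ≤ v ∨ v ≤ i ∧ i ≤ p) → c (i, z2 + 1) = κ := by
          intro i hi
          rcases hi with ⟨h3, h4⟩ | ⟨h3, h4⟩
          · exact h.fill_below n p v z2 κ (by omega) (by omega) (by omega) (by omega) (by omega)
              hp.2 hcv (fun x hx hx' => i1 x (by omega)) i h3 h4
          · exact h.fill_below n v p z2 κ (by omega) (by omega) (by omega) (by omega) (by omega)
              hcv hp.2 (fun x hx hx' => i1 x (by omega)) i h3 h4
        by_cases hiv : p ≤ i ∧ i ≤ v ∨ v ≤ i ∧ i ≤ p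
        · exact hseg i hiv
        · exact i2 i (by omega)
      · subst hj
        by_cases hip : i = p
        · rw [hip]; exact hp.2
        · exact ih _ _ _ w (by omega) hpu.2.2 i (by omega)
      · obtain rfl : j1 = j + 1 := by omega
        obtain ⟨⟨z, z2⟩, ⟨v, v2⟩, w₁, w₂, hab, hz, hv, h1, h2⟩ :=
          exists_last_step_up w (j := j) le_rfl le_rfl
        simp only at hz hv
        subst hz hv
        have hzv := hab.1.2.2
        simp only [Nb, Prod.mk.injEq] at hzv
        have i1 := ih _ _ _ w₁ (by omega) hpu.2.2
        have i2 := ih _ _ _ w₂ (by omega) hab.2.2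
        have hvT := hab.2.2.1
        have huT := hpu.2.2.1
        simp only [InTri] at hvT huT
        have hcv : c (v, v2) = κ := hab.2.2.2
        obtain ⟨m, rfl⟩ : ∃ m : ℕ, v2 = m := ⟨v2.toNat, by omega⟩
        have hseg : ∀ i, (p ≤ i ∧ i ≤ v ∨ v ≤ i ∧ i ≤ p) → c (i, (m : ℤ)) = κ := by
          intro i hi
          rcases hi with ⟨h3, h4⟩ | ⟨h3, h4⟩
          · exact h.fill_above m p v κ (by omega) (by omega) (by omega)
              hp.2 hcv (fun x hx hx' => i1 x (by omega)) i h3 h4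
          · exact h.fill_above m v p κ (by omega) (by omega) (by omega)
              hcv hp.2 (fun x hx hx' => i1 x (by omega)) i h3 h4
        by_cases hiv : p ≤ i ∧ i ≤ v ∨ v ≤ i ∧ i ≤ p
        · exact hseg i hiv
        · exact i2 i (by omega)

/-- The rows of a component are segments. -/
theorem Tight.convex (h : Tight n c) {p q j i : ℤ} (hp : InTri n (p, j)) (hq : InTri n (q, j))
    (hpq : c (p, j) = c (q, j)) (h1 : p ≤ i) (h2 : i ≤ q) : c (i, j) = c (p, j) := by
  obtain ⟨w⟩ := h.conn (c (p, j)) (p, j) ⟨hp, rfl⟩ (q, j) ⟨hq, hpq.symm⟩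
  exact h.eq_of_walk w.length p q j w le_rfl ⟨hp, rfl⟩ i (Or.inl ⟨h1, h2⟩)

end

section

variable {n : ℕ} {c : ℤ × ℤ → ℤ}

/-! ### The labels of a tight labeling -/

theorem isBdry_left {j : ℤ} (h0 : 0 ≤ j) (h1 : j ≤ n) : IsBdry n (0, j) :=
  ⟨⟨le_rfl, h0, by simpa⟩, Or.inl rfl⟩

theorem isBdry_top {i : ℤ} (h0 : 0 ≤ i) (h1 : i ≤ n) : IsBdry n (i, 0) :=
  ⟨⟨h0, le_rfl, by simpa⟩, Or.inr (Or.inl rfl)⟩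

/-- Otherwise a run in the topmost row of the component would be interior, with nothing of its label
above and a segment below. -/
theorem Tight.exists_isBdry_above (h : Tight n c) {i j : ℤ} (hij : InTri n (i, j)) :
    ∃ p, IsBdry n p ∧ c p = c (i, j) ∧ p.2 ≤ j := by
  by_contra hcon
  push Not at hcon
  obtain ⟨t, ⟨x, hx, hxc⟩, hmin⟩ := Int.exists_least_of_bdd
    (P := fun t => ∃ x, InTri n (x, t) ∧ c (x, t) = c (i, j))
    ⟨0, fun z ⟨x, hx, _⟩ => hx.2.1⟩ ⟨j, i, hij, rfl⟩
  have htj : t ≤ j := hmin j ⟨i, hij, rfl⟩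
  have hnot : ∀ y, IsBdry n (y, t) → c (y, t) ≠ c (x, t) := fun y hy he =>
    absurd (hcon _ hy (he.trans hxc)) (not_lt.2 htj)
  have hx' := hx
  simp only [InTri] at hx'
  have ht : 0 < t := by
    by_contra h0
    exact hnot x ⟨hx, by simp only; omega⟩ rfl
  obtain ⟨l, r, hl, hlx, hxr, hr, hlr, h1, h2⟩ := exists_run (f := fun y => c (y, t)) (p := 0)
    (m := x) (q := n - t) hx'.1 (by omega) (hnot _ (isBdry_left (by omega) (by omega)))
    (hnot _ (by simp only [IsBdry, InTri]; omega))
  refine h.false_of_run ht hl (by omega) (by omega) hlr h1 h2 (Or.inl ⟨?_, ?_⟩)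
  · intro k hk hk' he
    have := hmin (t - 1) ⟨k, by simp only [InTri]; omega, he.trans hxc⟩
    omega
  · intro p q hp hq hcp hcq k hk hk'
    rw [← hcp]
    exact h.convex (by simp only [InTri]; omega) (by simp only [InTri]; omega)
      (hcp.trans hcq.symm) hk hk'

theorem Tight.exists_isBdry_below (h : Tight n c) {i j : ℤ} (hij : InTri n (i, j)) :
    ∃ p, IsBdry n p ∧ c p = c (i, j) ∧ j ≤ p.2 := by
  by_contra hcon
  push Not at hcon
  obtain ⟨t, ⟨x, hx, hxc⟩, hmax⟩ := Int.exists_greatest_of_bdd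
    (P := fun t => ∃ x, InTri n (x, t) ∧ c (x, t) = c (i, j))
    ⟨n, fun z ⟨x, hx, _⟩ => by simp only [InTri] at hx; omega⟩ ⟨j, i, hij, rfl⟩
  have htj : j ≤ t := hmax j ⟨i, hij, rfl⟩
  have hnot : ∀ y, IsBdry n (y, t) → c (y, t) ≠ c (x, t) := fun y hy he =>
    absurd (hcon _ hy (he.trans hxc)) (not_lt.2 htj)
  have hx' := hx
  simp only [InTri] at hx'
  have ht : 0 < t := by
    by_contra h0
    exact hnot x ⟨hx, by simp only; omega⟩ rfl
  obtain ⟨l, r, hl, hlx, hxr, hr, hlr, h1, h2⟩ := exists_run (f := fun y => c (y, t)) (p := 0)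
    (m := x) (q := n - t) hx'.1 (by omega) (hnot _ (isBdry_left (by omega) (by omega)))
    (hnot _ (by simp only [IsBdry, InTri]; omega))
  refine h.false_of_run ht hl (by omega) (by omega) hlr h1 h2 (Or.inr ⟨?_, ?_⟩)
  · intro k hk hk' he
    have := hmax (t + 1) ⟨k, by simp only [InTri]; omega, he.trans hxc⟩
    omega
  · intro p q hp hq hcp hcq k hk hk'
    rw [← hcp]
    exact h.convex (by simp only [InTri]; omega) (by simp only [InTri]; omega)
      (hcp.trans hcq.symm) hk hk'

/-- The label occurs on the boundary both at or above row `j` and at or below it. In the upper half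
only the labels from `j` to `n - j` do so. -/
theorem Tight.mem_range (h : Tight n c) {i j : ℤ} (hij : InTri n (i, j)) (hj : 2 * j < n) :
    j ≤ c (i, j) ∧ c (i, j) ≤ n - j := by
  obtain ⟨⟨a, b⟩, hp, hpc, hpj⟩ := h.exists_isBdry_above hij
  obtain ⟨⟨a', b'⟩, hq, hqc, hqj⟩ := h.exists_isBdry_below hij
  rw [h.valid.bdry _ hp] at hpc
  rw [h.valid.bdry _ hq] at hqc
  rw [← hpc] at hqc ⊢
  simp only [IsBdry, InTri, idLabel] at *
  split_ifs at * <;> omega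

/-- In the lower half the two ends of a row have the same label, and convexity fills the row. -/
theorem Tight.eq_idLabel_of_le (h : Tight n c) {i j : ℤ} (hij : InTri n (i, j)) (hj : n ≤ 2 * j) :
    c (i, j) = idLabel n (i, j) := by
  have hij' := hij
  simp only [InTri] at hij'
  have hl : IsBdry n (0, j) := isBdry_left (by omega) (by omega)
  have hr : IsBdry n (n - j, j) := by simp only [IsBdry, InTri]; omega
  rw [h.convex hl.1 hr.1 ?_ hij'.1 (by omega), h.valid.bdry _ hl]
  · simp only [idLabel]; split_ifs <;> omega
  · rw [h.valid.bdry _ hl, h.valid.bdry _ hr]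
    simp only [idLabel]; split_ifs <;> omega

theorem Valid.top (h : Valid n c) {i : ℤ} (h0 : 0 ≤ i) (h1 : i ≤ n) : c (i, 0) = i := by
  rw [h.bdry _ (isBdry_top h0 h1), idLabel, if_pos h0]

theorem Tight.exists_step (h : Tight n c) {j k : ℤ} {p : ℤ × ℤ} (hp : InTri n p) (hpc : c p = k)
    (hpj : j + 1 ≤ p.2) (hj : 0 ≤ j) (h0 : 0 ≤ k) (hk : k ≤ n) :
    ∃ y z, InTri n (y, j + 1) ∧ c (y, j + 1) = k ∧ InTri n (z, j) ∧ c (z, j) = k ∧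
      (z = y ∨ z = y + 1) := by
  obtain ⟨w⟩ := h.conn k p ⟨hp, hpc⟩ (k, 0)
    ⟨by simp only [InTri]; omega, h.valid.top h0 hk⟩
  obtain ⟨⟨y, y2⟩, ⟨z, z2⟩, _, _, hab, ha, hb, _⟩ := exists_last_step_up w hpj hj
  simp only at ha hb
  subst ha hb
  have hn := hab.1.2.2
  simp only [Nb, Prod.mk.injEq] at hn
  exact ⟨y, z, hab.2.1.1, hab.2.1.2, hab.2.2.1, hab.2.2.2, by omega⟩

/-- The component of `k` joins the top point `(k, 0)` to a boundary point in row `j` or below, so it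
meets row `j`. -/
theorem Tight.exists_eq (h : Tight n c) {j k : ℤ} (h0 : 0 ≤ j) (hjk : j ≤ k)
    (hk : k ≤ n - j) : ∃ i, InTri n (i, j) ∧ c (i, j) = k := by
  obtain ⟨p, hp, hpk, hpj⟩ : ∃ p, IsBdry n p ∧ idLabel n p = k ∧ j ≤ p.2 := by
    by_cases h2 : 2 * k ≤ n
    · refine ⟨(0, k), isBdry_left (by omega) (by omega), ?_, hjk⟩
      · simp only [idLabel]; split_ifs <;> omega
    · refine ⟨(k, n - k), ?_, ?_, by simp only; omega⟩
      · simp only [IsBdry, InTri]; omega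
      · simp only [idLabel]; split_ifs <;> omega
  rw [← h.valid.bdry p hp] at hpk
  rcases eq_or_lt_of_le hpj with he | hlt
  · exact ⟨p.1, by rw [he]; exact hp.1, by rw [he]; exact hpk⟩
  · obtain ⟨_, z, _, _, hz, hzk, _⟩ := h.exists_step hp.1 hpk hlt h0 (by omega) (by omega)
    exact ⟨z, hz, hzk⟩

/-- Induction on the row: different labels occupy disjoint segments, and a step up inside each
component keeps their order. The top row is increasing. -/
theorem Tight.monotone (h : Tight n c) (m : ℕ) (hm : 2 * m < n) : ∀ p q : ℤ, 0 ≤ p → p ≤ q →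
    q + m ≤ n → c (p, (m : ℤ)) ≤ c (q, (m : ℤ)) := by
  induction m with
  | zero =>
    intro p q hp hpq hq
    simp only [Nat.cast_zero, add_zero] at *
    rwa [h.valid.top hp (by omega), h.valid.top (by omega) hq]
  | succ m ih =>
    intro p q hp hpq hq
    push_cast at *
    by_cases hne : c (p, (m : ℤ) + 1) = c (q, (m : ℤ) + 1)
    · exact hne.le
    have hpT : InTri n (p, (m : ℤ) + 1) := by simp only [InTri]; omega
    have hqT : InTri n (q, (m : ℤ) + 1) := by simp only [InTri]; omega
    have hpr := h.mem_range hpT (by omega)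
    have hqr := h.mem_range hqT (by omega)
    obtain ⟨y, z, hyT, hy, hzT, hz, hyz⟩ := h.exists_step (j := m) hpT rfl le_rfl
      (by omega) (by omega) (by omega)
    obtain ⟨y', z', hyT', hy', hzT', hz', hyz'⟩ := h.exists_step (j := m) hqT rfl le_rfl
      (by omega) (by omega) (by omega)
    have h1 : y < q := by
      by_contra hcon
      exact hne (h.convex hpT hyT hy.symm hpq (by omega)).symm
    have h2 : p < y' := by
      by_contra hcon
      exact hne ((h.convex hyT' hqT hy' (by omega) hpq).trans hy')
    have h3 : y < y' := by
      by_contra hcon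
      exact hne ((h.convex hpT hyT hy.symm h2.le (by omega)).symm.trans hy')
    have := ih (by omega) z z' hzT.1 (by omega) hzT'.2.2
    rwa [hz, hz'] at this

/-- A larger jump would skip a label that has to occur in the row. -/
theorem Tight.le_add_one (h : Tight n c) {i j : ℤ} (h0 : 0 ≤ j) (hj : 2 * j < n) (hi : 0 ≤ i)
    (hij : i + 1 + j ≤ n) : c (i + 1, j) ≤ c (i, j) + 1 := by
  obtain ⟨m, rfl⟩ : ∃ m : ℕ, j = m := ⟨j.toNat, by omega⟩
  by_contra hcon
  have h1 := h.mem_range (i := i) (j := m) (by simp only [InTri]; omega) hj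
  have h2 := h.mem_range (i := i + 1) (j := m) (by simp only [InTri]; omega) hj
  obtain ⟨x, hx, hxc⟩ := h.exists_eq (k := c (i, (m : ℤ)) + 1) h0 (by omega) (by omega)
  rcases le_or_gt x i with hxi | hxi
  · have := h.monotone m (by omega) x i hx.1 hxi (by omega)
    omega
  · have := h.monotone m (by omega) (i + 1) x (by omega) (by omega) hx.2.2
    omega

/-- The right end of the row has label `n - j`, and going right the labels grow by at most one per
step. -/
theorem Tight.le_label (h : Tight n c) {i j : ℤ} (hij : InTri n (i, j)) (hj : 2 * j < n) :
    i ≤ c (i, j) := by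
  have hij' := hij
  simp only [InTri] at hij'
  have key : ∀ q, i ≤ q → q + j ≤ n → c (q, j) ≤ c (i, j) + (q - i) := by
    intro q hq
    induction q, hq using Int.leInduction with
    | base => intro; omega
    | succ q hq ih =>
      intro hqn
      have := ih (by omega)
      have := h.le_add_one hij'.2.1 hj (i := q) (by omega) hqn
      omega
  have h1 := key (n - j) (by omega) (by omega)
  have hr : IsBdry n (n - j, j) := by simp only [IsBdry, InTri]; omega
  rw [h.valid.bdry _ hr, idLabel, if_pos (by simp only; omega)] at h1
  simp only at h1
  omega

/-! ### Lowering labels down to the identity labeling. -/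

theorem idLabel_le (p : ℤ × ℤ) (hp : InTri n p) : -(n : ℤ) ≤ idLabel n p ∧ idLabel n p ≤ n := by
  simp only [InTri, idLabel] at *
  split_ifs <;> omega

/-- The labels, shifted to be nonnegative, in total. -/
noncomputable def totalLabel (n : ℕ) (c : ℤ × ℤ → ℤ) : ℕ :=
  ∑ p ∈ Finset.Icc (0 : ℤ) n ×ˢ Finset.Icc (0 : ℤ) n, (c p + n).toNat

theorem exists_minimal_nat {α : Type*} {P : α → Prop} (f : α → ℕ) (h : ∃ a, P a) :
    ∃ a, P a ∧ ∀ b, P b → f a ≤ f b := by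
  obtain ⟨a, ha, hmin⟩ := (measure f).wf.has_min {a | P a} h
  exact ⟨a, ha, fun b hb => not_lt.1 (hmin b hb)⟩

/-- If a tight labeling is not the one of the identity configuration, then some label can be
decreased by one without changing the number of equal horizontal pairs. -/
theorem Tight.exists_decrease (h : Tight n c) (hne : ∃ p, InTri n p ∧ c p ≠ idLabel n p) :
    ∃ l j : ℤ, 0 < l ∧ 0 < j ∧ l + j < n ∧ 0 < c (l, j) ∧ c (l - 1, j) = c (l, j) - 1 ∧
      c (l + 1, j) = c (l, j) ∧ ConnOn n (level n c (c (l, j)) \ {(l, j)}) := by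
  obtain ⟨p, hpT, hp⟩ := hne
  -- The largest label that occurs at a wrong place.
  obtain ⟨k, ⟨⟨i, j⟩, hijT, hij, hk⟩, hmax⟩ := Int.exists_greatest_of_bdd
    (P := fun k => ∃ p, InTri n p ∧ c p ≠ idLabel n p ∧ c p = k)
    ⟨n, by
      rintro k ⟨p, hpT, _, rfl⟩
      obtain ⟨b, hb, hbp⟩ := h.valid.onBdry p hpT
      rw [← hbp, h.valid.bdry b hb]
      exact (idLabel_le b hb.1).2⟩ ⟨_, p, hpT, hp, rfl⟩
  have hijT' := hijT
  simp only [InTri] at hijT'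
  have hj : 2 * j < n := by
    by_contra hcon
    exact hij (h.eq_idLabel_of_le hijT (by omega))
  have hrange := h.mem_range hijT hj
  have hle := h.le_label hijT hj
  rw [hk] at hrange hle
  have hj0 : 0 < j := by
    by_contra hcon
    exact hij (h.valid.bdry _ ⟨hijT, by simp only; omega⟩)
  have hki : i < k ∧ j < k := by
    rw [hk] at hij
    simp only [idLabel] at hij
    split_ifs at hij <;> omega
  -- A wrong label in column `k` would exceed `k` by `Tight.le_label`, against the choice of `k`.
  have hcol : ∀ t, 0 ≤ t → t ≤ k → t ≤ n - k → c (k, t) = k := by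
    intro t h0 h1 h2
    have hT : InTri n (k, t) := by simp only [InTri]; omega
    have hid : idLabel n (k, t) = k := by rw [idLabel, if_pos h1]
    by_contra hcon
    have h3 := hmax _ ⟨(k, t), hT, by rwa [hid], rfl⟩
    by_cases ht : 2 * t < n
    · have := h.le_label hT ht
      omega
    · exact hcon ((h.eq_idLabel_of_le hT (by omega)).trans hid)
  have hbound : ∀ x t, InTri n (x, t) → c (x, t) = k → t ≤ k ∧ t ≤ n - k ∧ x ≤ k := by
    intro x t hT hxt
    by_cases ht : 2 * t < n
    · have h1 := h.mem_range hT ht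
      have h2 := h.le_label hT ht
      omega
    · rw [h.eq_idLabel_of_le hT (by omega)] at hxt
      simp only [InTri, idLabel] at hT hxt
      split_ifs at hxt <;> omega
  -- The left tip of the component in row `j`.
  obtain ⟨l, ⟨hl0, hl⟩, hlmin⟩ := Int.exists_least_of_bdd (P := fun x => 0 ≤ x ∧ c (x, j) = k)
    ⟨0, fun z hz => hz.1⟩ ⟨i, hijT'.1, hk⟩
  have hli : l ≤ i := hlmin i ⟨hijT'.1, hk⟩
  have hlT : InTri n (l, j) := by simp only [InTri]; omega
  have hkT : InTri n (k, j) := by simp only [InTri]; omega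
  have hkj := hcol j hj0.le hki.2.le (by omega)
  have hlpos : 0 < l := by
    rcases eq_or_lt_of_le hl0 with rfl | h1
    · rw [h.valid.bdry _ ⟨hlT, Or.inl rfl⟩] at hl
      simp only [idLabel] at hl
      split_ifs at hl <;> omega
    · exact h1
  have hprev : c (l - 1, j) = k - 1 := by
    have h1 := h.le_add_one (i := l - 1) hj0.le hj (by omega) (by omega)
    obtain ⟨m, rfl⟩ : ∃ m : ℕ, j = m := ⟨j.toNat, by omega⟩
    have h2 := h.monotone m (by omega) (l - 1) l (by omega) (by omega) (by omega)
    rw [sub_add_cancel, hl] at h1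
    have h3 : c (l - 1, (m : ℤ)) ≠ k := fun he => by
      have := hlmin (l - 1) ⟨by omega, he⟩
      omega
    omega
  refine ⟨l, j, hlpos, hj0, by omega, by omega, by rw [hprev, hl], ?_, ?_⟩
  · exact h.convex hlT hkT (hl.trans hkj.symm) (by omega) (by omega)
  · rw [hl]
    -- The component is a comb: column `k` with horizontal segments attached on its left. Removing a
    -- tip keeps it connected.
    have hto : ∀ u ∈ level n c k \ {(l, j)},
        (latOn n (level n c k \ {(l, j)})).Reachable (k, 0) u := by
      rintro ⟨x, t⟩ ⟨⟨hT, hx⟩, hxl⟩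
      obtain ⟨h1, h2, h3⟩ := hbound x t hT hx
      have hT' := hT
      simp only [InTri] at hT'
      have hkt := hcol t hT'.2.1 h1 h2
      have hktT : InTri n (k, t) := by simp only [InTri]; omega
      refine (reachable_column hT'.2.1 fun s hs hs' => ?_).trans
        (reachable_row h3 fun y hy hy' => ?_).symm
      · have hsT : InTri n (k, s) := by simp only [InTri]; omega
        refine ⟨hsT, ⟨hsT, hcol s hs (by omega) (by omega)⟩, ?_⟩
        simp; omega
      · have hyT : InTri n (y, t) := by simp only [InTri]; omega
        refine ⟨hyT, ⟨hyT, (h.convex hT hktT (hx.trans hkt.symm) hy hy').trans hx⟩, ?_⟩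
        rintro he
        simp only [Set.mem_singleton_iff, Prod.mk.injEq] at he hxl
        obtain ⟨rfl, rfl⟩ := he
        have := hlmin x ⟨hT'.1, hx⟩
        omega
    exact fun u hu v hv => (hto u hu).symm.trans (hto v hv)

/-- The labeling of the identity configuration can be reached. -/
theorem Closed.exists_idLabel {P : (ℤ × ℤ → ℤ) → Prop} (hP : Closed n P) (hne : ∃ c, P c) :
    ∃ c, P c ∧ ∀ p, InTri n p → c p = idLabel n p := by
  -- A lexicographic choice: the maximal number of equal pairs, expressed by minimising its
  -- complement, and then the least total label.
  obtain ⟨c₀, hc₀, hmax⟩ := exists_minimal_nat (fun c => (pairs n).card - equalPairs n c) hne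
  obtain ⟨c, ⟨hc, hcM⟩, hmin⟩ := exists_minimal_nat (totalLabel n)
    (P := fun c => P c ∧ equalPairs n c = equalPairs n c₀) ⟨c₀, hc₀, rfl⟩
  have ht : Tight n c := hP.tight hc fun c' hc' => by
    have := hmax c' hc'
    have := equalPairs_le (n := n) c'
    have := equalPairs_le (n := n) c
    omega
  refine ⟨c, hc, ?_⟩
  by_contra hcon
  push Not at hcon
  obtain ⟨l, j, hl, hj, hlj, hpos, h1, h2, hconn⟩ := ht.exists_decrease hcon
  have hadj : (lat n).Adj (l, j) (l - 1, j) := by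
    refine ⟨?_, ?_, by simp [Nb]⟩ <;> simp only [InTri] <;> omega
  have hP' := hP.update c hc (l - 1, j) (l, j) (by simp only [IsBdry, InTri]; omega) hadj hconn
  have hM := equalPairs_update (c := c) hl hj hlj (c (l - 1, j))
  -- The pair on the right is lost and the one on the left is gained, so the maximum is kept while
  -- the total label drops.
  rw [h2, if_neg (by omega), if_pos rfl, if_pos rfl] at hM
  have hle := hmin _ ⟨hP', by omega⟩
  refine absurd hle (not_le.2 ?_)
  refine Finset.sum_lt_sum (fun p _ => ?_) ⟨(l, j), ?_, ?_⟩
  · by_cases hp : p = (l, j)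
    · subst hp
      rw [Function.update_self, h1]
      omega
    · rw [Function.update_of_ne hp]
  · simp only [Finset.mem_product, Finset.mem_Icc]; omega
  · rw [Function.update_self, h1]
    omega

end

section

variable {n : ℕ}

/-! ### The identity configuration -/

/-- The identity configuration: row edges to the left of the diagonal and column edges above it. -/
def idGraph (n : ℕ) : SimpleGraph (ℤ × ℤ) where
  Adj p q := InTri n p ∧ InTri n q ∧ ((q = (p.1 + 1, p.2) ∧ p.1 < p.2) ∨
    (p = (q.1 + 1, q.2) ∧ q.1 < q.2) ∨ (q = (p.1, p.2 + 1) ∧ p.2 < p.1) ∨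
    (p = (q.1, q.2 + 1) ∧ q.2 < q.1))
  symm := ⟨fun p q h => ⟨h.2.1, h.1, by tauto⟩⟩
  loopless := ⟨fun p h => by simp [Prod.ext_iff] at h⟩

theorem not_reachable_of_closed {V : Type*} {G : SimpleGraph V} (U : V → Prop) {x y : V}
    (hU : ∀ a b, G.Adj a b → U a → U b) (hx : U x) (hy : ¬ U y) : ¬ G.Reachable x y := by
  intro h
  rw [SimpleGraph.reachable_iff_reflTransGen] at h
  refine hy ?_
  induction h with
  | refl => exact hx
  | tail _ hab ih => exact hU _ _ hab (ih fun hb => hy (hU _ _ hab hb))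

/-- Every edge is a bridge: without it, the part of its row to the left, or of its column above, is
closed under adjacency. -/
theorem idGraph_acyclic (n : ℕ) : (idGraph n).IsAcyclic := by
  rw [SimpleGraph.isAcyclic_iff_forall_adj_isBridge]
  have hrow : ∀ i j : ℤ, i < j → (idGraph n).IsBridge s((i, j), (i + 1, j)) := by
    intro i j hij
    rw [SimpleGraph.isBridge_iff]
    refine not_reachable_of_closed (fun p => p.2 = j ∧ p.1 ≤ i) ?_ ⟨rfl, le_rfl⟩ (by simp)
    rintro ⟨a, b⟩ ⟨k, l⟩ hab ⟨h1, h2⟩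
    simp only [SimpleGraph.deleteEdges_adj, idGraph, Set.mem_singleton_iff, Sym2.eq_iff,
      Prod.mk.injEq] at hab h1 h2 ⊢
    omega
  have hcol : ∀ i j : ℤ, j < i → (idGraph n).IsBridge s((i, j), (i, j + 1)) := by
    intro i j hij
    rw [SimpleGraph.isBridge_iff]
    refine not_reachable_of_closed (fun p => p.1 = i ∧ p.2 ≤ j) ?_ ⟨rfl, le_rfl⟩ (by simp)
    rintro ⟨a, b⟩ ⟨k, l⟩ hab ⟨h1, h2⟩
    simp only [SimpleGraph.deleteEdges_adj, idGraph, Set.mem_singleton_iff, Sym2.eq_iff,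
      Prod.mk.injEq] at hab h1 h2 ⊢
    omega
  rintro ⟨i, j⟩ ⟨k, l⟩ ⟨_, _, ⟨h, hlt⟩ | ⟨h, hlt⟩ | ⟨h, hlt⟩ | ⟨h, hlt⟩⟩
  · rw [h]; exact hrow _ _ hlt
  · rw [h, Sym2.eq_swap]; exact hrow _ _ hlt
  · rw [h]; exact hcol _ _ hlt
  · rw [h, Sym2.eq_swap]; exact hcol _ _ hlt

theorem idGraph_reachable_row {p q j : ℤ} (hp : 0 ≤ p) (hpq : p ≤ q) (hqj : q ≤ j)
    (hq : q + j ≤ n) : (idGraph n).Reachable (p, j) (q, j) := by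
  induction q, hpq using Int.leInduction with
  | base => exact SimpleGraph.Reachable.refl _
  | succ q hpq ih =>
    refine (ih (by omega) (by omega)).trans (SimpleGraph.Adj.reachable ?_)
    refine ⟨?_, ?_, Or.inl ⟨rfl, by simp only; omega⟩⟩ <;> simp only [InTri] <;> omega

theorem idGraph_reachable_column {p q i : ℤ} (hp : 0 ≤ p) (hpq : p ≤ q) (hqi : q ≤ i)
    (hq : i + q ≤ n) : (idGraph n).Reachable (i, p) (i, q) := by
  induction q, hpq using Int.leInduction with
  | base => exact SimpleGraph.Reachable.refl _
  | succ q hpq ih =>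
    refine (ih (by omega) (by omega)).trans (SimpleGraph.Adj.reachable ?_)
    refine ⟨?_, ?_, Or.inr (Or.inr (Or.inl ⟨rfl, by simp only; omega⟩))⟩ <;>
      simp only [InTri] <;> omega

/-- A boundary point with the label `κ`. -/
def idPoint (κ : ℤ) : ℤ × ℤ := if 0 ≤ κ then (κ, 0) else (0, -κ)

theorem isBdry_idPoint {p : ℤ × ℤ} (hp : InTri n p) : IsBdry n (idPoint (idLabel n p)) := by
  have h := idLabel_le p hp
  rw [idPoint]
  split_ifs with h0
  · exact isBdry_top h0 h.2
  · exact isBdry_left (by omega) (by omega)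

theorem idGraph_reachable_idPoint {p : ℤ × ℤ} (hp : InTri n p) :
    (idGraph n).Reachable p (idPoint (idLabel n p)) := by
  obtain ⟨i, j⟩ := p
  simp only [InTri] at hp
  simp only [idLabel, idPoint]
  by_cases h1 : j ≤ i
  · rw [if_pos h1, if_pos hp.1]
    exact (idGraph_reachable_column le_rfl hp.2.1 h1 hp.2.2).symm
  · rw [if_neg h1]
    by_cases h2 : 2 * j ≤ n
    · rw [if_pos h2, if_pos hp.2.1]
      exact (idGraph_reachable_row hp.1 (by omega) le_rfl (by omega)).trans
        (idGraph_reachable_column le_rfl hp.2.1 le_rfl (by omega)).symm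
    · rw [if_neg h2, if_neg (by omega), neg_neg]
      exact (idGraph_reachable_row le_rfl hp.1 (by omega) hp.2.2).symm

theorem idGraph_forest (n : ℕ) : Forest n (idLabel n) (idGraph n) := by
  refine ⟨?_, idGraph_acyclic n, fun u v hu hv => ⟨fun h => ?_, fun h => ?_⟩⟩
  · rintro p q ⟨hp, hq, h⟩
    refine ⟨hp, hq, ?_⟩
    simp only [Nb]
    tauto
  · rw [SimpleGraph.reachable_iff_reflTransGen] at h
    clear hv
    induction h with
    | refl => rfl
    | @tail a b _ hab ih =>
      rw [ih]
      obtain ⟨a1, a2⟩ := a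
      obtain ⟨b1, b2⟩ := b
      simp only [idGraph, InTri, Prod.mk.injEq] at hab
      simp only [idLabel]
      split_ifs <;> omega
  · have := idGraph_reachable_idPoint hu
    rw [h] at this
    exact this.trans (idGraph_reachable_idPoint hv).symm

theorem valid_idLabel (n : ℕ) : Valid n (idLabel n) :=
  ⟨fun _ _ => rfl, fun _ hx => ⟨_, isBdry_idPoint hx,
    ((idGraph_forest n).reach _ _ (isBdry_idPoint hx).1 hx).1 (idGraph_reachable_idPoint hx).symm⟩⟩

/-- A downward triangle contains exactly one edge of the graph, except those with upper left corner
on the diagonal `i = j`, which contain none. -/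
theorem arr_idGraph (n : ℕ) : arr n (idGraph n) = identityTriangle n := by
  funext ⟨t, ht⟩
  obtain ⟨i, j, hi, hj, hn, rfl⟩ := mem_cells_iff.1 ht
  have h1 : (idGraph n).Adj (i, j) (i + 1, j) ↔ i < j := by
    simp [idGraph, InTri]; omega
  have h2 : (idGraph n).Adj (i, j) (i, j + 1) ↔ j < i := by
    simp [idGraph, InTri]; omega
  have h3 : ¬ (idGraph n).Adj (i + 1, j) (i, j + 1) := by
    simp [idGraph, Prod.ext_iff]
  simp only [arr, corner_toPt, entry, h1, h2, h3, if_false]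
  simp only [identityTriangle, toPt]
  split_ifs <;> omega

theorem Forest.congr {c c' : ℤ × ℤ → ℤ} {G : SimpleGraph (ℤ × ℤ)} (h : Forest n c G)
    (hc : ∀ p, InTri n p → c p = c' p) : Forest n c' G :=
  ⟨h.le, h.acyclic, fun u v hu hv => by rw [h.reach u v hu hv, hc u hu, hc v hv]⟩

theorem IsAlternatingSignTriangle.reach_identityTriangle {A : TriArray n}
    (hA : IsAlternatingSignTriangle A) : Reach n A (identityTriangle n) := by
  obtain ⟨c₀, G₀, hc₀, hG₀, rfl⟩ := exists_forest_of_isAlternatingSignTriangle hA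
  have hP : Closed n fun c => Valid n c ∧ ∃ G, Forest n c G ∧ Reach n (arr n G₀) (arr n G) := by
    refine ⟨fun c h => h.1, fun c ⟨_, G, hG, _⟩ κ => hG.connOn κ, ?_⟩
    rintro c ⟨hc, G, hG, hr⟩ x y hy hyx hcon
    obtain ⟨H, hH, hGH⟩ := hG.exists_update hc hy hyx hcon
    exact ⟨hc.update hy hyx, H, hH, hr.trans hGH⟩
  obtain ⟨c, ⟨_, G, hG, hr⟩, heq⟩ := hP.exists_idLabel
    ⟨c₀, hc₀, G₀, hG₀, Relation.ReflTransGen.refl⟩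
  rw [← arr_idGraph]
  exact hr.trans ((hG.congr heq).reach_arr (idGraph_forest n) (valid_idLabel n))

end

end SignTriangles

theorem theorem5 (n : ℕ) (A : SignTriangles.TriArray n)
    (hA : SignTriangles.IsAlternatingSignTriangle A) :
    Relation.ReflTransGen
      (fun B C : SignTriangles.TriArray n =>
        SignTriangles.IsAlternatingSignTriangle B ∧
        SignTriangles.IsAlternatingSignTriangle C ∧
        SignTriangles.AddsSubTriangle B C)
      A (SignTriangles.identityTriangle n) :=
  hA.reach_identityTriangle
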